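/- Consider the problem DISTINCT ($F_0$): the input is a data stream of $m$ updates $(i,\delta)$ with $i$ in a universe of $n \ge 2$ items and $\delta \in \mathbb{Z}$; the frequency $a_i$ of an item is the sum of all $\delta$ that occur with $i$, and the goal is to compute $|\{i : a_i \neq 0\}|$. Assume $m = \Theta(n)$. Let $q > \max\{m,n\}$ be a Mersenne prime, and consider the streams in which no nonzero frequency $a_i$ is divisible by $q$ (this holds, for example, whenever all $\delta \in \{-1,0,1\}$, because then $|a_i| \le m < q$). Then there is a valid interactive proof protocol $(\mathcal{P},\mathcal{V})$ over the field $\mathbb{F}_q$ for DISTINCT: on every such stream $x$, in conversation with $\mathcal{P}$ the verifier $\mathcal{V}$ outputs the number of distinct items of $x$ with probability $1$, and in conversation with an arbitrary (computationally unbounded) prover $\mathcal{P}'$ the probability that $\mathcal{V}$ outputs something other than this number or $\bot$ is at most $1/3$; the probability is over the random elements of $\mathbb{F}_q$ drawn by $\mathcal{V}$. The protocol has the following costs: 1. the total communication is $O(\log n \log q)$ field elements; 2. the time of $\mathcal{V}$ is $O(m \log n)$; 3. $\mathcal{V}$ makes a single streaming pass over the updates, in whatever order they arrive, and at all times stores $O(\log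 n)$ field elements; 4. the time of $\mathcal{P}$ is $O(n \log q)$. Here time is the number of steps of a random access machine whose words have $O(\log q)$ bits and for which a field operation or a word operation is one step; $\mathcal{P}$ and $\mathcal{V}$ are each given by one fixed program, which works for all $q$, $n$, $m$. The bounds on communication, on the time and on the space of $\mathcal{V}$ hold for every prover. The constants in the $O(\cdot)$ depend only on the constants in $m = \Theta(n)$. -/

import Mathlib

/-! ## Data streams and the number of distinct items -/

namespace StreamIP

/-- A data stream over a universe of `n` items: a list of updates `(i, δ)`, where `δ` may be
negative. -/
abbrev DataStream (n : ℕ) : Type := List (Fin n × ℤ)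

/-- The frequency of item `i`: the sum of all `δ` that occur with `i` in the stream. -/
def freq {n : ℕ} (x : DataStream n) (i : Fin n) : ℤ :=
  (x.map fun u => if u.1 = i then u.2 else 0).sum

/-- The number of items of nonzero frequency. -/
def distinct {n : ℕ} (x : DataStream n) : ℕ :=
  (Finset.univ.filter fun i => freq x i ≠ 0).card

/-- No overflow modulo `q`: no nonzero frequency vanishes modulo `q`. -/
def NoOverflow {n : ℕ} (q : ℕ) (x : DataStream n) : Prop :=
  ∀ i, (q : ℤ) ∣ freq x i → freq x i = 0

/-! ## The machine model

A random access machine over the field with `q` elements. A memory cell holds a machine word,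
a natural number that is smaller than `q ^ 2` (so it has room for two field elements) or at most the
largest constant in the program; a field element is represented by its residue in `[0, q)`. Programs are finite and fixed once and for all: they do
not depend on the field, on the size of the universe or on the length of the stream. -/

/-- The unit-cost operations: word arithmetic, comparisons, and the field operations. -/
inductive Op where
  | add | sub | mul | div | mod | lt | eq | fadd | fsub | fmul

/-- The result of an operation. Word subtraction is truncated, word addition and multiplication
are modulo `q ^ 2`, comparisons return `1` or `0`. -/
def Op.eval (q : ℕ) : Op → ℕ → ℕ → ℕ
  | .add, x, y => (x + y) % q ^ 2
  | .sub, x, y => x - y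
  | .mul, x, y => (x * y) % q ^ 2
  | .div, x, y => x / y
  | .mod, x, y => x % y
  | .lt, x, y => if x < y then 1 else 0
  | .eq, x, y => if x = y then 1 else 0
  | .fadd, x, y => ((x : ZMod q) + (y : ZMod q)).val
  | .fsub, x, y => ((x : ZMod q) - (y : ZMod q)).val
  | .fmul, x, y => ((x : ZMod q) * (y : ZMod q)).val

/-- Expressions: constants, memory access (the address is again an expression), operations. -/
inductive Exp where
  | const (c : ℕ)
  | load (addr : Exp)
  | op (o : Op) (a b : Exp)

/-- The value of an expression for a given content of the memory. -/
def Exp.eval (q : ℕ) (mem : ℕ → ℕ) : Exp → ℕ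
  | .const c => c
  | .load a => mem (a.eval q mem)
  | .op o a b => o.eval q (a.eval q mem) (b.eval q mem)

/-- Each constant, memory access and operation takes one step. -/
def Exp.cost : Exp → ℕ
  | .const _ => 1
  | .load a => a.cost + 1
  | .op _ a b => a.cost + b.cost + 1

/-- Commands. `rand addr` draws a uniformly random field element and stores it at `addr`. -/
inductive Cmd where
  | skip
  | set (addr val : Exp)
  | rand (addr : Exp)
  | seq (c d : Cmd)
  | ite (b : Exp) (c d : Cmd)
  | while (b : Exp) (c : Cmd)

/-- The state of a machine: its memory, and the random words that it has not yet drawn. -/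
structure State where
  mem : ℕ → ℕ
  tape : List ℕ

/-- Store the word `v` at address `a`. -/
def State.write (s : State) (a v : ℕ) : State := ⟨Function.update s.mem a v, s.tape⟩

/-- Cells `0` and `1` are the input port of a machine. -/
def State.input (s : State) (a b : ℕ) : State := (s.write 0 a).write 1 b

/-- `Exec q M c s t r`: with `M` memory cells, the command `c`, started in the state `s`, halts
after `t` steps in the state `r`. There is no such `r` if `c` runs forever, attempts to write
outside the cells `0, …, M - 1`, or draws from an exhausted tape. -/
inductive Exec (q M : ℕ) : Cmd → State → ℕ → State → Prop where
  | skip (s : State) : Exec q M .skip s 1 s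
  | set (a e : Exp) (s : State) (h : a.eval q s.mem < M) :
      Exec q M (.set a e) s (a.cost + e.cost + 1) (s.write (a.eval q s.mem) (e.eval q s.mem))
  | rand (a : Exp) (mem : ℕ → ℕ) (v : ℕ) (l : List ℕ) (h : a.eval q mem < M) :
      Exec q M (.rand a) ⟨mem, v :: l⟩ (a.cost + 1) ((State.mk mem l).write (a.eval q mem) v)
  | seq {c d : Cmd} {s r u : State} {t₁ t₂ : ℕ} (hc : Exec q M c s t₁ r) (hd : Exec q M d r t₂ u) :
      Exec q M (.seq c d) s (t₁ + t₂) u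
  | iteTrue {b : Exp} {c d : Cmd} {s r : State} {t : ℕ} (hb : b.eval q s.mem ≠ 0)
      (h : Exec q M c s t r) : Exec q M (.ite b c d) s (b.cost + 1 + t) r
  | iteFalse {b : Exp} {c d : Cmd} {s r : State} {t : ℕ} (hb : b.eval q s.mem = 0)
      (h : Exec q M d s t r) : Exec q M (.ite b c d) s (b.cost + 1 + t) r
  | whileTrue {b : Exp} {c : Cmd} {s r u : State} {t₁ t₂ : ℕ} (hb : b.eval q s.mem ≠ 0)
      (hc : Exec q M c s t₁ r) (hw : Exec q M (.while b c) r t₂ u) :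
      Exec q M (.while b c) s (b.cost + 1 + t₁ + t₂) u
  | whileFalse {b : Exp} {c : Cmd} {s : State} (hb : b.eval q s.mem = 0) :
      Exec q M (.while b c) s (b.cost + 1) s

/-! ## Streaming machines and their interaction -/

/-- A verifier or a prover: `init` is executed once in the beginning, `update` once for each
update of the stream, and `respond` once for each word that arrives from the other party. Nothing
but the memory is carried over from one execution to the next. -/
structure Machine where
  init : Cmd
  update : Cmd
  respond : Cmd

/-- A single pass over the stream: for each update `(i, δ)` the command is executed with `i` and
the residue of `δ` modulo `q` on the input port. The number is the total number of steps. -/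
inductive Pass {n : ℕ} (q M : ℕ) (c : Cmd) : DataStream n → State → ℕ → State → Prop where
  | nil (s : State) : Pass q M c [] s 0 s
  | cons {i : Fin n} {δ : ℤ} {x : DataStream n} {s r u : State} {t₁ t₂ : ℕ}
      (h : Exec q M c (s.input i (δ : ZMod q).val) t₁ r) (hx : Pass q M c x r t₂ u) :
      Pass q M c ((i, δ) :: x) s (t₁ + t₂) u

/-- Starting with an empty memory, knowing only `n` and `q`, and having the random words of `tape`
at its disposal, the machine has read the stream `x` after `t` steps and is in the state `s`. -/
def Machine.Observes {n : ℕ} (A : Machine) (q M : ℕ) (tape : List ℕ) (x : DataStream n)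
    (t : ℕ) (s : State) : Prop :=
  ∃ (r : State) (t₁ t₂ : ℕ),
    Exec q M A.init (State.input ⟨fun _ => 0, tape⟩ n q) t₁ r ∧
      Pass q M A.update x r t₂ s ∧ t = t₁ + t₂

/-- The output of the verifier when it has halted: status `1` means that it outputs the word in
cell `0`, and any other status means that it outputs `⊥`, here `none`. -/
def verdict (s : State) : Option ℕ := if s.mem 1 = 1 then some (s.mem 0) else none

/-- The conversation, after both parties have read the stream. The prover is given by a relation:
`next p w a t r` means that in the state `p`, when the word `w` arrives, it takes `t` steps to send
the field element `a` and to move to the state `r`.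

In each round, the prover gets the last word of the verifier (`0` in the first round) and sends
one field element. The verifier processes it and then either continues (status `0` in cell `1`)
by sending the field element in cell `0`, or halts.

`Interact q M c next s p w out tV tP k`: the verifier, in the state `s`, and the prover, in the
state `p` and about to get `w`, converse for `k` rounds, after which the verifier outputs `out`;
this takes the verifier `tV` and the prover `tP` steps. -/
inductive Interact {S : Type} (q M : ℕ) (c : Cmd)
    (next : S → ZMod q → ZMod q → ℕ → S → Prop) :
    State → S → ZMod q → Option ℕ → ℕ → ℕ → ℕ → Prop where
  | halt {s r : State} {p p₁ : S} {w a : ZMod q} {tV tP : ℕ}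
      (hp : next p w a tP p₁) (hv : Exec q M c (s.input a.val 0) tV r) (hr : r.mem 1 ≠ 0) :
      Interact q M c next s p w (verdict r) tV tP 1
  | step {s r : State} {p p₁ : S} {w a : ZMod q} {out : Option ℕ} {tV tP tV₁ tP₁ k : ℕ}
      (hp : next p w a tP p₁) (hv : Exec q M c (s.input a.val 0) tV r) (hr : r.mem 1 = 0)
      (h : Interact q M c next r p₁ (r.mem 0 : ZMod q) out tV₁ tP₁ k) :
      Interact q M c next s p w out (tV + tV₁) (tP + tP₁) (k + 1)

/-- An arbitrary, computationally unbounded prover: what it sends is any function of the list of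
all words received so far. Its steps are not counted. -/
def strategyNext {q : ℕ} (σ : List (ZMod q) → ZMod q) :
    List (ZMod q) → ZMod q → ZMod q → ℕ → List (ZMod q) → Prop :=
  fun p w a t r => r = p ++ [w] ∧ a = σ r ∧ t = 0

/-- A prover that is a machine, with `N` memory cells. -/
def machineNext (q N : ℕ) (P : Machine) : State → ZMod q → ZMod q → ℕ → State → Prop :=
  fun p w a t r => Exec q N P.respond (p.input w.val 0) t r ∧ a = (r.mem 0 : ZMod q)

/-- The random tape of the verifier that consists of the field elements `R 0, …, R (L - 1)`. -/
def coins {q L : ℕ} (R : Fin L → ZMod q) : List ℕ := List.ofFn fun j => (R j).val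

/-- On the stream `x` and the random elements `R`, the verifier `V` with `M` memory cells, in
conversation with an arbitrary prover `σ`, outputs `out` after `tV` steps in total and `k` rounds. -/
def RunAgainst {n q L : ℕ} (M : ℕ) (V : Machine) (x : DataStream n) (R : Fin L → ZMod q)
    (σ : List (ZMod q) → ZMod q) (out : Option ℕ) (tV k : ℕ) : Prop :=
  ∃ (s : State) (t₁ t₂ tP : ℕ),
    V.Observes q M (coins R) x t₁ s ∧
      Interact q M V.respond (strategyNext σ) s [] 0 out t₂ tP k ∧ tV = t₁ + t₂

/-- The same in conversation with the machine `P`, which has seen the same stream, uses no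
randomness and takes `tP` steps in total. The number `N` of its memory cells is not restricted. -/
def RunHonest {n q L : ℕ} (M : ℕ) (V P : Machine) (x : DataStream n) (R : Fin L → ZMod q)
    (out : Option ℕ) (tV tP k : ℕ) : Prop :=
  ∃ (N : ℕ) (s p : State) (t₁ t₂ t₃ t₄ : ℕ),
    V.Observes q M (coins R) x t₁ s ∧ P.Observes q N [] x t₃ p ∧
      Interact q M V.respond (machineNext q N P) s p 0 out t₂ t₄ k ∧
      tV = t₁ + t₂ ∧ tP = t₃ + t₄

/-- The probability of an event when `L` field elements are chosen independently and uniformly. -/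
noncomputable def prob {q L : ℕ} (E : Set (Fin L → ZMod q)) : ℝ := (E.ncard : ℝ) / (q : ℝ) ^ L

/-- `(P, V)` is a valid interactive proof protocol over the field with `q` elements for the
function `f` on the streams in `I`, where the verifier has `M` memory cells and `L` random field
elements: with the prover `P`, the verifier outputs `f x` with probability one, and with any
prover, it outputs something that is neither `f x` nor `⊥` with probability at most `1 / 3`. -/
structure IsValidProtocol {n : ℕ} (q M L : ℕ) (V P : Machine) (I : Set (DataStream n))
    (f : DataStream n → ℕ) : Prop where
  complete : ∀ x ∈ I,
    prob {R : Fin L → ZMod q | ∃ tV tP k, RunHonest M V P x R (some (f x)) tV tP k} = 1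
  sound : ∀ x ∈ I, ∀ σ : List (ZMod q) → ZMod q,
    prob {R : Fin L → ZMod q | ∃ v tV k, RunAgainst M V x R σ (some v) tV k ∧ v ≠ f x} ≤ 1 / 3

/-- The streams of length `m` without overflow modulo `q`. -/
def streams (q n m : ℕ) : Set (DataStream n) := {x | x.length = m ∧ NoOverflow q x}

end StreamIP

/-! Write q = 2^k - 1 and d = `Nat.clog 2 n`. By Fermat, a ^ (q - 1) is the indicator of a ≠ 0 in
the field, so without overflow, and because n < q, the answer can be read off the field element ∑
a_i ^ (q - 1). Since q is a Mersenne prime, q - 1 = 2^k - 2, and this power is reached from 1 by K =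
k - 1 steps u ↦ (a u)². The intermediate tables are the layers of a circuit whose gates only use the
layer below and the input.

The sum is 2^d times the multilinear extension of the top layer at (1/2, …, 1/2)
(`two_pow_mul_mle_half`). A claim about the extension of a layer at a point, plus a multiple of the
input's extension there, is reduced coordinate by coordinate to the layer below. The prover sends
the five coefficients of the polynomial g that arises when the current coordinate r is replaced by a
variable inside the two tables, before squaring. The test is claim = g(0) + r (g(1) - g(0)), and the
new claim is g(w) for a random w. After d such rounds the prover states the values of the lower
layer and of the input at the new point. These are tested against the claim, and a random weight
merges them into the next one (`combine_layer`, `combine_fold`, `fold_combine`).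

At the bottom the layer is constantly 1, so all that is needed is one value of the input's
extension. The coins of the last reduction are the coordinates of a secret point drawn before the
stream, and the value there is linear in the updates (`mle_update_add`); hence a single field
element is maintained during the pass.

Soundness runs backwards. The final messages are correct if they are accepted; correct messages that
pass the test make the claim of their block true; and a true claim forces the preceding messages to
be correct unless the coin is one of at most four exceptional values (`check_honest_iff`,
`nextClaim_honest`, `agrees_zero`). That coin is independent of everything sent before it
(`ncard_collision_mul_le`), and a union bound over K (d + 1) blocks gives 1/3.

Two ranges are treated differently. If q < 4096 the union bound may fail, but n is bounded and the
verifier stores all frequencies. If n ≤ k, the K (d + 1) blocks would be too slow for time O(m log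
n), so the prover lists the n frequencies and the verifier compares their multilinear fingerprint
with that of the stream.

The prover is fast because each substitution halves its tables, so that a layer costs O(2^d)
(`sum_block_size_le`). The programs are analysed by invariants with time bounds (`reach_round`,
`reach_answer`), and determinism of runs turns the exhibited executions into statements about all
executions. -/

namespace StreamIP

/-! ## A program logic for time-bounded execution -/

/-- The command halts within `T` steps, in a state that satisfies `Q`. -/
def Reach (q M : ℕ) (c : Cmd) (s : State) (T : ℕ) (Q : State → Prop) : Prop :=
  ∃ t r, Exec q M c s t r ∧ t ≤ T ∧ Q r

theorem Reach.mono {q M : ℕ} {c : Cmd} {s : State} {T T' : ℕ} {Q Q' : State → Prop}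
    (h : Reach q M c s T Q) (hT : T ≤ T') (hQ : ∀ r, Q r → Q' r) : Reach q M c s T' Q' := by
  obtain ⟨t, r, h₁, h₂, h₃⟩ := h
  exact ⟨t, r, h₁, h₂.trans hT, hQ r h₃⟩

theorem Reach.seq {q M : ℕ} {c d : Cmd} {s : State} {T₁ T₂ : ℕ} {P Q : State → Prop}
    (hc : Reach q M c s T₁ P) (hd : ∀ r, P r → Reach q M d r T₂ Q) :
    Reach q M (.seq c d) s (T₁ + T₂) Q := by
  obtain ⟨t, r, h₁, h₂, h₃⟩ := hc
  obtain ⟨t', r', h₁', h₂', h₃'⟩ := hd r h₃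
  exact ⟨t + t', r', .seq h₁ h₁', Nat.add_le_add h₂ h₂', h₃'⟩

theorem Reach.ite {q M : ℕ} {b : Exp} {c d : Cmd} {s : State} {T₁ T₂ : ℕ} {Q : State → Prop}
    (hc : b.eval q s.mem ≠ 0 → Reach q M c s T₁ Q)
    (hd : b.eval q s.mem = 0 → Reach q M d s T₂ Q) :
    Reach q M (.ite b c d) s (b.cost + 1 + max T₁ T₂) Q := by
  by_cases hb : b.eval q s.mem = 0
  · obtain ⟨t, r, h₁, h₂, h₃⟩ := hd hb
    exact ⟨_, r, .iteFalse hb h₁, by lia, h₃⟩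
  · obtain ⟨t, r, h₁, h₂, h₃⟩ := hc hb
    exact ⟨_, r, .iteTrue hb h₁, by lia, h₃⟩

/-- A loop with an invariant that is indexed by the number of iterations. -/
theorem Reach.while {q M : ℕ} {b : Exp} {c : Cmd} (I : ℕ → State → Prop) (n : ℕ) (T : ℕ → ℕ)
    (hend : ∀ s, I n s → b.eval q s.mem = 0)
    (hstep : ∀ i < n, ∀ s, I i s → b.eval q s.mem ≠ 0 ∧ Reach q M c s (T i) (I (i + 1)))
    {s : State} (h0 : I 0 s) :
    Reach q M (.while b c) s (∑ i ∈ Finset.range n, (b.cost + 1 + T i) + (b.cost + 1)) (I n) := by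
  -- Here j is the number of iterations still to come, so the induction starts at the exit of the
  -- loop.
  have key : ∀ j ≤ n, ∀ s, I (n - j) s → Reach q M (.while b c) s
      (∑ i ∈ Finset.Ico (n - j) n, (b.cost + 1 + T i) + (b.cost + 1)) (I n) := by
    intro j
    induction j with
    | zero =>
      intro _ s hs
      exact ⟨_, s, .whileFalse (hend s hs), by simp, hs⟩
    | succ j ih =>
      intro hj s hs
      obtain ⟨hb, t, r, h₁, h₂, h₃⟩ := hstep (n - (j + 1)) (by lia) s hs
      rw [show n - (j + 1) + 1 = n - j by lia] at h₃
      obtain ⟨t', r', h₁', h₂', h₃'⟩ := ih (by lia) r h₃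
      refine ⟨_, r', .whileTrue hb h₁ h₁', ?_, h₃'⟩
      rw [Finset.sum_eq_sum_Ico_succ_bot (by lia : n - (j + 1) < n),
        show n - (j + 1) + 1 = n - j by lia]
      lia
  have := key n le_rfl s (by simpa using h0)
  rwa [Nat.sub_self, Nat.Ico_zero_eq_range] at this

/-- A loop in which every iteration has the same time bound. -/
theorem Reach.whileConst {q M : ℕ} {b : Exp} {c : Cmd} (I : ℕ → State → Prop) (n : ℕ) (T : ℕ)
    (hend : ∀ s, I n s → b.eval q s.mem = 0)
    (hstep : ∀ i < n, ∀ s, I i s → b.eval q s.mem ≠ 0 ∧ Reach q M c s T (I (i + 1)))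
    {s : State} (h0 : I 0 s) :
    Reach q M (.while b c) s (n * (b.cost + 1 + T) + (b.cost + 1)) (I n) := by
  have := Reach.while I n (fun _ => T) hend hstep h0
  simpa using this

/-- Weakest preconditions of loop-free commands. -/
def Cmd.wp (q M : ℕ) : Cmd → (State → Prop) → State → Prop
  | .skip, Q, s => Q s
  | .set a e, Q, s => a.eval q s.mem < M ∧ Q (s.write (a.eval q s.mem) (e.eval q s.mem))
  | .rand a, Q, s => a.eval q s.mem < M ∧ ∃ v l, s.tape = v :: l ∧
      Q ⟨Function.update s.mem (a.eval q s.mem) v, l⟩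
  | .seq c d, Q, s => c.wp q M (d.wp q M Q) s
  | .ite b c d, Q, s => (b.eval q s.mem ≠ 0 → c.wp q M Q s) ∧ (b.eval q s.mem = 0 → d.wp q M Q s)
  | .while _ _, _, _ => False

/-- The largest number of steps of a loop-free command. -/
def Cmd.cost : Cmd → ℕ
  | .skip => 1
  | .set a e => a.cost + e.cost + 1
  | .rand a => a.cost + 1
  | .seq c d => c.cost + d.cost
  | .ite b c d => b.cost + 1 + max c.cost d.cost
  | .while b _ => b.cost + 1

theorem Reach.of_wp {q M : ℕ} {c : Cmd} {s : State} {Q : State → Prop} (h : c.wp q M Q s) :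
    Reach q M c s c.cost Q := by
  induction c generalizing s Q with
  | skip => exact ⟨1, s, .skip s, le_rfl, h⟩
  | set a e => exact ⟨_, _, .set a e s h.1, le_rfl, h.2⟩
  | rand a =>
    obtain ⟨h₁, v, l, h₂, h₃⟩ := h
    obtain ⟨mem, tape⟩ := s
    subst h₂
    exact ⟨_, _, .rand a mem v l h₁, le_rfl, h₃⟩
  | seq c d ihc ihd => exact (ihc h).seq fun r hr => ihd hr
  | ite b c d ihc ihd =>
    exact Reach.ite (fun hb => ihc (h.1 hb)) (fun hb => ihd (h.2 hb))
  | _ => exact h.elim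

/-- Execution is deterministic. -/
theorem Exec.det {q M : ℕ} {c : Cmd} {s r r' : State} {t t' : ℕ} (h : Exec q M c s t r)
    (h' : Exec q M c s t' r') : t = t' ∧ r = r' := by
  induction h generalizing t' r' with
  | skip s => cases h'; exact ⟨rfl, rfl⟩
  | set a e s _ => cases h'; exact ⟨rfl, rfl⟩
  | rand a mem v l _ => cases h'; exact ⟨rfl, rfl⟩
  | seq _ _ ihc ihd =>
    cases h' with
    | seq hc hd =>
      obtain ⟨rfl, rfl⟩ := ihc hc
      obtain ⟨rfl, rfl⟩ := ihd hd
      exact ⟨rfl, rfl⟩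
  | iteTrue hb _ ih =>
    cases h' with
    | iteTrue _ h => obtain ⟨rfl, rfl⟩ := ih h; exact ⟨rfl, rfl⟩
    | iteFalse hb' _ => exact (hb hb').elim
  | iteFalse hb _ ih =>
    cases h' with
    | iteTrue hb' _ => exact (hb' hb).elim
    | iteFalse _ h => obtain ⟨rfl, rfl⟩ := ih h; exact ⟨rfl, rfl⟩
  | whileTrue hb _ _ ihc ihd =>
    cases h' with
    | whileTrue _ hc hd =>
      obtain ⟨rfl, rfl⟩ := ihc hc
      obtain ⟨rfl, rfl⟩ := ihd hd
      exact ⟨rfl, rfl⟩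
    | whileFalse hb' => exact (hb hb').elim
  | whileFalse hb =>
    cases h' with
    | whileTrue hb' _ _ => exact (hb' hb).elim
    | whileFalse _ => exact ⟨rfl, rfl⟩

theorem Pass.det {n q M : ℕ} {c : Cmd} {x : DataStream n} {s r r' : State} {t t' : ℕ}
    (h : Pass q M c x s t r) (h' : Pass q M c x s t' r') : r = r' := by
  induction h generalizing t' r' with
  | nil s => cases h'; rfl
  | cons h _ ih =>
    cases h' with
    | cons h₁ h₂ => obtain ⟨rfl, rfl⟩ := h.det h₁; exact ih h₂

theorem Machine.Observes.det {n q M : ℕ} {A : Machine} {l : List ℕ} {x : DataStream n}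
    {s s' : State} {t t' : ℕ} (h : A.Observes q M l x t s) (h' : A.Observes q M l x t' s') :
    s = s' := by
  obtain ⟨r, _, _, h₁, h₂, _⟩ := h
  obtain ⟨r', _, _, h₁', h₂', _⟩ := h'
  obtain ⟨_, rfl⟩ := h₁.det h₁'
  exact h₂.det h₂'

/-- A strategy is a function of the words received, so both sides of each round are determined.
Soundness speaks of the existence of a bad run; uniqueness allows a single exhibited run to exclude
it. -/
theorem Interact.det {q M : ℕ} {c : Cmd} {σ : List (ZMod q) → ZMod q} {s : State}
    {p : List (ZMod q)} {w : ZMod q} {out out' : Option ℕ} {tV tP k tV' tP' k' : ℕ}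
    (h : Interact q M c (strategyNext σ) s p w out tV tP k)
    (h' : Interact q M c (strategyNext σ) s p w out' tV' tP' k') : out = out' := by
  induction h generalizing out' tV' tP' k' with
  | halt hp hv hr =>
    cases h' with
    | halt hp' hv' hr' =>
      obtain ⟨rfl, rfl, rfl⟩ := hp
      obtain ⟨rfl, rfl, rfl⟩ := hp'
      obtain ⟨_, rfl⟩ := hv.det hv'
      rfl
    | step hp' hv' hr' _ =>
      obtain ⟨rfl, rfl, rfl⟩ := hp
      obtain ⟨rfl, rfl, rfl⟩ := hp'
      obtain ⟨_, rfl⟩ := hv.det hv'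
      exact (hr hr').elim
  | step hp hv hr _ ih =>
    cases h' with
    | halt hp' hv' hr' =>
      obtain ⟨rfl, rfl, rfl⟩ := hp
      obtain ⟨rfl, rfl, rfl⟩ := hp'
      obtain ⟨_, rfl⟩ := hv.det hv'
      exact (hr' hr).elim
    | step hp' hv' hr' h₁ =>
      obtain ⟨rfl, rfl, rfl⟩ := hp
      obtain ⟨rfl, rfl, rfl⟩ := hp'
      obtain ⟨_, rfl⟩ := hv.det hv'
      exact ih h₁

/-- Against a fixed prover and for fixed random elements, the output of the verifier is unique. -/
theorem RunAgainst.det {n q L M : ℕ} {V : Machine} {x : DataStream n} {R : Fin L → ZMod q}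
    {σ : List (ZMod q) → ZMod q} {out out' : Option ℕ} {tV k tV' k' : ℕ}
    (h : RunAgainst M V x R σ out tV k) (h' : RunAgainst M V x R σ out' tV' k') : out = out' := by
  obtain ⟨s, _, _, _, h₁, h₂, _⟩ := h
  obtain ⟨s', _, _, _, h₁', h₂', _⟩ := h'
  obtain rfl := h₁.det h₁'
  exact h₂.det h₂'

/-- A single pass, from an invariant on prefixes of the stream. -/
theorem Pass.of_invariant {n q M : ℕ} {c : Cmd} (I : DataStream n → State → Prop) (T : ℕ)
    (hstep : ∀ (y : DataStream n) (i : Fin n) (δ : ℤ) (s : State), I y s →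
      Reach q M c (s.input i (δ : ZMod q).val) T (I (y ++ [(i, δ)])))
    (x y : DataStream n) (s : State) (h : I y s) :
    ∃ t r, Pass q M c x s t r ∧ t ≤ x.length * T ∧ I (y ++ x) r := by
  induction x generalizing y s with
  | nil => exact ⟨0, s, .nil s, by simp, by simpa using h⟩
  | cons u x ih =>
    obtain ⟨i, δ⟩ := u
    obtain ⟨t, r, h₁, h₂, h₃⟩ := hstep y i δ s h
    obtain ⟨t', r', h₁', h₂', h₃'⟩ := ih _ r h₃
    refine ⟨t + t', r', .cons h₁ h₁', ?_, by simpa using h₃'⟩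
    simp only [List.length_cons]
    nlinarith

/-- A conversation of `k` rounds, from invariants of both parties that are indexed by the rounds. -/
theorem Interact.of_invariant {S : Type} {q M k : ℕ} {c : Cmd}
    {next : S → ZMod q → ZMod q → ℕ → S → Prop} (w a : ℕ → ZMod q) (out : Option ℕ)
    (TV TP : ℕ → ℕ) (VI : ℕ → State → Prop) (PI : ℕ → S → Prop) (hk : 0 < k)
    (hP : ∀ i < k, ∀ p, PI i p → ∃ t p', next p (w i) (a i) t p' ∧ t ≤ TP i ∧ PI (i + 1) p')
    (hV : ∀ i < k, ∀ s, VI i s → Reach q M c (s.input (a i).val 0) (TV i) fun r =>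
      (i + 1 < k → r.mem 1 = 0 ∧ (r.mem 0 : ZMod q) = w (i + 1) ∧ VI (i + 1) r) ∧
      (i + 1 = k → r.mem 1 ≠ 0 ∧ verdict r = out))
    {s : State} {p : S} (hs : VI 0 s) (hp : PI 0 p) :
    ∃ tV tP, Interact q M c next s p (w 0) out tV tP k ∧ tV ≤ ∑ i ∈ Finset.range k, TV i ∧
      tP ≤ ∑ i ∈ Finset.range k, TP i := by
  -- Induction on the rounds left, of which there are j + 1; a conversation has at least one round,
  -- since only a reply can halt it.
  have key : ∀ j < k, ∀ s p, VI (k - (j + 1)) s → PI (k - (j + 1)) p →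
      ∃ tV tP, Interact q M c next s p (w (k - (j + 1))) out tV tP (j + 1) ∧
        tV ≤ ∑ i ∈ Finset.Ico (k - (j + 1)) k, TV i ∧
        tP ≤ ∑ i ∈ Finset.Ico (k - (j + 1)) k, TP i := by
    intro j
    induction j with
    | zero =>
      intro _ s p hs hp
      obtain ⟨t, p', hn, ht, _⟩ := hP (k - (0 + 1)) (by lia) p hp
      obtain ⟨t', r, hx, ht', _, hr⟩ := hV (k - (0 + 1)) (by lia) s hs
      obtain ⟨hr₁, rfl⟩ := hr (by lia)
      refine ⟨t', t, .halt hn hx hr₁, ?_, ?_⟩ <;>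
        simpa [Finset.sum_eq_sum_Ico_succ_bot (by lia : k - 1 < k),
          show k - 1 + 1 = k by lia] using by assumption
    | succ j ih =>
      intro hj s p hs hp
      obtain ⟨t, p', hn, ht, hp'⟩ := hP (k - (j + 1 + 1)) (by lia) p hp
      obtain ⟨t', r, hx, ht', hr, _⟩ := hV (k - (j + 1 + 1)) (by lia) s hs
      obtain ⟨hr₁, hr₂, hr₃⟩ := hr (by lia)
      rw [show k - (j + 1 + 1) + 1 = k - (j + 1) by lia] at hr₂ hr₃ hp'
      obtain ⟨tV, tP, h₁, h₂, h₃⟩ := ih (by lia) r p' hr₃ hp'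
      rw [← hr₂] at h₁
      refine ⟨_, _, .step hn hx hr₁ h₁, ?_, ?_⟩ <;>
      · rw [Finset.sum_eq_sum_Ico_succ_bot (by lia : k - (j + 1 + 1) < k),
          show k - (j + 1 + 1) + 1 = k - (j + 1) by lia]
        lia
  have := key (k - 1) (by lia) s p (by rwa [show k - (k - 1 + 1) = 0 by lia])
    (by rwa [show k - (k - 1 + 1) = 0 by lia])
  rw [show k - (k - 1 + 1) = 0 by lia, show k - 1 + 1 = k by lia] at this
  rwa [Nat.Ico_zero_eq_range] at this

/-! ### Values of expressions -/

theorem eval_add_of_lt {q x y : ℕ} (h : x + y < q ^ 2) : Op.eval q .add x y = x + y :=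
  Nat.mod_eq_of_lt h

theorem eval_mul_of_lt {q x y : ℕ} (h : x * y < q ^ 2) : Op.eval q .mul x y = x * y :=
  Nat.mod_eq_of_lt h

/-- The memory cell at the constant address `c`. -/
abbrev Exp.reg (c : ℕ) : Exp := .load (.const c)

/-- Assignment to the memory cell at the constant address `c`. -/
abbrev Cmd.setReg (c : ℕ) (e : Exp) : Cmd := .set (.const c) e

/-- For a concrete expression the cost is a numeral, so `decide` settles the side condition. Time
budgets can then be written as nested sums that mirror the program. -/
theorem Reach.setReg_seq {q M c : ℕ} {e : Exp} {d : Cmd} {s : State} {k T : ℕ} {Q : State → Prop}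
    (h : c < M) (hd : Reach q M d (s.write c (e.eval q s.mem)) T Q)
    (hk : e.cost + 2 ≤ k := by decide) : Reach q M (.seq (.setReg c e) d) s (k + T) Q := by
  obtain ⟨t, r, h₁, h₂, h₃⟩ := hd
  refine ⟨_, r, .seq (.set (.const c) e s h) h₁, ?_, h₃⟩
  simp only [Exp.cost]
  lia

theorem Reach.branch {q M : ℕ} {b : Exp} {c d : Cmd} {s : State} {k T : ℕ} {Q : State → Prop}
    (hc : b.eval q s.mem ≠ 0 → Reach q M c s T Q) (hd : b.eval q s.mem = 0 → Reach q M d s T Q)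
    (hk : b.cost + 1 ≤ k := by decide) : Reach q M (.ite b c d) s (k + T) Q :=
  (Reach.ite hc hd).mono (by lia) fun _ => id

theorem Reach.loop {q M k T U : ℕ} {b : Exp} {c : Cmd} (I : ℕ → State → Prop) (n : ℕ)
    (hend : ∀ s, I n s → b.eval q s.mem = 0)
    (hstep : ∀ i < n, ∀ s, I i s → b.eval q s.mem ≠ 0 ∧ Reach q M c s T (I (i + 1)))
    {s : State} (h0 : I 0 s) (hU : n * (k + T) + k ≤ U) (hk : b.cost + 1 ≤ k := by decide) :
    Reach q M (.while b c) s U (I n) := by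
  refine (Reach.whileConst I n T hend hstep h0).mono (le_trans ?_ hU) fun _ => id
  gcongr

/-- Execution of a loop-free command. -/
theorem Reach.step {q M T : ℕ} {c : Cmd} {s : State} {Q : State → Prop} (h : c.wp q M Q s)
    (hT : c.cost ≤ T := by decide) : Reach q M c s T Q :=
  (Reach.of_wp h).mono hT fun _ => id

/-! ## Multilinear extensions of tables -/

section Mle

variable {F : Type*} [Field F]

/-- Substitution of `r` for the lowest bit of the index, by linear interpolation. -/
def fold (r : F) (f : ℕ → F) : ℕ → F := fun x => f (2 * x) + r * (f (2 * x + 1) - f (2 * x))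

/-- Substitution of `ρ 0, …, ρ (i - 1)` for the `i` lowest bits of the index. -/
def foldSeq (ρ : ℕ → F) (f : ℕ → F) : ℕ → ℕ → F
  | 0 => f
  | i + 1 => fold (ρ i) (foldSeq ρ f i)

/-- The multilinear extension of a table of size `2 ^ d` at the point `(ρ 0, …, ρ (d - 1))`. -/
def mle (ρ : ℕ → F) (d : ℕ) (f : ℕ → F) : F := foldSeq ρ f d 0

/-- The recursion splits off the last substitution; inductions over the coordinates of a point need
the first one split off instead. -/
theorem foldSeq_succ_left (ρ f : ℕ → F) (i : ℕ) :
    foldSeq ρ f (i + 1) = foldSeq (fun y => ρ (y + 1)) (fold (ρ 0) f) i := by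
  induction i with
  | zero => rfl
  | succ i ih => rw [foldSeq, ih, foldSeq]

theorem foldSeq_congr_point {ρ ρ' : ℕ → F} (f : ℕ → F) {i : ℕ} (h : ∀ j < i, ρ j = ρ' j) :
    foldSeq ρ f i = foldSeq ρ' f i := by
  induction i with
  | zero => rfl
  | succ i ih => rw [foldSeq, foldSeq, ih fun j hj => h j (by lia), h i (by lia)]

theorem foldSeq_congr_table (ρ : ℕ → F) {f g : ℕ → F} {d : ℕ} (h : ∀ x < 2 ^ d, f x = g x)
    {i : ℕ} (hi : i ≤ d) : ∀ x < 2 ^ (d - i), foldSeq ρ f i x = foldSeq ρ g i x := by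
  induction i with
  | zero => exact h
  | succ i ih =>
    intro x hx
    have h2 : 2 ^ (d - i) = 2 * 2 ^ (d - (i + 1)) := by
      rw [← pow_succ', show d - (i + 1) + 1 = d - i by lia]
    simp only [foldSeq, fold]
    rw [ih (by lia) (2 * x) (by lia), ih (by lia) (2 * x + 1) (by lia)]

theorem mle_congr {ρ ρ' f g : ℕ → F} {d : ℕ} (h : ∀ j < d, ρ j = ρ' j)
    (hf : ∀ x < 2 ^ d, f x = g x) : mle ρ d f = mle ρ' d g := by
  rw [mle, mle, foldSeq_congr_table ρ hf le_rfl 0 (by simp), foldSeq_congr_point g h]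

theorem foldSeq_add (ρ f g : ℕ → F) (i : ℕ) :
    foldSeq ρ (f + g) i = foldSeq ρ f i + foldSeq ρ g i := by
  induction i with
  | zero => rfl
  | succ i ih =>
    ext x
    simp only [foldSeq, ih, fold, Pi.add_apply]
    ring

theorem foldSeq_smul (ρ : ℕ → F) (c : F) (f : ℕ → F) (i : ℕ) :
    foldSeq ρ (c • f) i = c • foldSeq ρ f i := by
  induction i with
  | zero => rfl
  | succ i ih =>
    ext x
    simp only [foldSeq, ih, fold, Pi.smul_apply, smul_eq_mul]
    ring

theorem mle_add (ρ : ℕ → F) (d : ℕ) (f g : ℕ → F) : mle ρ d (f + g) = mle ρ d f + mle ρ d g := by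
  rw [mle, foldSeq_add]; rfl

theorem mle_smul (ρ : ℕ → F) (d : ℕ) (c : F) (f : ℕ → F) : mle ρ d (c • f) = c * mle ρ d f := by
  rw [mle, foldSeq_smul]; rfl

theorem mle_zero (ρ : ℕ → F) (d : ℕ) : mle ρ d 0 = 0 := by
  simpa using mle_smul ρ d 0 0

theorem mle_succ (ρ : ℕ → F) (d : ℕ) (f : ℕ → F) :
    mle ρ (d + 1) f = mle (fun y => ρ (y + 1)) d (fold (ρ 0) f) := by
  rw [mle, foldSeq_succ_left]; rfl

theorem foldSeq_one (ρ : ℕ → F) (i : ℕ) : foldSeq ρ 1 i = 1 := by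
  induction i with
  | zero => rfl
  | succ i ih => ext x; simp [foldSeq, ih, fold]

/-- The multilinear extension of the indicator of `x`, for the first `d` coordinates. -/
def indicatorMle (ρ : ℕ → F) (x : ℕ) : ℕ → F
  | 0 => 1
  | j + 1 => indicatorMle ρ x j * if x / 2 ^ j % 2 = 1 then ρ j else 1 - ρ j

/-- A fold maps an indicator to a multiple of the indicator of the halved index: only one entry of a
pair is nonzero, and the low bit decides whether the factor is r or 1 - r. -/
theorem foldSeq_single (ρ : ℕ → F) (x i : ℕ) :
    foldSeq ρ (Pi.single x 1) i = indicatorMle ρ x i • Pi.single (x / 2 ^ i) 1 := by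
  induction i with
  | zero => ext y; simp [foldSeq, indicatorMle]
  | succ i ih =>
    ext y
    have h2 : x / 2 ^ (i + 1) = x / 2 ^ i / 2 := by rw [pow_succ, Nat.div_div_eq_div_mul]
    simp only [foldSeq, ih, fold, indicatorMle, Pi.smul_apply, smul_eq_mul, Pi.single_apply, h2]
    generalize x / 2 ^ i = z
    rcases Nat.mod_two_eq_zero_or_one z with hz | hz
    · have h₁ : 2 * y + 1 ≠ z := by lia
      by_cases hy : y = z / 2
      · have h₃ : 2 * (z / 2) = z := by lia
        subst hy; simp [h₃, hz]; ring
      · have h₂ : 2 * y ≠ z := by lia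
        simp [h₁, h₂, hy]
    · have h₁ : 2 * y ≠ z := by lia
      by_cases hy : y = z / 2
      · have h₃ : 2 * (z / 2) + 1 = z := by lia
        subst hy
        simp [h₁, h₃, hz]; ring
      · have h₂ : 2 * y + 1 ≠ z := by lia
        simp [h₁, h₂, hy]

theorem mle_single (ρ : ℕ → F) {d x : ℕ} (hx : x < 2 ^ d) (c : F) :
    mle ρ d (Pi.single x c) = c * indicatorMle ρ x d := by
  have : (Pi.single x c : ℕ → F) = c • Pi.single x 1 := by
    ext y; simp [Pi.single_apply]
  rw [this, mle_smul, mle, foldSeq_single, Nat.div_eq_of_lt hx]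
  simp

/-- The streaming step: by linearity the value at a fixed point is maintained under an update at the
cost of one product with d factors. -/
theorem mle_update_add (ρ : ℕ → F) {d x : ℕ} (hx : x < 2 ^ d) (f : ℕ → F) (c : F) :
    mle ρ d (f + Pi.single x c) = mle ρ d f + indicatorMle ρ x d * c := by
  rw [mle_add, mle_single ρ hx, mul_comm]

theorem sum_range_two_mul (f : ℕ → F) (n : ℕ) :
    ∑ x ∈ Finset.range (2 * n), f x = ∑ x ∈ Finset.range n, (f (2 * x) + f (2 * x + 1)) := by
  induction n with
  | zero => simp
  | succ n ih =>
    rw [show 2 * (n + 1) = 2 * n + 1 + 1 by ring, Finset.sum_range_succ, Finset.sum_range_succ, ih,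
      Finset.sum_range_succ]
    ring

/-- The sum of a table, from its multilinear extension at the point `(1 / 2, …, 1 / 2)`. -/
theorem two_pow_mul_mle_half (h2 : (2 : F) ≠ 0) (d : ℕ) (f : ℕ → F) :
    2 ^ d * mle (fun _ => 1 / 2) d f = ∑ x ∈ Finset.range (2 ^ d), f x := by
  induction d generalizing f with
  | zero => simp [mle, foldSeq]
  | succ d ih =>
    rw [mle_succ, pow_succ', mul_assoc, ih, pow_succ', sum_range_two_mul, Finset.mul_sum]
    refine Finset.sum_congr rfl fun x _ => ?_
    rw [fold]
    field_simp
    ring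

/-- A nonzero table that is mapped to zero by `fold` determines the point. -/
theorem fold_eq_zero_unique {f : ℕ → F} {n : ℕ} (hf : ∃ x < 2 * n, f x ≠ 0) {r r' : F}
    (h : ∀ x < n, fold r f x = 0) (h' : ∀ x < n, fold r' f x = 0) : r = r' := by
  obtain ⟨x, hx, hfx⟩ := hf
  have h1 := h (x / 2) (by lia)
  have h2 := h' (x / 2) (by lia)
  simp only [fold] at h1 h2
  by_contra hne
  -- An affine function with two zeros has slope zero and vanishes identically, so both entries of
  -- the pair containing x would be zero.
  have h3 : (r - r') * (f (2 * (x / 2) + 1) - f (2 * (x / 2))) = 0 := by linear_combination h1 - h2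
  have h4 : f (2 * (x / 2) + 1) - f (2 * (x / 2)) = 0 := by
    simpa [sub_ne_zero.mpr hne] using h3
  rw [h4, mul_zero, add_zero] at h1
  rw [h1, sub_zero] at h4
  rcases Nat.mod_two_eq_zero_or_one x with hz | hz
  · exact hfx (by rwa [show 2 * (x / 2) = x by lia] at h1)
  · exact hfx (by rwa [show 2 * (x / 2) + 1 = x by lia] at h4)

/-- Where the multilinear extension of a nonzero table vanishes, some coordinate makes the table
vanish. -/
theorem exists_fold_eq_zero {ρ f : ℕ → F} {d : ℕ} (hf : ∃ x < 2 ^ d, f x ≠ 0)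
    (h : mle ρ d f = 0) :
    ∃ j < d, (∃ x < 2 * 2 ^ (d - (j + 1)), foldSeq ρ f j x ≠ 0) ∧
      ∀ x < 2 ^ (d - (j + 1)), fold (ρ j) (foldSeq ρ f j) x = 0 := by
  by_contra! hcon
  -- If no single coordinate kills the table, a nonzero entry survives all d folds. By then only
  -- entry 0 is left, and it is the value of the extension.
  have : ∀ j ≤ d, ∃ x < 2 ^ (d - j), foldSeq ρ f j x ≠ 0 := by
    intro j
    induction j with
    | zero => intro _; exact hf
    | succ j ih =>
      intro hj
      have h2 : 2 ^ (d - j) = 2 * 2 ^ (d - (j + 1)) := by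
        rw [← pow_succ', show d - (j + 1) + 1 = d - j by lia]
      rw [h2] at ih
      exact hcon j (by lia) (ih (by lia))
  obtain ⟨x, hx, hne⟩ := this d le_rfl
  simp only [Nat.sub_self, pow_zero, Nat.lt_one_iff] at hx
  subst hx
  exact hne h

end Mle

/-! ## The layers and the sum-check polynomials -/

section Layers

variable {F : Type*} [Field F]

/-- The layers of the circuit: `layer a j` is the table of the powers `a x ^ (2 ^ (j + 1) - 2)`. -/
def layer (a : ℕ → F) : ℕ → ℕ → F
  | 0 => 1
  | j + 1 => fun x => (a x * layer a j x) ^ 2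

/-- The exponents follow e ↦ 2 (e + 1) from 0. For q = 2^k - 1 the layer of index k - 1 therefore
has exponent q - 1. -/
theorem layer_eq (a : ℕ → F) (j x : ℕ) : layer a j x = a x ^ (2 ^ (j + 1) - 2) := by
  induction j with
  | zero => simp [layer]
  | succ j ih =>
    have h : 2 ^ (j + 1 + 1) = 2 * 2 ^ (j + 1) := pow_succ' 2 (j + 1)
    have h' : 2 ≤ 2 ^ (j + 1) := by rw [pow_succ]; have := Nat.one_le_two_pow (n := j); lia
    simp only [layer]
    rw [ih, ← pow_succ', ← pow_mul]
    congr 1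
    lia

/-- The combined claim about a layer and about the input. -/
def combine (lam : F) (A B : ℕ → F) : ℕ → F := fun x => (A x * B x) ^ 2 + lam * A x

/-- One table carries both pending claims, about a layer and about the input, so that a single
reduction serves both. -/
theorem combine_layer (lam : F) (a : ℕ → F) (j : ℕ) :
    combine lam a (layer a j) = layer a (j + 1) + lam • a := by
  ext x; simp [combine, layer]

/-- The coefficients of the polynomial `X ↦ combine lam (fold X A) (fold X B) x`. -/
def coef (lam : F) (A B : ℕ → F) (t x : ℕ) : F :=
  let a₀ := A (2 * x)
  let a₁ := A (2 * x + 1) - A (2 * x)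
  let b₀ := B (2 * x)
  let b₁ := B (2 * x + 1) - B (2 * x)
  let p₀ := a₀ * b₀
  let p₁ := a₀ * b₁ + a₁ * b₀
  let p₂ := a₁ * b₁
  match t with
  | 0 => p₀ * p₀ + lam * a₀
  | 1 => p₀ * p₁ + p₀ * p₁ + lam * a₁
  | 2 => p₁ * p₁ + (p₀ * p₂ + p₀ * p₂)
  | 3 => p₁ * p₂ + p₁ * p₂
  | _ => p₂ * p₂

/-- The value at `X` of the polynomial with the coefficients `m 0, …, m 4`. -/
def horner (m : ℕ → F) (X : F) : F := m 0 + X * (m 1 + X * (m 2 + X * (m 3 + X * m 4)))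

/-- Both folded tables are affine in X, and the square of their product has degree four; hence five
coefficients per message. -/
theorem combine_fold (lam : F) (A B : ℕ → F) (X : F) (x : ℕ) :
    combine lam (fold X A) (fold X B) x = horner (fun t => coef lam A B t x) X := by
  simp only [combine, fold, horner, coef]
  ring

/-- This is the source of the verifier's test. Folding after combining interpolates linearly between
g(0), the lowest coefficient, and g(1), where g(1) - g(0) is the sum of the other four. Claims are
values at a point rather than sums over a cube, so no equality polynomial is needed. -/
theorem fold_combine (lam : F) (A B : ℕ → F) (r : F) (x : ℕ) :
    fold r (combine lam A B) x = coef lam A B 0 x + r * (coef lam A B 1 x + coef lam A B 2 x +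
      coef lam A B 3 x + coef lam A B 4 x) := by
  simp only [combine, fold, coef]
  ring

/-- By linearity the prover may extend each coefficient table separately and send the resulting
values as the coefficients of its polynomial. -/
theorem horner_mle (ρ : ℕ → F) (d : ℕ) (f : ℕ → ℕ → F) (X : F) :
    horner (fun t => mle ρ d (f t)) X = mle ρ d fun x => horner (fun t => f t x) X := by
  have : (fun x => horner (fun t => f t x) X) =
      f 0 + X • (f 1 + X • (f 2 + X • (f 3 + X • f 4))) := by
    ext x; simp only [horner, Pi.add_apply, Pi.smul_apply, smul_eq_mul]
  rw [this]
  simp only [mle_add, mle_smul, horner]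

/-- The points of agreement are roots of the nonzero difference, which has degree at most four. -/
theorem ncard_horner_eq_le (m m' : ℕ → F) (h : ∃ t < 5, m t ≠ m' t) :
    {X | horner m X = horner m' X}.ncard ≤ 4 := by
  classical
  let p : Polynomial F := ∑ t ∈ Finset.range 5, Polynomial.monomial t (m t - m' t)
  have hp : p ≠ 0 := by
    obtain ⟨t, ht, hne⟩ := h
    intro h0
    have := congrArg (fun p => Polynomial.coeff p t) h0
    simp only [p, Polynomial.finsetSum_coeff, Polynomial.coeff_monomial, Polynomial.coeff_zero,
      Finset.sum_ite_eq', Finset.mem_range, ht, if_true] at this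
    exact hne (sub_eq_zero.mp this)
  have hdeg : p.natDegree ≤ 4 := by
    refine Polynomial.natDegree_sum_le_of_forall_le _ _ fun t ht => ?_
    have := Finset.mem_range.mp ht
    exact (Polynomial.natDegree_monomial_le _).trans (by lia)
  have hsub : {X | horner m X = horner m' X} ⊆ (p.roots.toFinset : Set F) := by
    intro X hX
    simp only [Set.mem_ofPred_eq, horner] at hX
    rw [Finset.mem_coe, Multiset.mem_toFinset, Polynomial.mem_roots hp, Polynomial.IsRoot.def]
    simp only [p, Finset.sum_range_succ, Finset.sum_range_zero,
      Polynomial.eval_add, Polynomial.eval_monomial, Polynomial.eval_zero]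
    linear_combination hX
  calc _ ≤ (p.roots.toFinset : Set F).ncard := Set.ncard_le_ncard hsub (Finset.finite_toSet _)
    _ = p.roots.toFinset.card := Set.ncard_coe_finset _
    _ ≤ p.roots.card := Multiset.toFinset_card_le _
    _ ≤ 4 := (Polynomial.card_roots' p).trans hdeg

end Layers

/-! ## The schedule of the protocol

The conversation is divided into blocks of five rounds. In a block of index `d + 1` the prover
claims the values of the current layer and of the input at the current point, and a block of index
`i ≤ d` is the `i`-th round of the sum-check protocol. -/

/-- The index of block `b` within its layer. -/
def blockIdx (d : ℕ) : ℕ → ℕ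
  | 0 => d + 1
  | b + 1 => if blockIdx d b = d + 1 then 1 else blockIdx d b + 1

/-- The layer of block `b`. -/
def blockLayer (K d : ℕ) : ℕ → ℕ
  | 0 => K
  | b + 1 => if blockIdx d b = d + 1 then blockLayer K d b - 1 else blockLayer K d b

theorem one_le_blockIdx (d b : ℕ) : 1 ≤ blockIdx d b := by
  cases b with
  | zero => simp [blockIdx]
  | succ b => rw [blockIdx]; split <;> lia

theorem blockIdx_le (d b : ℕ) : blockIdx d b ≤ d + 1 := by
  induction b with
  | zero => simp [blockIdx]
  | succ b ih => rw [blockIdx]; split <;> lia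

theorem blockLayer_le (K d b : ℕ) : blockLayer K d b ≤ K := by
  induction b with
  | zero => simp [blockLayer]
  | succ b ih => rw [blockLayer]; split <;> lia

/-- A conservation law for the schedule: the index grows by one with each block, except that after a
block of claims it drops by d while the layer drops by one. It determines the position of a block
from its layer and index. -/
theorem block_eq {K d b : ℕ} (hb : b ≤ K * (d + 1)) :
    b + (d + 1) + blockLayer K d b * (d + 1) = K * (d + 1) + blockIdx d b := by
  induction b with
  | zero => simp [blockIdx, blockLayer]; ring
  | succ b ih =>
    have ih := ih (by lia)
    rw [blockIdx, blockLayer]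
    split_ifs with h
    · rw [h] at ih
      -- The truncated subtraction in `blockLayer` is a true one here: claims about layer 0 would
      -- mean b = K * (d + 1), past the allowed range.
      obtain ⟨l, hl⟩ : ∃ l, blockLayer K d b = l + 1 := by
        refine Nat.exists_eq_succ_of_ne_zero fun h0 => ?_
        rw [h0] at ih
        lia
      rw [hl] at ih ⊢
      rw [Nat.add_sub_cancel]
      linarith [add_mul l 1 (d + 1)]
    · lia

/-- The last block is the only one with the claims about the input layer. -/
theorem blockLayer_pos {K d b : ℕ} (hb : b < K * (d + 1)) (hi : blockIdx d b = d + 1) :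
    0 < blockLayer K d b := by
  have := block_eq hb.le
  rw [hi] at this
  refine Nat.pos_of_ne_zero fun h0 => ?_
  rw [h0] at this
  lia

theorem blockIdx_last (K d : ℕ) : blockIdx d (K * (d + 1)) = d + 1 := by
  have h := block_eq (le_refl (K * (d + 1)))
  have h₁ := blockIdx_le d (K * (d + 1))
  have h₂ := one_le_blockIdx d (K * (d + 1))
  nlinarith

theorem blockLayer_last (K d : ℕ) : blockLayer K d (K * (d + 1)) = 0 := by
  have h := block_eq (le_refl (K * (d + 1)))
  rw [blockIdx_last] at h
  have : blockLayer K d (K * (d + 1)) * (d + 1) = 0 := by lia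
  simpa using this

/-! ### Claims, tests and honest messages as functions of the coins. -/

section Protocol

variable {F : Type*} [Field F]

/-- The point at the beginning of block `b`, if the verifier draws `w b` at the end of block `b`. -/
def point (d : ℕ) (w : ℕ → F) : ℕ → ℕ → F
  | 0 => fun _ => 1 / 2
  | b + 1 => if blockIdx d b = d + 1 then point d w b
      else Function.update (point d w b) (blockIdx d b - 1) (w b)

/-- The coefficient of the claim about the input at the beginning of block `b`. -/
def weight (d : ℕ) (w : ℕ → F) : ℕ → F
  | 0 => 0
  | b + 1 => if blockIdx d b = d + 1 then w b else weight d w b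

/-- The claim that results from the message `m` and the random element `w` in a block of index
`i`. -/
def nextClaim (d i : ℕ) (m : ℕ → F) (w : F) : F :=
  if i = d + 1 then m 0 + w * m 1 else horner m w

/-- The claim at the beginning of block `b`, where `m b` are the messages in block `b`. -/
def claim (d : ℕ) (w : ℕ → F) (m : ℕ → ℕ → F) : ℕ → F
  | 0 => 0
  | b + 1 => nextClaim d (blockIdx d b) (m b) (w b)

/-- The verifier's test at the end of block `b`. -/
def Check (d : ℕ) (w : ℕ → F) (m : ℕ → ℕ → F) (b : ℕ) : Prop :=
  if blockIdx d b = d + 1 then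
    b = 0 ∨ claim d w m b = (m b 1 * m b 0) ^ 2 + weight d w b * m b 1
  else claim d w m b =
    m b 0 + point d w b (blockIdx d b - 1) * (m b 1 + m b 2 + m b 3 + m b 4)

/-- The table of the input in block `b`, with the substitutions made so far in its layer. -/
def inputTable (d : ℕ) (a : ℕ → F) (w : ℕ → F) (b : ℕ) : ℕ → F :=
  foldSeq (point d w b) a (blockIdx d b - 1)

/-- The table of the current layer in block `b`. -/
def layerTable (K d : ℕ) (a : ℕ → F) (w : ℕ → F) (b : ℕ) : ℕ → F :=
  foldSeq (point d w b) (layer a (blockLayer K d b)) (blockIdx d b - 1)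

/-- The messages of the honest prover in block `b`. -/
def honest (K d : ℕ) (a : ℕ → F) (w : ℕ → F) (b t : ℕ) : F :=
  if blockIdx d b = d + 1 then
    if t = 0 then layerTable K d a w b 0 else inputTable d a w b 0
  else mle (fun y => point d w b (blockIdx d b + y)) (d - blockIdx d b)
    (coef (weight d w b) (inputTable d a w b) (layerTable K d a w b) t)

/-- The true value of what is claimed at the beginning of block `b`. -/
def truth (K d : ℕ) (a : ℕ → F) (w : ℕ → F) (b : ℕ) : F :=
  mle (fun y => point d w b (blockIdx d b - 1 + y)) (d + 1 - blockIdx d b)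
    (combine (weight d w b) (inputTable d a w b) (layerTable K d a w b))

/-- The relevant messages of block `b` are those of the honest prover. -/
def Agrees (K d : ℕ) (a : ℕ → F) (w : ℕ → F) (m : ℕ → ℕ → F) (b : ℕ) : Prop :=
  if blockIdx d b = d + 1 then m b 0 = honest K d a w b 0 ∧ m b 1 = honest K d a w b 1
  else ∀ t < 5, m b t = honest K d a w b t

variable {K d : ℕ} {a : ℕ → F} {w : ℕ → F} {m : ℕ → ℕ → F} {b : ℕ}

/-- After claims this is linearity of the extension applied to `combine_layer`. In a sum-check
block, the honest polynomial at the coin is the extension of the tables folded at the coin, by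
`combine_fold`. -/
theorem nextClaim_honest (hb : b < K * (d + 1)) :
    nextClaim d (blockIdx d b) (honest K d a w b) (w b) = truth K d a w (b + 1) := by
  by_cases hi : blockIdx d b = d + 1
  · obtain ⟨l, hl⟩ := Nat.exists_eq_succ_of_ne_zero (blockLayer_pos hb hi).ne'
    have h1 : blockIdx d (b + 1) = 1 := by rw [blockIdx, if_pos hi]
    have h2 : blockLayer K d (b + 1) = l := by rw [blockLayer, if_pos hi, hl]; rfl
    have h3 : point d w (b + 1) = point d w b := by rw [point, if_pos hi]
    have h4 : weight d w (b + 1) = w b := by rw [weight, if_pos hi]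
    simp only [truth, inputTable, layerTable, h1, h2, h3, h4, Nat.sub_self, foldSeq,
      combine_layer, mle_add, mle_smul, nextClaim, honest, hi, hl, zero_add,
      Nat.add_sub_cancel]
    simp [mle]
  · have h0 := one_le_blockIdx d b
    have h0' := blockIdx_le d b
    have h1 : blockIdx d (b + 1) = blockIdx d b + 1 := by rw [blockIdx, if_neg hi]
    have h2 : blockLayer K d (b + 1) = blockLayer K d b := by rw [blockLayer, if_neg hi]
    have h3 : point d w (b + 1) = Function.update (point d w b) (blockIdx d b - 1) (w b) := by
      rw [point, if_neg hi]
    have h4 : weight d w (b + 1) = weight d w b := by rw [weight, if_neg hi]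
    obtain ⟨i, hi'⟩ := Nat.exists_eq_add_of_le' h0
    -- Replacing coordinate i does not disturb the folds of the coordinates below i that are already
    -- in the tables.
    have hA : ∀ f : ℕ → F, foldSeq (Function.update (point d w b) i (w b)) f (i + 1) =
        fold (w b) (foldSeq (point d w b) f i) := by
      intro f
      rw [foldSeq, Function.update_self]
      congr 1
      exact foldSeq_congr_point f fun j hj => Function.update_of_ne (by lia) _ _
    simp only [truth, inputTable, layerTable, h1, h2, h3, h4, hi', Nat.add_sub_cancel, hA]
    simp only [nextClaim, ← hi', if_neg hi]
    have : honest K d a w b = fun t => mle (fun y => point d w b (blockIdx d b + y))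
        (d - blockIdx d b)
        (coef (weight d w b) (inputTable d a w b) (layerTable K d a w b) t) := by
      ext t; rw [honest, if_neg hi]
    rw [this, horner_mle, show d + 1 - (blockIdx d b + 1) = d - blockIdx d b by lia]
    refine mle_congr (fun j _ => ?_) fun x _ => ?_
    · rw [Function.update_of_ne (by lia), hi']
    · rw [← combine_fold, inputTable, layerTable, hi', Nat.add_sub_cancel]

/-- Honest messages pass the test of block `b` if and only if the claim is true. -/
theorem check_honest_iff (h0 : b ≠ 0) (hm : Agrees K d a w m b) :
    Check d w m b ↔ claim d w m b = truth K d a w b := by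
  by_cases hi : blockIdx d b = d + 1
  · rw [Agrees, if_pos hi] at hm
    rw [Check, if_pos hi, hm.1, hm.2, truth, hi, Nat.sub_self]
    simp [h0, mle, foldSeq, combine, honest, hi]
  · have h1 := one_le_blockIdx d b
    have h1' := blockIdx_le d b
    rw [Agrees, if_neg hi] at hm
    rw [Check, if_neg hi, truth, show d + 1 - blockIdx d b = d - blockIdx d b + 1 by lia, mle_succ]
    -- Folding the first remaining coordinate expresses the true claim in the coefficients that an
    -- honest message contains.
    have : fold (point d w b (blockIdx d b - 1 + 0))
        (combine (weight d w b) (inputTable d a w b) (layerTable K d a w b)) =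
        coef (weight d w b) (inputTable d a w b) (layerTable K d a w b) 0 +
        point d w b (blockIdx d b - 1) •
        (coef (weight d w b) (inputTable d a w b) (layerTable K d a w b) 1 +
        coef (weight d w b) (inputTable d a w b) (layerTable K d a w b) 2 +
        coef (weight d w b) (inputTable d a w b) (layerTable K d a w b) 3 +
        coef (weight d w b) (inputTable d a w b) (layerTable K d a w b) 4) := by
      ext x
      rw [fold_combine]; rfl
    rw [this]
    simp only [mle_add, mle_smul, hm 0 (by lia), hm 1 (by lia), hm 2 (by lia), hm 3 (by lia),
      hm 4 (by lia), honest, if_neg hi]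
    have h2 : ∀ y, blockIdx d b - 1 + (y + 1) = blockIdx d b + y := fun y => by lia
    simp only [h2]

theorem nextClaim_congr {i : ℕ} {m m' : ℕ → F} {w : F}
    (h : if i = d + 1 then m 0 = m' 0 ∧ m 1 = m' 1 else ∀ t < 5, m t = m' t) :
    nextClaim d i m w = nextClaim d i m' w := by
  rw [nextClaim, nextClaim]
  split_ifs at h ⊢ with hi
  · rw [h.1, h.2]
  · simp only [horner, h 0 (by lia), h 1 (by lia), h 2 (by lia), h 3 (by lia), h 4 (by lia)]

/-- In conversation with the honest prover, the verifier's tests do not fail. -/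
theorem check_of_honest (hb : b ≤ K * (d + 1)) (hm : ∀ b, Agrees K d a w m b) :
    Check d w m b := by
  cases b with
  | zero => simp [Check, blockIdx]
  | succ b =>
    rw [check_honest_iff (by lia) (hm _), claim, ← nextClaim_honest (by lia)]
    exact nextClaim_congr (hm b)

/-- The random element of block `b` hides that the messages of block `b` are wrong. -/
def Collision (K d : ℕ) (a : ℕ → F) (w : ℕ → F) (m : ℕ → ℕ → F) (b : ℕ) : Prop :=
  ¬ Agrees K d a w m b ∧ nextClaim d (blockIdx d b) (m b) (w b) =
    nextClaim d (blockIdx d b) (honest K d a w b) (w b)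

/-- Without a collision, if the last messages are correct then so are the first ones. -/
theorem agrees_zero (hc : ∀ b < K * (d + 1), ¬ Collision K d a w m b)
    (hk : ∀ b ≤ K * (d + 1), Check d w m b) (hlast : Agrees K d a w m (K * (d + 1))) :
    Agrees K d a w m 0 := by
  -- The induction goes from the last block to the first. Correctness of block b + 1 and its test
  -- make the claim left by block b true, so wrong messages in block b would be a collision.
  have key : ∀ j ≤ K * (d + 1), Agrees K d a w m (K * (d + 1) - j) := by
    intro j
    induction j with
    | zero => intro _; exact hlast
    | succ j ih =>
      intro hj
      have h1 := ih (by lia)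
      obtain ⟨b, hb⟩ : ∃ b, K * (d + 1) - j = b + 1 := ⟨K * (d + 1) - (j + 1), by lia⟩
      rw [hb] at h1
      rw [show K * (d + 1) - (j + 1) = b by lia]
      by_contra hcon
      refine hc b (by lia) ⟨hcon, ?_⟩
      rw [nextClaim_honest (by lia), ← (check_honest_iff (by lia) h1).mp (hk _ (by lia)), claim]
  simpa using key _ le_rfl

/-- At most four random elements cause a collision. -/
theorem ncard_nextClaim_eq_le {i : ℕ} {m m' : ℕ → F}
    (h : ¬ if i = d + 1 then m 0 = m' 0 ∧ m 1 = m' 1 else ∀ t < 5, m t = m' t) :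
    {v | nextClaim d i m v = nextClaim d i m' v}.ncard ≤ 4 := by
  simp only [nextClaim]
  split_ifs at h ⊢ with hi
  -- Only the first two messages of a block of claims matter; padding them with zeros makes the
  -- affine case an instance of degree four.
  · let z : (ℕ → F) → ℕ → F := fun m t => if t < 2 then m t else 0
    have : ∀ m v, m 0 + v * m 1 = horner (z m) v := by intro m v; simp [horner, z]
    simp only [this]
    refine ncard_horner_eq_le _ _ ?_
    by_cases h0 : m 0 = m' 0
    · exact ⟨1, by lia, by simpa [z] using fun h1 => h ⟨h0, h1⟩⟩
    · exact ⟨0, by lia, by simpa [z] using h0⟩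
  · push Not at h
    exact ncard_horner_eq_le _ _ h

theorem point_congr {w w' : ℕ → F} (h : ∀ b' < b, w b' = w' b') : point d w b = point d w' b := by
  induction b with
  | zero => rfl
  | succ b ih => rw [point, point, ih fun b' hb' => h b' (by lia), h b (by lia)]

theorem weight_congr {w w' : ℕ → F} (h : ∀ b' < b, w b' = w' b') :
    weight d w b = weight d w' b := by
  induction b with
  | zero => rfl
  | succ b ih => rw [weight, weight, ih fun b' hb' => h b' (by lia), h b (by lia)]

/-- The honest messages of a block are fixed before its coin is drawn, which is what allows the
roots to be counted for that coin alone. -/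
theorem honest_congr {w w' : ℕ → F} (h : ∀ b' < b, w b' = w' b') (t : ℕ) :
    honest K d a w b t = honest K d a w' b t := by
  simp only [honest, inputTable, layerTable, point_congr h, weight_congr h]

/-- In the last layer, the point is replaced by the one of the last random elements. -/
theorem point_last {w : ℕ → F} {z : ℕ → F} (hK : 0 < K)
    (hw : ∀ b < K * (d + 1), blockLayer K d b = 0 → w b = z (blockIdx d b - 1)) :
    ∀ j < d, point d w (K * (d + 1)) j = z j := by
  have key : ∀ b ≤ K * (d + 1), blockLayer K d b = 0 →
      ∀ j < blockIdx d b - 1, point d w b j = z j := by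
    intro b
    induction b with
    -- The first block belongs to layer K, which `hK` separates from layer 0; it needs no secret
    -- coordinates.
    | zero => intro _ h; simp [blockLayer] at h; lia
    | succ b ih =>
      intro hb hl j hj
      by_cases hi : blockIdx d b = d + 1
      · rw [blockIdx, if_pos hi] at hj; lia
      · rw [blockIdx, if_neg hi] at hj
        rw [blockLayer, if_neg hi] at hl
        rw [point, if_neg hi, Function.update_apply]
        split_ifs with hji
        · rw [hji, hw b (by lia) hl]
        · exact ih (by lia) hl j (by lia)
  have := key _ le_rfl (blockLayer_last K d)
  rwa [blockIdx_last] at this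

end Protocol

/-! ## Simplification of program values -/

section Eval

variable {q : ℕ}

theorem eval_sub (x y : ℕ) : Op.eval q .sub x y = x - y := rfl
theorem eval_div (x y : ℕ) : Op.eval q .div x y = x / y := rfl
theorem eval_mod (x y : ℕ) : Op.eval q .mod x y = x % y := rfl
theorem eval_lt (x y : ℕ) : Op.eval q .lt x y = if x < y then 1 else 0 := rfl
theorem eval_eq (x y : ℕ) : Op.eval q .eq x y = if x = y then 1 else 0 := rfl
theorem eval_fadd (x y : ℕ) : Op.eval q .fadd x y = ((x : ZMod q) + (y : ZMod q)).val := rfl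
theorem eval_fsub (x y : ℕ) : Op.eval q .fsub x y = ((x : ZMod q) - (y : ZMod q)).val := rfl
theorem eval_fmul (x y : ℕ) : Op.eval q .fmul x y = ((x : ZMod q) * (y : ZMod q)).val := rfl

end Eval

infixr:65 " ;; " => Cmd.seq

/-! ## Initialization -/

/-- The initialization of both parties. Cell `2` gets the number `n` of items, cell `4` the number
`d` of bits of an item, cell `6` the number `2 ^ d`, cell `17` the field element `1 / 2`, cell `5`
the number of layers, and cell `14` the block index. The mode in cell `3` is `0` if the field is
small, `1` if `n ≤ log (q + 1)`, and `2` otherwise. For each bit, the command `c` is executed. -/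
def initCmd (c : Cmd) : Cmd :=
  .setReg 2 (.reg 0) ;;
  .ite (.op .lt (.reg 1) (.const 4096)) .skip
    (.setReg 17 (.op .div (.op .add (.reg 1) (.const 1)) (.const 2)) ;;
    .setReg 6 (.const 1) ;;
    .setReg 13 (.const 1) ;;
    .while (.op .lt (.reg 6) (.reg 2))
      (c ;; .setReg 6 (.op .mul (.reg 6) (.const 2)) ;;
      .setReg 4 (.op .add (.reg 4) (.const 1))) ;;
    .setReg 18 (.const 1) ;;
    .while (.op .mul (.op .lt (.reg 18) (.reg 1)) (.op .lt (.reg 5) (.reg 2)))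
      (.setReg 18 (.op .mul (.reg 18) (.const 2)) ;;
      .setReg 5 (.op .add (.reg 5) (.const 1))) ;;
    .ite (.op .lt (.reg 5) (.reg 2))
      (.setReg 3 (.const 2) ;;
      .setReg 5 (.op .sub (.reg 5) (.const 1)) ;;
      .setReg 14 (.op .add (.reg 4) (.const 1)))
      (.setReg 3 (.const 1)))

theorem half_val {q : ℕ} [Fact q.Prime] (h : q % 2 = 1) : (1 / 2 : ZMod q).val = (q + 1) / 2 := by
  have hq := (Fact.out : q.Prime).two_le
  have h2 : ((2 : ℕ) : ZMod q) ≠ 0 := by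
    rw [Ne, ZMod.natCast_eq_zero_iff]
    intro hdvd
    have := Nat.le_of_dvd (by lia) hdvd
    lia
  have : (1 / 2 : ZMod q) = (((q + 1) / 2 : ℕ) : ZMod q) := by
    rw [div_eq_iff (by exact_mod_cast h2)]
    have h3 : (((q + 1) / 2 * 2 : ℕ) : ZMod q) = ((q + 1 : ℕ) : ZMod q) := by
      congr 1; lia
    push_cast at h3
    rw [ZMod.natCast_self] at h3
    simpa using h3.symm
  rw [this, ZMod.val_natCast, Nat.mod_eq_of_lt (by lia)]

theorem pow_lt_iff_lt_clog {n j : ℕ} : 2 ^ j < n ↔ j < Nat.clog 2 n := by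
  rw [← not_le, ← not_le, Nat.clog_le_iff_le_pow (by lia)]

/-- What is known after the initialization for a large field. -/
structure InitPost (n q k : ℕ) (r : State) : Prop where
  items : r.mem 2 = n
  mode : r.mem 3 = if k < n then 2 else 1
  bits : r.mem 4 = Nat.clog 2 n
  layers : k < n → r.mem 5 = k - 1
  size : r.mem 6 = 2 ^ Nat.clog 2 n
  ok : r.mem 13 = 1
  idx : k < n → r.mem 14 = Nat.clog 2 n + 1
  half : r.mem 17 = (q + 1) / 2
  rest : ∀ a < 100, a ∉ [0, 1, 2, 3, 4, 5, 6, 13, 14, 17, 18] → r.mem a = 0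

theorem zero_update {m : ℕ → ℕ} {l : List ℕ} {c v : ℕ} (h : ∀ a < 100, a ∉ l → m a = 0)
    (hc : c ∈ l) : ∀ a < 100, a ∉ l → Function.update m c v a = 0 := by
  intro a ha hal
  rw [Function.update_of_ne (by rintro rfl; exact hal hc), h a ha hal]

/-- The two parties share this program and differ only in the command per bit. `J` abstracts its
effect; it may depend on the tape and the cells from 100 on, which the common part leaves alone. -/
theorem reach_init {n q M k T : ℕ} {c : Cmd} {l : List ℕ} (J : ℕ → State → Prop)
    (hn : n < q) (hn2 : 2 ≤ n) (hq : 4096 ≤ q) (hk : q = 2 ^ k - 1) (hM : 100 ≤ M)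
    (hJ : ∀ j s s', (∀ a, 100 ≤ a → s'.mem a = s.mem a) → s'.tape = s.tape → J j s → J j s')
    (hc : ∀ j < Nat.clog 2 n, ∀ s, s.mem 4 = j → s.mem 17 = (q + 1) / 2 → J j s →
      Reach q M c s T fun r => J (j + 1) r ∧ ∀ a < 100, r.mem a = s.mem a)
    (h0 : J 0 ⟨fun _ => 0, l⟩) :
    Reach q M (initCmd c) (State.input ⟨fun _ => 0, l⟩ n q)
      (100 + Nat.clog 2 n * (T + 100) + n * 100)
      fun r => InitPost n q k r ∧ J (Nat.clog 2 n) r := by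
  set d := Nat.clog 2 n with hd
  have hqq : 4096 * q ≤ q ^ 2 := by nlinarith
  have hdn : d ≤ n := Nat.clog_le_of_le_pow (Nat.lt_two_pow_self).le
  have hpow : ∀ j < d, 2 ^ j < n := fun j hj => pow_lt_iff_lt_clog.mpr hj
  have hk12 : 12 ≤ k := by
    by_contra hcon
    have : 2 ^ k ≤ 2 ^ 11 := Nat.pow_le_pow_right (by lia) (by lia)
    lia
  -- The summands follow the commands in order; the bound in the statement is a coarser one.
  refine Reach.mono (T := 4 + (5 + (8 + (3 + (3 + ((d * (6 + (T + 12)) + 6) + (3 +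
    ((n * (12 + 12) + 12) + (6 + 15))))))))) ?_ (by ring_nf; lia) fun _ => id
  refine Reach.setReg_seq (by lia) (Reach.branch (fun hb => ?_) fun hb => ?_)
  · exfalso
    simp [Exp.eval, eval_lt, State.input, State.write] at hb
    lia
  refine Reach.setReg_seq (by lia) (Reach.setReg_seq (by lia) (Reach.setReg_seq (by lia) ?_))
  let I : ℕ → State → Prop := fun j s => s.mem 1 = q ∧ s.mem 2 = n ∧ s.mem 4 = j ∧
    s.mem 6 = 2 ^ j ∧ s.mem 13 = 1 ∧ s.mem 17 = (q + 1) / 2 ∧ J j s ∧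
    ∀ a < 100, a ∉ [0, 1, 2, 4, 6, 13, 14, 17, 18] → s.mem a = 0
  refine Reach.seq (P := I d) (Reach.loop I d (T := T + 12) (k := 6) ?_ ?_ ?_ le_rfl) ?_
  · rintro s ⟨-, h2, -, h6, -⟩
    simp [Exp.eval, eval_lt, h2, h6]
    exact Nat.le_pow_clog (by lia) n
  · rintro j hj s ⟨h1, h2, h4, h6, h13, h17, hJs, hz⟩
    refine ⟨by simp [Exp.eval, eval_lt, h2, h6, hpow j hj], ?_⟩
    refine Reach.seq (hc j hj s h4 h17 hJs) fun r ⟨hr, hr'⟩ => ?_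
    have hpj := hpow j hj
    refine Reach.step ?_
    have e6 : r.mem 6 = 2 ^ j := by rw [hr' 6 (by lia), h6]
    have e4 : r.mem 4 = j := by rw [hr' 4 (by lia), h4]
    have hpj' : 2 ^ (j + 1) = 2 ^ j * 2 := pow_succ 2 j
    simp (disch := lia) [Cmd.wp, Exp.eval, State.write, e6, e4, eval_mul_of_lt,
      eval_add_of_lt, Function.update_apply]
    refine ⟨by lia, by lia, ?_, ?_, ?_, ?_, ?_, ?_, ?_, ?_⟩
    · simp [hr', h1]
    · simp [hr', h2]
    · simp
    · simp [hpj']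
    · simp [hr', h13]
    · simp [hr', h17]
    · exact hJ (j + 1) r _ (fun a ha => by simp (disch := lia) [Function.update_of_ne]) rfl hr
    · exact zero_update (zero_update (fun a ha hal => by rw [hr' a ha, hz a ha hal]) (by simp))
        (by simp)
  · refine ⟨?_, ?_, ?_, ?_, ?_, ?_, ?_, ?_⟩
    on_goal 7 => exact hJ 0 ⟨fun _ => 0, l⟩ _ (fun a ha => by
      simp (disch := lia) [State.write, State.input, Function.update_of_ne]) rfl h0
    on_goal 7 =>
      refine zero_update (zero_update (zero_update (zero_update (zero_update (zero_update
        (fun a ha hal => rfl) ?_) ?_) ?_) ?_) ?_) ?_ <;> simp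
    all_goals
      simp (disch := lia) [Exp.eval, State.write, State.input, eval_add_of_lt, eval_div]
  rintro s ⟨h1, h2, h4, h6, h13, h17, hJs, hz⟩
  refine Reach.setReg_seq (by lia) ?_
  let I' : ℕ → State → Prop := fun j s => s.mem 1 = q ∧ s.mem 2 = n ∧ s.mem 4 = d ∧
    s.mem 5 = j ∧ s.mem 6 = 2 ^ d ∧ s.mem 13 = 1 ∧ s.mem 17 = (q + 1) / 2 ∧ s.mem 18 = 2 ^ j ∧
    J d s ∧ ∀ a < 100, a ∉ [0, 1, 2, 4, 5, 6, 13, 14, 17, 18] → s.mem a = 0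
  have hkpow : ∀ j < k, 2 ^ j < q := by
    intro j hj
    have h₁ : 2 ^ j ≤ 2 ^ (k - 1) := Nat.pow_le_pow_right (by lia) (by lia)
    have h₂ : 2 ^ k = 2 * 2 ^ (k - 1) := by rw [← pow_succ', show k - 1 + 1 = k by lia]
    lia
  -- As q = 2^k - 1, the doubling passes q after exactly k steps. The loop also stops after n steps,
  -- because k may be far larger than n and the time must stay O(n); comparing k with n needs no
  -- more.
  refine Reach.seq (P := I' (min k n)) (Reach.loop I' (min k n) (T := 12) (k := 12) ?_ ?_ ?_ ?_) ?_
  · rintro s ⟨h1, h2, -, h5, -, -, -, h18, -⟩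
    rcases Nat.le_total k n with hkn | hkn
    · rw [min_eq_left hkn] at h5 h18
      have : ¬ 2 ^ k < q := by lia
      simp [Exp.eval, eval_lt, h1, h2, h5, h18, this, Op.eval]
    · rw [min_eq_right hkn] at h5 h18
      simp [Exp.eval, eval_lt, h1, h2, h5, h18, Op.eval]
  · rintro j hj s ⟨h1, h2, h4, h5, h6, h13, h17, h18, hJs, hz⟩
    have hj' := hkpow j (by lia)
    have hjn : j < n := by lia
    have hpj' : 2 ^ (j + 1) = 2 ^ j * 2 := pow_succ 2 j
    refine ⟨?_, Reach.step ?_⟩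
    · simp [Exp.eval, eval_lt, h1, h2, h5, h18, hj', hjn]
      rw [eval_mul_of_lt (by lia)]
      lia
    · simp (disch := lia) [Cmd.wp, Exp.eval, State.write, h5, h18, eval_mul_of_lt,
        eval_add_of_lt, Function.update_apply]
      refine ⟨by lia, by lia, ?_, ?_, ?_, ?_, ?_, ?_, ?_, ?_, ?_, ?_⟩
      · simp [h1]
      · simp [h2]
      · simp [h4]
      · simp
      · simp [h6]
      · simp [h13]
      · simp [h17]
      · simp [hpj']
      · exact hJ d s _ (fun a ha => by simp (disch := lia) [Function.update_of_ne]) rfl hJs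
      · exact zero_update (zero_update hz (by simp)) (by simp)
  · refine ⟨?_, ?_, ?_, ?_, ?_, ?_, ?_, ?_, ?_, ?_⟩
    on_goal 9 => exact hJ d s _ (fun a ha => by
      simp (disch := lia) [State.write, Function.update_of_ne]) rfl hJs
    on_goal 9 =>
      refine zero_update (fun a ha hal => hz a ha ?_) (by simp)
      contrapose! hal
      simp at hal ⊢
      lia
    all_goals simp [State.write, Exp.eval, h1, h2, h4, h6, h13, h17, hz]
  · have := Nat.min_le_right k n
    lia
  rintro s ⟨h1, h2, h4, h5, h6, h13, h17, -, hJs, hz⟩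
  refine Reach.branch (fun hb => ?_) fun hb => ?_
  · have hkn : k < n := by
      by_contra hcon
      rw [min_eq_right (by lia)] at h5
      simp [Exp.eval, eval_lt, h2, h5] at hb
    rw [min_eq_left hkn.le] at h5
    refine Reach.step ?_
    simp (disch := lia) [Cmd.wp, Exp.eval, State.write, h4, h5, eval_sub, eval_add_of_lt,
      Function.update_apply]
    refine ⟨by lia, by lia, by lia, ⟨?_, ?_, ?_, ?_, ?_, ?_, ?_, ?_, ?_⟩, ?_⟩
    · simp [h2]
    · simp [hkn]
    · simp [h4, hd]
    · simp
    · simp [h6, hd]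
    · simp [h13]
    · simp [hd]
    · simp [h17]
    · refine zero_update (zero_update (zero_update (fun a ha hal => hz a ha ?_) ?_) ?_) ?_
      · contrapose! hal
        simp at hal ⊢
        lia
      all_goals simp
    · exact hJ d s _ (fun a ha => by simp (disch := lia) [Function.update_of_ne]) rfl hJs
  · have hkn : ¬ k < n := by
      intro hcon
      rw [min_eq_left hcon.le] at h5
      simp [Exp.eval, eval_lt, h2, h5] at hb
      lia
    refine Reach.step ?_
    simp [Cmd.wp, Exp.eval, State.write]
    refine ⟨by lia, ⟨?_, ?_, ?_, ?_, ?_, ?_, ?_, ?_, ?_⟩, ?_⟩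
    · simp [h2]
    · simp [hkn]
    · simp [h4, hd]
    · intro h; lia
    · simp [h6, hd]
    · simp [h13]
    · intro h; lia
    · simp [h17]
    · refine zero_update (fun a ha hal => hz a ha ?_) (by simp)
      contrapose! hal
      simp at hal ⊢
      lia
    · exact hJ d s _ (fun a ha => by simp (disch := lia) [Function.update_of_ne]) rfl hJs

theorem reach_init_small {n q M : ℕ} {c : Cmd} {l : List ℕ} (hq : q < 4096) (hM : 100 ≤ M) :
    Reach q M (initCmd c) (State.input ⟨fun _ => 0, l⟩ n q) 100 fun r =>
      r.mem 2 = n ∧ r.tape = l ∧ ∀ a, 3 ≤ a → r.mem a = 0 := by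
  refine Reach.mono (T := 4 + (5 + 1)) ?_ (by lia) fun _ => id
  refine Reach.setReg_seq (by lia) (Reach.branch (fun hb => Reach.step ?_) fun hb => ?_)
  · simp only [Cmd.wp, State.write, State.input, Exp.eval]
    refine ⟨by simp, trivial, fun a ha => ?_⟩
    simp (disch := lia) [Function.update_of_ne]
  · exfalso
    simp [Exp.eval, eval_lt, State.input, State.write] at hb
    lia

/-! ## The table of a stream -/

/-- The frequencies of a stream in the field with `q` elements. -/
def table {n : ℕ} (q : ℕ) (x : DataStream n) (i : ℕ) : ZMod q :=
  if h : i < n then (freq x ⟨i, h⟩ : ZMod q) else 0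

theorem table_nil {n q : ℕ} : table q ([] : DataStream n) = 0 := by
  ext i; simp [table, freq]

theorem table_append {n q : ℕ} (y : DataStream n) (i : Fin n) (δ : ℤ) :
    table q (y ++ [(i, δ)]) = table q y + Pi.single (i : ℕ) (δ : ZMod q) := by
  ext j
  by_cases hj : j < n
  · have : (i = ⟨j, hj⟩) ↔ j = i := by rw [Fin.ext_iff, eq_comm]
    simp only [table, hj, dif_pos, freq, List.map_append, List.sum_append, List.map_cons,
      List.map_nil, List.sum_cons, List.sum_nil, add_zero, Pi.add_apply, Pi.single_apply, this]
    split_ifs <;> simp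
  · have : j ≠ i := by lia
    simp [table, hj, this]

theorem table_eq_zero_iff {n q : ℕ} {x : DataStream n} (h : NoOverflow q x) (i : Fin n) :
    table q x i = 0 ↔ freq x i = 0 := by
  rw [table, dif_pos i.2, Fin.eta, ZMod.intCast_zmod_eq_zero_iff_dvd]
  exact ⟨h i, fun h0 => h0 ▸ dvd_zero _⟩

/-- The number of distinct items, from the table. -/
theorem distinct_eq {n q : ℕ} {x : DataStream n} (h : NoOverflow q x) :
    distinct x = ((Finset.range n).filter fun i => table q x i ≠ 0).card := by
  refine Finset.card_bij (fun i _ => (i : ℕ)) (fun i hi => ?_) (fun i _ j _ hij => Fin.ext hij)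
    fun j hj => ?_
  · simpa [table_eq_zero_iff h] using hi
  · rw [Finset.mem_filter, Finset.mem_range] at hj
    exact ⟨⟨j, hj.1⟩, by simpa [← table_eq_zero_iff h] using hj.2, rfl⟩

theorem frame_update {m m₀ : ℕ → ℕ} {l : List ℕ} {c v : ℕ} (h : ∀ a, a ∉ l → m a = m₀ a)
    (hc : c ∈ l) : ∀ a, a ∉ l → Function.update m c v a = m₀ a := by
  intro a hal
  rw [Function.update_of_ne (by rintro rfl; exact hal hc), h a hal]

/-! ## The verifier -/

/-- The value at the secret point of the multilinear extension of the indicator of the item in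
cell `12`. -/
def indicatorCmd : Cmd :=
  .setReg 11 (.const 1) ;;
  .setReg 10 (.const 0) ;;
  .while (.op .lt (.reg 10) (.reg 4))
    (.ite (.op .mod (.reg 12) (.const 2))
      (.setReg 11 (.op .fmul (.reg 11) (.load (.op .add (.op .mul (.reg 10) (.const 2))
        (.const 101)))))
      (.setReg 11 (.op .fmul (.reg 11) (.op .fsub (.const 1)
        (.load (.op .add (.op .mul (.reg 10) (.const 2)) (.const 101)))))) ;;
    .setReg 12 (.op .div (.reg 12) (.const 2)) ;;
    .setReg 10 (.op .add (.reg 10) (.const 1)))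

/-- The item is shifted right once per iteration, so its parity is the bit that selects the factor.
`hdq` keeps the address arithmetic below the modulus `q ^ 2`. -/
theorem reach_indicator {q M d x : ℕ} [Fact q.Prime] {z : ℕ → ZMod q} {s : State}
    (hM : 100 ≤ M) (hdq : 2 * d + 101 < q ^ 2) (hd : s.mem 4 = d) (hx : s.mem 12 = x)
    (hz : ∀ j < d, s.mem (j * 2 + 101) = (z j).val) :
    Reach q M indicatorCmd s (20 + d * 60) fun r => r.mem 11 = (indicatorMle z x d).val ∧
      r.tape = s.tape ∧ ∀ a, a ∉ [10, 11, 12] → r.mem a = s.mem a := by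
  have : Fact (1 < q) := ⟨(Fact.out : q.Prime).one_lt⟩
  refine Reach.mono (T := 3 + (3 + (d * (6 + 40) + 6))) ?_ (by lia) fun _ => id
  refine Reach.setReg_seq (by lia) (Reach.setReg_seq (by lia) ?_)
  refine Reach.mono (Reach.loop (fun j r => r.mem 11 = (indicatorMle z x j).val ∧ r.mem 10 = j ∧
    r.mem 12 = x / 2 ^ j ∧ r.tape = s.tape ∧ ∀ a, a ∉ [10, 11, 12] → r.mem a = s.mem a) d
    (T := 40) (k := 6) ?_ ?_ ?_ le_rfl) le_rfl ?_
  · rintro r ⟨-, h10, -, -, hr⟩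
    simp [Exp.eval, eval_lt, h10, hr, hd]
  · rintro j hj r ⟨h11, h10, h12, ht, hr⟩
    have h4 : r.mem 4 = d := by rw [hr 4 (by simp), hd]
    have hzj : r.mem (j * 2 + 101) = (z j).val := by rw [hr _ (by simp), hz j hj]
    refine ⟨by simp [Exp.eval, eval_lt, h10, h4, hj], Reach.step ?_⟩
    simp (disch := lia) only [Cmd.wp, Exp.eval, State.write, h10, h12, h11, hzj, eval_mul_of_lt,
      eval_add_of_lt, eval_fmul, eval_fsub, eval_mod, eval_div, Function.update_self,
      Function.update_of_ne, ZMod.natCast_zmod_val, Nat.cast_one]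
    have hodd : x / 2 ^ j % 2 = 0 ∨ x / 2 ^ j % 2 = 1 := by lia
    refine ⟨fun hb => ?_, fun hb => ?_⟩ <;>
    · refine ⟨by lia, by lia, by lia, ?_, trivial, ?_, ht,
        frame_update (frame_update (frame_update hr (by simp)) (by simp)) (by simp)⟩
      · rcases hodd with h | h <;> simp [h, indicatorMle] at hb ⊢
      · rw [pow_succ, Nat.div_div_eq_div_mul]
  · refine ⟨?_, ?_, ?_, rfl, frame_update (frame_update (fun a _ => rfl) (by simp)) (by simp)⟩
    · simp [Exp.eval, State.write, indicatorMle, ZMod.val_one]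
    · simp [Exp.eval, State.write]
    · simp [State.write, hx]
  · exact fun r hr => ⟨hr.1, hr.2.2.2⟩

/-- Processing of an update by the verifier. -/
def updateCmd : Cmd :=
  .ite (.reg 3)
    (.setReg 12 (.reg 0) ;; indicatorCmd ;;
      .setReg 7 (.op .fadd (.reg 7) (.op .fmul (.reg 11) (.reg 1))))
    (.set (.op .sub (.const 5000) (.reg 0))
      (.op .fadd (.load (.op .sub (.const 5000) (.reg 0))) (.reg 1)))

/-- Processing of the next frequency, in the modes in which the frequencies are listed. -/
def listCmd : Cmd :=
  .ite (.reg 3)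
    (.setReg 12 (.reg 8) ;; indicatorCmd ;;
      .setReg 7 (.op .fsub (.reg 7) (.op .fmul (.reg 11) (.reg 0))))
    (.setReg 0 (.load (.op .sub (.const 5000) (.reg 8)))) ;;
  .setReg 9 (.op .add (.reg 9) (.op .lt (.const 0) (.reg 0))) ;;
  .setReg 8 (.op .add (.reg 8) (.const 1)) ;;
  .ite (.op .lt (.reg 8) (.reg 2))
    (.setReg 0 (.const 0))
    (.setReg 1 (.op .sub (.const 2) (.op .eq (.reg 7) (.const 0))) ;; .setReg 0 (.reg 9))

/-- The verifier at the end of a block with claims. The claims are in the cells `20` and `21`. -/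
def claimsCmd : Cmd :=
  .ite (.reg 19)
    (.setReg 13 (.op .mul (.reg 13) (.op .eq (.reg 16)
      (.op .fadd (.op .fmul (.op .fmul (.reg 21) (.reg 20)) (.op .fmul (.reg 21) (.reg 20)))
        (.op .fmul (.reg 15) (.reg 21))))))
    (.setReg 9 (.op .fmul (.reg 6) (.reg 20)) ;; .setReg 19 (.const 1)) ;;
  .ite (.reg 5)
    (.setReg 15 (.reg 0) ;;
      .setReg 16 (.op .fadd (.reg 20) (.op .fmul (.reg 0) (.reg 21))) ;;
      .setReg 14 (.const 1) ;;
      .setReg 5 (.op .sub (.reg 5) (.const 1)))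
    (.setReg 1 (.op .sub (.const 2) (.op .mul (.reg 13)
        (.op .mul (.op .eq (.reg 20) (.const 1)) (.op .eq (.reg 21) (.reg 7))))) ;;
      .setReg 0 (.reg 9))

/-- The verifier at the end of a round of the sum-check protocol. The coefficients are in the cells
`20, …, 24`. -/
def sumcheckCmd : Cmd :=
  .setReg 13 (.op .mul (.reg 13) (.op .eq (.reg 16) (.op .fadd (.reg 20) (.op .fmul
    (.load (.op .add (.op .mul (.reg 14) (.const 2)) (.const 98)))
    (.op .fadd (.op .fadd (.op .fadd (.reg 21) (.reg 22)) (.reg 23)) (.reg 24)))))) ;;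
  .ite (.reg 5) .skip
    (.setReg 0 (.load (.op .add (.op .mul (.reg 14) (.const 2)) (.const 99)))) ;;
  .set (.op .add (.op .mul (.reg 14) (.const 2)) (.const 98)) (.reg 0) ;;
  .setReg 16 (.op .fadd (.reg 20) (.op .fmul (.reg 0) (.op .fadd (.reg 21) (.op .fmul (.reg 0)
    (.op .fadd (.reg 22) (.op .fmul (.reg 0) (.op .fadd (.reg 23)
      (.op .fmul (.reg 0) (.reg 24))))))))) ;;
  .setReg 14 (.op .add (.reg 14) (.const 1))

/-- The receipt of a message in the layered protocol. The message is stored, and the answer is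
drawn. -/
def receiveCmd : Cmd :=
  .set (.op .add (.reg 8) (.const 20)) (.reg 0) ;;
  .rand (.const 0) ;;
  .setReg 8 (.op .mod (.op .add (.reg 8) (.const 1)) (.const 5))

/-- A round of the layered protocol. -/
def roundCmd : Cmd :=
  receiveCmd ;; .ite (.reg 8) .skip (.ite (.op .lt (.reg 4) (.reg 14)) claimsCmd sumcheckCmd)

/-- The verifier. -/
def verifier : Machine where
  init := initCmd (.rand (.op .add (.op .mul (.reg 4) (.const 2)) (.const 101)) ;;
    .set (.op .add (.op .mul (.reg 4) (.const 2)) (.const 100)) (.reg 17))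
  update := updateCmd
  respond := .ite (.op .eq (.reg 3) (.const 2)) roundCmd listCmd

/-! ### The pass over the stream -/

/-- The invariant on prefixes is that the accumulator holds the extension of the frequencies so far
at the secret point. Linearity makes the order of the updates irrelevant. -/
theorem pass_large {n q M d m : ℕ} [Fact q.Prime] {z : ℕ → ZMod q} {s : State} {x : DataStream n}
    (hm : x.length = m)
    (hM : 100 ≤ M) (hdq : 2 * d + 101 < q ^ 2) (hnd : n ≤ 2 ^ d) (h3 : s.mem 3 ≠ 0)
    (hd : s.mem 4 = d) (h7 : s.mem 7 = 0) (hz : ∀ j < d, s.mem (j * 2 + 101) = (z j).val) :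
    ∃ t r, Pass q M updateCmd x s t r ∧ t ≤ m * (50 + d * 60) ∧
      r.mem 7 = (mle z d (table q x)).val ∧ r.tape = s.tape ∧
      ∀ a, a ∉ [0, 1, 7, 10, 11, 12] → r.mem a = s.mem a := by
  have key := Pass.of_invariant (q := q) (M := M) (c := updateCmd) (fun y r =>
    r.mem 7 = (mle z d (table q y)).val ∧ r.tape = s.tape ∧
      ∀ a, a ∉ [0, 1, 7, 10, 11, 12] → r.mem a = s.mem a) (50 + d * 60) ?_ x [] s ?_
  · obtain ⟨t, r, h₁, h₂, h₃⟩ := key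
    exact ⟨t, r, h₁, hm ▸ h₂, h₃⟩
  · rintro y i δ r ⟨h7', ht, hr⟩
    refine Reach.mono (T := 3 + (4 + ((20 + d * 60) + 10))) ?_ (by lia) fun _ => id
    refine Reach.branch (fun hb => ?_) fun hb => ?_
    · refine Reach.setReg_seq (by lia) (Reach.seq
        (reach_indicator (z := z) (d := d) (x := i) hM hdq ?_ ?_ ?_) ?_)
      · simp [State.write, State.input, hr, hd]
      · simp [State.write, State.input, Exp.eval]
      · intro j hj
        have := hr (j * 2 + 101) (by simp)
        simp (disch := lia) [State.write, State.input, this, hz j hj]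
      · rintro u ⟨h11, hut, hu⟩
        refine Reach.step ?_
        have e7 : u.mem 7 = (mle z d (table q y)).val := by
          rw [hu 7 (by simp)]; simp [State.write, State.input, h7']
        have e1 : u.mem 1 = (δ : ZMod q).val := by
          rw [hu 1 (by simp)]; simp [State.write, State.input]
        refine ⟨by simp [Exp.eval]; lia, ?_, by rw [← ht]; exact hut,
          frame_update (fun a ha => ?_) (by simp [Exp.eval])⟩
        · simp only [State.write, Exp.eval, Function.update_self, eval_fadd, eval_fmul, e7, e1,
            h11, ZMod.natCast_zmod_val]
          rw [table_append, mle_update_add z (lt_of_lt_of_le i.2 hnd)]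
        · simp only [List.mem_cons, not_or] at ha
          rw [hu a (by simp [ha])]
          simp [State.write, State.input, ha, hr]
    · simp [Exp.eval, State.input, State.write, hr, h3] at hb
  · refine ⟨?_, rfl, fun a _ => rfl⟩
    rw [h7, table_nil, mle_zero, ZMod.val_zero]

/-- The list runs downwards from cell 5000: an address formed by addition would be reduced modulo `q
^ 2`, which can be tiny here, while subtraction from a constant is not reduced. As n < 4096, the
list stays clear of the working cells. -/
theorem pass_small {n q M m : ℕ} [Fact q.Prime] {s : State} {x : DataStream n}
    (hm : x.length = m) (hM : 6000 ≤ M) (hn : n < 4096)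
    (hs : ∀ a, 3 ≤ a → s.mem a = 0) :
    ∃ t r, Pass q M updateCmd x s t r ∧ t ≤ m * 50 ∧ r.tape = s.tape ∧ r.mem 2 = s.mem 2 ∧
      (∀ i < n, r.mem (5000 - i) = (table q x i).val) ∧ ∀ a, 3 ≤ a → a < 100 → r.mem a = 0 := by
  have key := Pass.of_invariant (q := q) (M := M) (c := updateCmd) (fun y r =>
    r.tape = s.tape ∧ r.mem 2 = s.mem 2 ∧
      (∀ i < n, r.mem (5000 - i) = (table q y i).val) ∧ ∀ a, 3 ≤ a → a < 100 → r.mem a = 0)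
    50 ?_ x [] s ?_
  · obtain ⟨t, r, h₁, h₂, h₃⟩ := key
    exact ⟨t, r, h₁, hm ▸ h₂, h₃⟩
  · rintro y i δ r ⟨ht, h2, hT, hr⟩
    have hi := i.2
    have h3 : r.mem 3 = 0 := hr 3 (by lia) (by lia)
    refine Reach.mono (T := 3 + 40) ?_ (by lia) fun _ => id
    refine Reach.branch (fun hb => ?_) fun hb => Reach.step ?_
    · simp [Exp.eval, State.input, State.write, h3] at hb
    · have e1 : (r.input i (δ : ZMod q).val).mem 1 = (δ : ZMod q).val := by
        simp [State.input, State.write]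
      have e0 : (r.input i (δ : ZMod q).val).mem 0 = i := by simp [State.input, State.write]
      have er : ∀ a, 2 ≤ a → (r.input i (δ : ZMod q).val).mem a = r.mem a := fun a ha => by
        simp (disch := lia) [State.input, State.write]
      simp only [Cmd.wp, Exp.eval, e0, e1, eval_sub, er (5000 - i) (by lia), hT i i.2, eval_fadd,
        ZMod.natCast_zmod_val, State.write]
      refine ⟨by lia, ht, ?_, fun j hj => ?_, fun a ha ha' => ?_⟩
      · rw [Function.update_of_ne (by lia), er 2 le_rfl, h2]
      · rw [table_append, Pi.add_apply, Pi.single_apply]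
        by_cases hij : j = i
        · subst hij; simp
        · rw [Function.update_of_ne (by lia), er _ (by lia), hT j hj, if_neg hij, add_zero]
      · rw [Function.update_of_ne (by lia), er _ (by lia), hr a ha ha']
  · exact ⟨rfl, rfl, fun i hi => by rw [hs _ (by lia), table_nil]; simp, fun a ha _ => hs a ha⟩

/-! ### The listing of the frequencies -/

/-- The number of nonzero elements among the first `i` ones. -/
def countNonzero {F : Type*} [Zero F] [DecidableEq F] (v : ℕ → F) (i : ℕ) : ℕ :=
  ((Finset.range i).filter fun j => v j ≠ 0).card

theorem countNonzero_succ {F : Type*} [Zero F] [DecidableEq F] (v : ℕ → F) (i : ℕ) :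
    countNonzero v (i + 1) = countNonzero v i + if v i = 0 then 0 else 1 := by
  rw [countNonzero, Finset.range_add_one, Finset.filter_insert]
  by_cases h : v i = 0
  · simp [h, countNonzero]
  · rw [if_pos h, if_neg h, Finset.card_insert_of_notMem (by simp), countNonzero]

theorem countNonzero_le {F : Type*} [Zero F] [DecidableEq F] (v : ℕ → F) (i : ℕ) :
    countNonzero v i ≤ i :=
  (Finset.card_filter_le _ _).trans (Finset.card_range i).le

/-- The memory of the verifier that is common to the two modes in which frequencies are listed. -/
structure ListInv (n q : ℕ) (v : ℕ → ZMod q) (i : ℕ) (s : State) : Prop where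
  items : s.mem 2 = n
  idx : s.mem 8 = i
  count : s.mem 9 = countNonzero v i

/-- The final status is 2 minus the accepting bit: 1 for an output and 2 for ⊥, so the conversation
halts in either case. -/
theorem reach_count {n q M i : ℕ} [Fact q.Prime] {v : ℕ → ZMod q} {s : State} (hM : 100 ≤ M)
    (hn : n < q) (hi : i < n) (h : ListInv n q v i s) (h0 : s.mem 0 = (v i).val)
    (h1 : s.mem 1 = 0) :
    Reach q M (.setReg 9 (.op .add (.reg 9) (.op .lt (.const 0) (.reg 0))) ;;
      .setReg 8 (.op .add (.reg 8) (.const 1)) ;;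
      .ite (.op .lt (.reg 8) (.reg 2))
        (.setReg 0 (.const 0))
        (.setReg 1 (.op .sub (.const 2) (.op .eq (.reg 7) (.const 0))) ;; .setReg 0 (.reg 9)))
      s 60 fun r =>
        (i + 1 < n → r.mem 1 = 0 ∧ r.mem 0 = 0 ∧ ListInv n q v (i + 1) r ∧
          ∀ a, a ∉ [0, 1, 8, 9] → r.mem a = s.mem a) ∧
        (i + 1 = n → r.mem 1 ≠ 0 ∧
          verdict r = if s.mem 7 = 0 then some (countNonzero v n) else none) := by
  obtain ⟨h2, h8, h9⟩ := h
  have hqq : q ≤ q ^ 2 := Nat.le_self_pow (by lia) q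
  have hc := countNonzero_le v i
  have hlt : (if 0 < (v i).val then 1 else 0) = if v i = 0 then 0 else 1 := by
    by_cases h : v i = 0
    · simp [h]
    · have : 0 < (v i).val := Nat.pos_of_ne_zero (by simpa using h)
      simp [h, this]
  have hs := countNonzero_succ v i
  have hle : countNonzero v i + (if v i = 0 then 0 else 1) < q ^ 2 := by split_ifs <;> lia
  refine Reach.step ?_
  simp (disch := lia) only [Cmd.wp, Exp.eval, State.write, h9, h8, h0, h2, eval_lt, hlt,
    eval_add_of_lt, ← hs, Function.update_self, Function.update_of_ne, ne_eq]
  refine ⟨by lia, by lia, fun hb => ⟨by lia, fun _ => ⟨?_, ?_, ⟨?_, ?_, ?_⟩, ?_⟩, fun hn => ?_⟩,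
    fun hb => ⟨by lia, by lia, fun hn => ?_, fun hn => ?_⟩⟩
  · simp [h1]
  · simp
  · simp [h2]
  · simp
  · simp
  · refine frame_update (frame_update (frame_update (fun a _ => rfl) ?_) ?_) ?_ <;> simp
  · simp [hn] at hb
  · simp [hn] at hb
  · simp only [verdict, eval_sub, eval_eq]
    by_cases h7 : s.mem 7 = 0 <;> simp [h7, hn]

/-- The difference of a table and the first `i` entries of another one. -/
def residual {F : Type*} [Field F] (f v : ℕ → F) (i : ℕ) : ℕ → F :=
  fun j => f j - if j < i then v j else 0

theorem residual_succ {F : Type*} [Field F] (f v : ℕ → F) (i : ℕ) :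
    residual f v (i + 1) = residual f v i + Pi.single i (-v i) := by
  ext j
  simp only [residual, Pi.add_apply, Pi.single_apply]
  rcases lt_trichotomy j i with h | rfl | h
  · have h1 : j < i + 1 := by lia
    simp [h, h1, h.ne]
  · simp [sub_eq_add_neg]
  · have h1 : ¬ j < i + 1 := by lia
    have h2 : ¬ j < i := by lia
    simp [h1, h2, h.ne']

/-- The memory of the verifier while the prover lists the frequencies. -/
structure RemoteInv (n q d : ℕ) [Fact q.Prime] (z f v : ℕ → ZMod q) (i : ℕ) (s : State) : Prop
    extends ListInv n q v i s where
  mode : s.mem 3 = 1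
  bits : s.mem 4 = d
  secret : ∀ j < d, s.mem (j * 2 + 101) = (z j).val
  acc : s.mem 7 = (mle z d (residual f v i)).val

/-- Each listed frequency is subtracted from the stream's fingerprint, so in the end the accumulator
tests whether the difference of the two tables vanishes at the secret point. -/
theorem reach_remote {n q M d i : ℕ} [Fact q.Prime] {z f v : ℕ → ZMod q} {s : State}
    (hM : 100 ≤ M) (hn : n < q) (hdq : 2 * d + 101 < q ^ 2) (hnd : n ≤ 2 ^ d) (hi : i < n)
    (h : RemoteInv n q d z f v i s) :
    Reach q M verifier.respond (s.input (v i).val 0) (200 + d * 60) fun r =>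
      (i + 1 < n → r.mem 1 = 0 ∧ (r.mem 0 : ZMod q) = 0 ∧ RemoteInv n q d z f v (i + 1) r) ∧
      (i + 1 = n → r.mem 1 ≠ 0 ∧ verdict r =
        if mle z d (residual f v n) = 0 then some (countNonzero v n) else none) := by
  obtain ⟨⟨h2, h8, h9⟩, h3, h4, hz, h7⟩ := h
  refine Reach.mono (T := 5 + ((3 + (4 + ((20 + d * 60) + 10))) + 60)) ?_ (by lia) fun _ => id
  refine Reach.branch (fun hb => ?_) fun hb => ?_
  · simp [Exp.eval, State.input, State.write, h3, eval_eq] at hb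
  refine Reach.seq (P := fun r => r.mem 7 = (mle z d (residual f v (i + 1))).val ∧
    ∀ a, a ∉ [7, 10, 11, 12] → r.mem a = (s.input (v i).val 0).mem a) ?_ ?_
  · refine Reach.branch (fun hb => ?_) fun hb => ?_
    · refine Reach.setReg_seq (by lia) (Reach.seq
        (reach_indicator (z := z) (d := d) (x := i) hM hdq ?_ ?_ ?_) ?_)
      · simp [State.write, State.input, h4]
      · simp [State.write, State.input, Exp.eval, h8]
      · intro j hj
        simp (disch := lia) [State.write, State.input, hz j hj]
      · rintro u ⟨h11, hut, hu⟩
        refine Reach.step ⟨by simp [Exp.eval]; lia, ?_,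
          frame_update (fun a ha => ?_) (by simp [Exp.eval])⟩
        · have e7 : u.mem 7 = (mle z d (residual f v i)).val := by
            rw [hu 7 (by simp)]; simp [State.write, State.input, h7]
          have e0 : u.mem 0 = (v i).val := by
            rw [hu 0 (by simp)]; simp [State.write, State.input]
          simp only [State.write, Exp.eval, Function.update_self, eval_fsub, eval_fmul, e7, e0,
            h11, ZMod.natCast_zmod_val]
          rw [residual_succ, mle_update_add z (hi.trans_le hnd), mul_neg, sub_eq_add_neg]
        · simp only [List.mem_cons, not_or] at ha
          rw [hu a (by simp [ha])]
          simp [State.write, ha]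
    · simp [Exp.eval, State.input, State.write, h3] at hb
  · rintro u ⟨h7', hu⟩
    have hin : ∀ a, 2 ≤ a → (s.input (v i).val 0).mem a = s.mem a := fun a ha => by
      simp (disch := lia) [State.input, State.write]
    have hl : ListInv n q v i u := by
      refine ⟨?_, ?_, ?_⟩
      · rw [hu 2 (by simp), hin 2 (by lia), h2]
      · rw [hu 8 (by simp), hin 8 (by lia), h8]
      · rw [hu 9 (by simp), hin 9 (by lia), h9]
    refine Reach.mono (reach_count hM hn hi hl ?_ ?_) le_rfl fun r hr => ⟨fun hlt => ?_, fun he => ?_⟩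
    · rw [hu 0 (by simp)]; simp [State.input, State.write]
    · rw [hu 1 (by simp)]; simp [State.input, State.write]
    · obtain ⟨hr₁, hr₂, hr₃, hr₄⟩ := hr.1 hlt
      refine ⟨hr₁, by simp [hr₂], hr₃, ?_, ?_, fun j hj => ?_, ?_⟩
      · rw [hr₄ 3 (by simp), hu 3 (by simp), hin 3 (by lia), h3]
      · rw [hr₄ 4 (by simp), hu 4 (by simp), hin 4 (by lia), h4]
      · rw [hr₄ _ (by simp), hu _ (by simp), hin _ (by lia), hz j hj]
      · rw [hr₄ 7 (by simp), h7']
    · refine ⟨(hr.2 he).1, (hr.2 he).2.trans ?_⟩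
      rw [h7', he]
      simp

/-- The memory of the verifier while it goes through its own list of the frequencies. -/
structure LocalInv (n q : ℕ) (v : ℕ → ZMod q) (i : ℕ) (s : State) : Prop
    extends ListInv n q v i s where
  mode : s.mem 3 = 0
  list : ∀ j < n, s.mem (5000 - j) = (v j).val
  acc : s.mem 7 = 0

/-- The word `b` from the prover is overwritten by the stored frequency, so the outcome does not
depend on the conversation. -/
theorem reach_local {n q M i b : ℕ} [Fact q.Prime] {v : ℕ → ZMod q} {s : State}
    (hM : 6000 ≤ M) (hn : n < q) (hq : q < 4096) (hi : i < n) (h : LocalInv n q v i s) :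
    Reach q M verifier.respond (s.input b 0) 200 fun r =>
      (i + 1 < n → r.mem 1 = 0 ∧ (r.mem 0 : ZMod q) = 0 ∧ LocalInv n q v (i + 1) r) ∧
      (i + 1 = n → r.mem 1 ≠ 0 ∧ verdict r = some (countNonzero v n)) := by
  obtain ⟨⟨h2, h8, h9⟩, h3, hl, h7⟩ := h
  have hin : ∀ a, 2 ≤ a → (s.input b 0).mem a = s.mem a := fun a ha => by
    simp (disch := lia) [State.input, State.write]
  refine Reach.mono (T := 5 + ((3 + 10) + 60)) ?_ (by lia) fun _ => id
  refine Reach.branch (fun hb => ?_) fun hb => ?_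
  · simp [Exp.eval, hin, h3, eval_eq] at hb
  refine Reach.seq (P := fun r => r.mem 0 = (v i).val ∧
    ∀ a, a ∉ [0] → r.mem a = (s.input b 0).mem a) ?_ ?_
  · refine Reach.branch (fun hb => ?_) fun hb => ?_
    · simp [Exp.eval, hin, h3] at hb
    · refine Reach.step ⟨by simp [Exp.eval]; lia, ?_, frame_update (fun a _ => rfl)
        (by simp [Exp.eval])⟩
      simp only [State.write, Exp.eval, Function.update_self, eval_sub]
      rw [hin 8 (by lia), h8, hin _ (by lia), hl i hi]
  · rintro u ⟨h0, hu⟩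
    have hu : ∀ a, 2 ≤ a → u.mem a = s.mem a := fun a ha => by
      rw [hu a (by simp; lia), hin a ha]
    have hL : ListInv n q v i u :=
      ⟨(hu 2 (by lia)).trans h2, (hu 8 (by lia)).trans h8, (hu 9 (by lia)).trans h9⟩
    refine Reach.mono (reach_count (by lia) hn hi hL h0 ?_) le_rfl
      fun r hr => ⟨fun hlt => ?_, fun he => ?_⟩
    · have := ‹∀ a, a ∉ [0] → u.mem a = (s.input b 0).mem a› 1 (by simp)
      simpa [State.input, State.write] using this
    · obtain ⟨hr₁, hr₂, hr₃, hr₄⟩ := hr.1 hlt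
      refine ⟨hr₁, by simp [hr₂], hr₃, ?_, fun j hj => ?_, ?_⟩
      · rw [hr₄ 3 (by simp), hu 3 (by lia), h3]
      · rw [hr₄ _ (by simp; lia), hu _ (by lia), hl j hj]
      · rw [hr₄ 7 (by simp), hu 7 (by lia), h7]
    · refine ⟨(hr.2 he).1, (hr.2 he).2.trans ?_⟩
      rw [hu 7 (by lia), h7, if_pos rfl]

/-! ### The layered protocol -/

section Layered

variable {q : ℕ} [Fact q.Prime]

open Classical in
/-- The memory of the verifier after `t` rounds of block `b` of the layered protocol. -/
structure LayeredInv (K d : ℕ) (l : List ℕ) (z f w : ℕ → ZMod q) (m : ℕ → ℕ → ZMod q)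
    (b t : ℕ) (s : State) : Prop where
  mode : s.mem 3 = 2
  bits : s.mem 4 = d
  layer : s.mem 5 = blockLayer K d b
  size : s.mem 6 = 2 ^ d
  acc : s.mem 7 = (mle z d f).val
  round : s.mem 8 = t % 5
  out : b ≠ 0 → s.mem 9 = (2 ^ d * m 0 0).val
  ok : s.mem 13 = if ∀ b' < b, Check d w m b' then 1 else 0
  idx : s.mem 14 = blockIdx d b
  weight : s.mem 15 = (weight d w b).val
  claim : s.mem 16 = (claim d w m b).val
  started : s.mem 19 = if b = 0 then 0 else 1
  buffer : ∀ i < t, s.mem (20 + i) = (m b i).val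
  point : ∀ j < d, s.mem (j * 2 + 100) = (point d w b j).val
  secret : ∀ j < d, s.mem (j * 2 + 101) = (z j).val
  tape : s.tape = l.drop (d + (5 * b + t))

variable {K d M : ℕ} {l : List ℕ} {z f w u : ℕ → ZMod q} {m : ℕ → ℕ → ZMod q} {b t : ℕ} {s : State}

theorem input_mem_of_le {s : State} {x y a : ℕ} (ha : 2 ≤ a) : (s.input x y).mem a = s.mem a := by
  simp (disch := lia) [State.input, State.write]

/-- A coin is drawn in every round, so the tape position is d plus the round number. The coins of
the first four rounds of a block are sent but enter no test. -/
theorem reach_receive (hM : 100 ≤ M) (hq : 4096 ≤ q) (ht : t < 5)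
    (hl : l.drop (d + (5 * b + t)) = (u (d + (5 * b + t))).val :: l.drop (d + (5 * b + t) + 1))
    (h : LayeredInv K d l z f w m b t s) :
    Reach q M receiveCmd (s.input (m b t).val 0) 30 fun r =>
      r.mem 1 = 0 ∧ r.mem 0 = (u (d + (5 * b + t))).val ∧
        LayeredInv K d l z f w m b (t + 1) r := by
  obtain ⟨h3, h4, h5, h6, h7, h8, h9, h13, h14, h15, h16, h19, hB, hP, hZ, hT⟩ := h
  rw [Nat.mod_eq_of_lt ht] at h8
  have hqq : 4096 * q ≤ q ^ 2 := by nlinarith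
  refine Reach.step ?_
  have e0 : (s.input (m b t).val 0).mem 0 = (m b t).val := by simp [State.input, State.write]
  have e1 : (s.input (m b t).val 0).mem 1 = 0 := by simp [State.input, State.write]
  have htape : (s.input (m b t).val 0).tape = s.tape := rfl
  simp (disch := lia) only [receiveCmd, Cmd.wp, Exp.eval, State.write, e0,
    eval_add_of_lt, eval_mod, h8, h3, hT, hl, htape, input_mem_of_le,
    Function.update_self, Function.update_of_ne]
  refine ⟨by lia, by lia, (u (d + (5 * b + t))).val, l.drop (d + (5 * b + t) + 1), rfl,
    by lia, ?_, ?_, ?_⟩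
  · simp (disch := lia) [e1]
  · simp
  · constructor
    case tape => rfl
    case round => simp
    case out =>
      intro hb
      simp (disch := lia) only [Function.update_of_ne, input_mem_of_le, h9 hb]
    case point =>
      intro j hj
      simp (disch := lia) only [Function.update_of_ne, input_mem_of_le, hP j hj]
    case secret =>
      intro j hj
      simp (disch := lia) only [Function.update_of_ne, input_mem_of_le, hZ j hj]
    case buffer =>
      intro i hi
      by_cases hit : i = t
      · subst hit
        simp (disch := lia) only [Function.update_of_ne]
        rw [add_comm, Function.update_self]
      · simp (disch := lia) only [Function.update_of_ne, input_mem_of_le, hB i (by lia)]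
    all_goals
      simp (disch := lia) only [Function.update_of_ne, input_mem_of_le]
      assumption

end Layered

/-! ### The verifier at the end of a block. -/

section Layered

variable {q : ℕ} [Fact q.Prime] {K d M : ℕ} {l : List ℕ} {z f w : ℕ → ZMod q}
  {m : ℕ → ℕ → ZMod q} {b : ℕ} {s : State} {c : ZMod q}

/-- Programs conjoin flags by multiplying bits; the product is never reduced because 1 < `q ^ 2`. -/
theorem eval_mul_ite {A B : Prop} [Decidable A] [Decidable B] :
    Op.eval q .mul (if A then 1 else 0) (if B then 1 else 0) = if A ∧ B then 1 else 0 := by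
  have hq := (Fact.out : q.Prime).two_le
  have : 1 < q ^ 2 := by nlinarith
  by_cases hA : A <;> by_cases hB : B <;> simp [hA, hB, Op.eval, Nat.mod_eq_of_lt this]

theorem forall_lt_succ_iff {p : ℕ → Prop} {n : ℕ} :
    (∀ i < n + 1, p i) ↔ (∀ i < n, p i) ∧ p n := by
  constructor
  · exact fun h => ⟨fun i hi => h i (by lia), h n (by lia)⟩
  · rintro ⟨h, hn⟩ i hi
    rcases Nat.lt_succ_iff_lt_or_eq.mp hi with hi | rfl
    exacts [h i hi, hn]

theorem val_eq_iff {x y : ZMod q} : x.val = y.val ↔ x = y := (ZMod.val_injective q).eq_iff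

open Classical in
-- In the last layer the freshly drawn `c` is discarded and the secret coordinate takes its place as
-- the answer; `hw` records this choice.
theorem reach_sumcheck (hM : 2 * d + 100 ≤ M) (hq : 4096 ≤ q) (hdq : d < q)
    (hi : blockIdx d b ≠ d + 1) (hw : w b = if blockLayer K d b = 0 then z (blockIdx d b - 1) else c)
    (h : LayeredInv K d l z f w m b 5 s) (h1 : s.mem 1 = 0) (h0 : s.mem 0 = c.val) :
    Reach q M sumcheckCmd s 200 fun r =>
      r.mem 1 = 0 ∧ r.mem 0 = (w b).val ∧ LayeredInv K d l z f w m (b + 1) 0 r := by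
  obtain ⟨h3, h4, h5, h6, h7, h8, h9, h13, h14, h15, h16, h19, hB, hP, hZ, hT⟩ := h
  have hqq : 4096 * q ≤ q ^ 2 := by nlinarith
  have hi1 := one_le_blockIdx d b
  have hid := blockIdx_le d b
  have hb0 : b ≠ 0 := by rintro rfl; exact hi rfl
  obtain ⟨j, hj⟩ := Nat.exists_eq_add_of_le' hi1
  have hjd : j < d := by lia
  have hB0 := hB 0 (by lia)
  have hB1 := hB 1 (by lia)
  have hB2 := hB 2 (by lia)
  have hB3 := hB 3 (by lia)
  have hB4 := hB 4 (by lia)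
  have hPj := hP j hjd
  have hZj := hZ j hjd
  rw [hj] at h14
  rw [hj, Nat.add_sub_cancel] at hw
  simp only [Nat.add_zero, Nat.reduceAdd] at hB0 hB1 hB2 hB3 hB4
  -- Block index j + 1 treats coordinate j, hence the offsets 98 and 99 for the point and the secret
  -- stored from 100 and 101 on.
  have a98 : (j + 1) * 2 + 98 = j * 2 + 100 := by lia
  have a99 : (j + 1) * 2 + 99 = j * 2 + 101 := by lia
  refine Reach.mono (T := 40 + ((3 + 30) + 100)) ?_ (by lia) fun _ => id
  refine Reach.setReg_seq (by lia) (Reach.seq (P := fun r => r.mem 0 = (w b).val ∧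
    r.tape = s.tape ∧ (∀ a, a ∉ [0, 13] → r.mem a = s.mem a) ∧
    r.mem 13 = if (∀ b' < b, Check d w m b') ∧ Check d w m b then 1 else 0) ?_ ?_)
  · have hck : Exp.eval q s.mem (.op .mul (.reg 13) (.op .eq (.reg 16) (.op .fadd (.reg 20)
        (.op .fmul (.load (.op .add (.op .mul (.reg 14) (.const 2)) (.const 98)))
        (.op .fadd (.op .fadd (.op .fadd (.reg 21) (.reg 22)) (.reg 23)) (.reg 24)))))) =
        if (∀ b' < b, Check d w m b') ∧ Check d w m b then 1 else 0 := by
      have hmul : Op.eval q .mul (j + 1) 2 = (j + 1) * 2 := eval_mul_of_lt (by lia)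
      simp (disch := lia) only [Exp.eval, h13, h16, hB0, hB1, hB2, hB3, hB4, h14, hmul,
        eval_add_of_lt, a98, hPj, eval_fadd, eval_fmul, ZMod.natCast_zmod_val, eval_eq]
      rw [eval_mul_ite]
      simp only [val_eq_iff]
      congr 1
      rw [Check, if_neg hi, hj, Nat.add_sub_cancel]
    refine Reach.branch (fun hb => Reach.step ?_) fun hb => Reach.step ?_
    · have : blockLayer K d b ≠ 0 := by
        rw [← h5]; simpa [Exp.eval, State.write] using hb
      rw [if_neg this] at hw
      refine ⟨by simp [State.write, h0, hw], rfl,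
        frame_update (fun a _ => rfl) (by simp), ?_⟩
      simp only [State.write, Function.update_self, hck]
    · have : blockLayer K d b = 0 := by
        rw [← h5]; simpa [Exp.eval, State.write] using hb
      rw [if_pos this] at hw
      refine ⟨by simp [Exp.eval]; lia, ?_, rfl,
        frame_update (frame_update (fun a _ => rfl) (by simp)) (by simp [Exp.eval]), ?_⟩
      · simp (disch := lia) only [Exp.eval, State.write, Function.update_self,
          Function.update_of_ne, h14, eval_mul_of_lt, eval_add_of_lt, a99, hZj, hw]
      · simp (disch := lia) only [Exp.eval, State.write, Function.update_self,
          Function.update_of_ne]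
        exact hck
  · rintro r ⟨r0, rT, hr, r13⟩
    have r14 : r.mem 14 = j + 1 := by rw [hr 14 (by simp), h14]
    have r20 : r.mem 20 = (m b 0).val := by rw [hr 20 (by simp), hB0]
    have r21 : r.mem 21 = (m b 1).val := by rw [hr 21 (by simp), hB1]
    have r22 : r.mem 22 = (m b 2).val := by rw [hr 22 (by simp), hB2]
    have r23 : r.mem 23 = (m b 3).val := by rw [hr 23 (by simp), hB3]
    have r24 : r.mem 24 = (m b 4).val := by rw [hr 24 (by simp), hB4]
    refine Reach.step ?_
    simp (disch := lia) only [Cmd.wp, State.write, Exp.eval, r14, r0, r20, r21, r22, r23, r24,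
      eval_mul_of_lt, eval_add_of_lt, a98, Function.update_self,
      Function.update_of_ne, eval_fadd, eval_fmul, ZMod.natCast_zmod_val]
    refine ⟨by lia, by lia, by lia, ?_, ?_, ?_⟩
    · rw [hr 1 (by simp), h1]
    · trivial
    · have hin : ∀ a, a ∉ [0, 13, 14, 16] → a ≠ j * 2 + 100 → ∀ v₁ v₂ v₃ : ℕ,
          Function.update (Function.update (Function.update r.mem (j * 2 + 100) v₁) 16 v₂) 14 v₃ a =
            s.mem a := by
        intro a ha hne v₁ v₂ v₃
        simp only [List.mem_cons, List.not_mem_nil, or_false, not_or] at ha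
        rw [Function.update_of_ne (by lia), Function.update_of_ne (by lia),
          Function.update_of_ne hne, hr a (by simp; lia)]
      constructor <;> try dsimp only
      case mode => rw [hin 3 (by simp) (by lia), h3]
      case bits => rw [hin 4 (by simp) (by lia), h4]
      case layer => rw [hin 5 (by simp) (by lia), h5, blockLayer, if_neg hi]
      case size => rw [hin 6 (by simp) (by lia), h6]
      case acc => rw [hin 7 (by simp) (by lia), h7]
      case round => rw [hin 8 (by simp) (by lia), h8]
      case out => intro _; rw [hin 9 (by simp) (by lia), h9 hb0]
      case ok =>
        simp (disch := lia) only [Function.update_of_ne]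
        rw [r13]
        simp only [forall_lt_succ_iff]
      case idx => rw [Function.update_self, blockIdx, if_neg hi, hj]
      case weight => rw [hin 15 (by simp) (by lia), h15, weight, if_neg hi]
      case claim =>
        simp (disch := lia) only [Function.update_of_ne, Function.update_self]
        rw [claim, nextClaim, if_neg hi, horner]
      case started => rw [hin 19 (by simp) (by lia), h19, if_neg hb0, if_neg (by lia)]
      case buffer => intro i hi; lia
      case point =>
        intro i hid
        rw [point, if_neg hi, hj, Nat.add_sub_cancel]
        by_cases hij : i = j
        · subst hij
          simp (disch := lia) only [Function.update_of_ne, Function.update_self]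
        · rw [Function.update_of_ne hij, hin _ (by simp) (by lia), hP i hid]
      case secret => intro i hid; rw [hin _ (by simp) (by lia), hZ i hid]
      case tape => rw [rT, hT]; rfl

/-- The claims at the end of all layers, and the test of the last of them. -/
def accepts (K d : ℕ) (f z w : ℕ → ZMod q) (m : ℕ → ℕ → ZMod q) : Prop :=
  (∀ b ≤ K * (d + 1), Check d w m b) ∧ m (K * (d + 1)) 0 = 1 ∧ m (K * (d + 1)) 1 = mle z d f

open Classical in
theorem eval_claims (hq : 4096 ≤ q) (hi : blockIdx d b = d + 1) (hb : b ≠ 0)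
    (h : LayeredInv K d l z f w m b 5 s) :
    Exp.eval q s.mem (.op .mul (.reg 13) (.op .eq (.reg 16)
      (.op .fadd (.op .fmul (.op .fmul (.reg 21) (.reg 20)) (.op .fmul (.reg 21) (.reg 20)))
        (.op .fmul (.reg 15) (.reg 21))))) =
      if (∀ b' < b, Check d w m b') ∧ Check d w m b then 1 else 0 := by
  have h20 : s.mem 20 = (m b 0).val := h.buffer 0 (by lia)
  have h21 : s.mem 21 = (m b 1).val := h.buffer 1 (by lia)
  simp only [Exp.eval, h.ok, h.claim, h.weight, h20, h21, eval_fadd, eval_fmul,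
    ZMod.natCast_zmod_val, eval_eq]
  rw [eval_mul_ite]
  simp only [val_eq_iff]
  congr 1
  rw [Check, if_pos hi, pow_two]
  simp [hb]

open Classical in
/-- The first part of the processing of claims. -/
theorem reach_claims_check (hM : 100 ≤ M) (hq : 4096 ≤ q) (hi : blockIdx d b = d + 1)
    (h : LayeredInv K d l z f w m b 5 s) :
    Reach q M (.ite (.reg 19)
      (.setReg 13 (.op .mul (.reg 13) (.op .eq (.reg 16)
        (.op .fadd (.op .fmul (.op .fmul (.reg 21) (.reg 20)) (.op .fmul (.reg 21) (.reg 20)))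
          (.op .fmul (.reg 15) (.reg 21))))))
      (.setReg 9 (.op .fmul (.reg 6) (.reg 20)) ;; .setReg 19 (.const 1))) s 60 fun r =>
      r.tape = s.tape ∧ (∀ a, a ∉ [9, 13, 19] → r.mem a = s.mem a) ∧ r.mem 19 = 1 ∧
      r.mem 9 = (2 ^ d * m 0 0).val ∧
      r.mem 13 = if ∀ b' < b + 1, Check d w m b' then 1 else 0 := by
  refine Reach.mono (T := 3 + 40) ?_ (by lia) fun _ => id
  simp only [forall_lt_succ_iff]
  refine Reach.branch (fun hb => Reach.step ?_) fun hb => Reach.step ?_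
  · have hb0 : b ≠ 0 := by
      rintro rfl
      simp [Exp.eval, h.started] at hb
    refine ⟨by simp [Exp.eval]; lia, rfl, frame_update (fun a _ => rfl) (by simp [Exp.eval]), ?_⟩
    have h19 := h.started
    rw [if_neg hb0] at h19
    have h9 := h.out hb0
    have := eval_claims hq hi hb0 h
    simp only [State.write]
    rw [this]
    simp [Exp.eval, h19, h9]
  · have hb0 : b = 0 := by
      by_contra hne
      simp [Exp.eval, h.started, hne] at hb
    subst hb0
    have h20 : s.mem 20 = (m 0 0).val := h.buffer 0 (by lia)
    refine ⟨by simp [Exp.eval]; lia, by simp [Exp.eval]; lia, rfl,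
      frame_update (frame_update (fun a _ => rfl) (by simp [Exp.eval])) (by simp [Exp.eval]), ?_⟩
    have h13 := h.ok
    simp only [not_lt_zero, false_imp_iff, implies_true, if_true] at h13
    have hck : Check d w m 0 := by rw [Check, if_pos hi]; exact Or.inl rfl
    simp [Exp.eval, State.write, h13, h.size, h20, eval_fmul, hck]

theorem reach_claims (hM : 100 ≤ M) (hq : 4096 ≤ q)
    (hi : blockIdx d b = d + 1) (hl : blockLayer K d b ≠ 0) (hw : w b = c)
    (h : LayeredInv K d l z f w m b 5 s) (h1 : s.mem 1 = 0) (h0 : s.mem 0 = c.val) :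
    Reach q M claimsCmd s 200 fun r =>
      r.mem 1 = 0 ∧ r.mem 0 = (w b).val ∧ LayeredInv K d l z f w m (b + 1) 0 r := by
  refine Reach.mono (T := 60 + (3 + 40)) ?_ (by lia) fun _ => id
  refine Reach.seq (reach_claims_check hM hq hi h) ?_
  rintro r ⟨rT, hr, r19, r9, r13⟩
  obtain ⟨h3, h4, h5, h6, h7, h8, h9, h13, h14, h15, h16, h19, hB, hP, hZ, hT⟩ := h
  have r20 : r.mem 20 = (m b 0).val := by rw [hr 20 (by simp)]; exact hB 0 (by lia)
  have r21 : r.mem 21 = (m b 1).val := by rw [hr 21 (by simp)]; exact hB 1 (by lia)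
  have r5 : r.mem 5 = blockLayer K d b := by rw [hr 5 (by simp), h5]
  have r0 : r.mem 0 = (w b).val := by rw [hr 0 (by simp), h0, hw]
  refine Reach.branch (fun hb => Reach.step ?_) fun hb => ?_
  · simp (disch := lia) only [Cmd.wp, State.write, Exp.eval, r5, r0, r20, r21,
      Function.update_of_ne, eval_fadd, eval_fmul, eval_sub,
      ZMod.natCast_zmod_val]
    refine ⟨by lia, by lia, by lia, by lia, ?_, trivial, ?_⟩
    · rw [hr 1 (by simp), h1]
    · have hin : ∀ a, a ∉ [5, 9, 13, 14, 15, 16, 19] → ∀ v₁ v₂ v₃ v₄ : ℕ,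
          Function.update (Function.update (Function.update (Function.update r.mem 15 v₁) 16 v₂)
            14 v₃) 5 v₄ a = s.mem a := by
        intro a ha v₁ v₂ v₃ v₄
        simp only [List.mem_cons, List.not_mem_nil, or_false, not_or] at ha
        rw [Function.update_of_ne (by lia), Function.update_of_ne (by lia),
          Function.update_of_ne (by lia), Function.update_of_ne (by lia), hr a (by simp; lia)]
      constructor <;> try dsimp only
      case mode => rw [hin 3 (by simp), h3]
      case bits => rw [hin 4 (by simp), h4]
      case layer => rw [Function.update_self, blockLayer, if_pos hi]
      case size => rw [hin 6 (by simp), h6]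
      case acc => rw [hin 7 (by simp), h7]
      case round => rw [hin 8 (by simp), h8]
      case out => intro _; simp (disch := lia) only [Function.update_of_ne, r9]
      case ok => simp (disch := lia) only [Function.update_of_ne, r13]
      case idx =>
        simp (disch := lia) only [Function.update_of_ne, Function.update_self]
        rw [blockIdx, if_pos hi]
      case weight =>
        simp (disch := lia) only [Function.update_of_ne, Function.update_self]
        rw [weight, if_pos hi]
      case claim =>
        simp (disch := lia) only [Function.update_of_ne, Function.update_self]
        rw [claim, nextClaim, if_pos hi]
      case started =>
        simp (disch := lia) only [Function.update_of_ne]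
        rw [r19, if_neg (by lia)]
      case buffer => intro i hi; lia
      case point =>
        intro i hid
        rw [point, if_pos hi, hin _ (by simp), hP i hid]
      case secret => intro i hid; rw [hin _ (by simp), hZ i hid]
      case tape => rw [rT, hT]; rfl
  · exfalso
    simp only [Exp.eval, r5] at hb
    exact hl hb

open Classical in
-- Among the blocks of claims only the last has layer counter 0, which selects the halting branch.
-- The two claims are compared with values known to the verifier: the constant 1 and the sketch of
-- the stream.
theorem reach_last (hM : 100 ≤ M) (hq : 4096 ≤ q)
    (h : LayeredInv K d l z f w m (K * (d + 1)) 5 s) :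
    Reach q M claimsCmd s 200 fun r => r.mem 1 ≠ 0 ∧
      verdict r = if accepts K d f z w m then some (2 ^ d * m 0 0 : ZMod q).val else none := by
  have : Fact (1 < q) := ⟨(Fact.out : q.Prime).one_lt⟩
  refine Reach.mono (T := 60 + (3 + 40)) ?_ (by lia) fun _ => id
  refine Reach.seq (reach_claims_check hM hq (blockIdx_last K d) h) ?_
  rintro r ⟨rT, hr, r19, r9, r13⟩
  obtain ⟨h3, h4, h5, h6, h7, h8, h9, h13, h14, h15, h16, h19, hB, hP, hZ, hT⟩ := h
  have r20 : r.mem 20 = (m (K * (d + 1)) 0).val := by rw [hr 20 (by simp)]; exact hB 0 (by lia)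
  have r21 : r.mem 21 = (m (K * (d + 1)) 1).val := by rw [hr 21 (by simp)]; exact hB 1 (by lia)
  have r5 : r.mem 5 = 0 := by rw [hr 5 (by simp), h5, blockLayer_last]
  have r7 : r.mem 7 = (mle z d f).val := by rw [hr 7 (by simp), h7]
  have hone : ∀ x : ZMod q, x.val = 1 ↔ x = 1 := fun x => by
    rw [← ZMod.val_one q, val_eq_iff]
  refine Reach.branch (fun hb => ?_) fun hb => Reach.step ?_
  · simp [Exp.eval, r5] at hb
  · simp (disch := lia) only [Cmd.wp, State.write, Exp.eval, r13, r20, r21, r7, r9,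
      Function.update_of_ne, eval_eq, eval_mul_ite, eval_sub, val_eq_iff, hone, verdict]
    refine ⟨by lia, by lia, ?_, ?_⟩
    · simp (disch := lia) only [Function.update_of_ne, Function.update_self]
      split_ifs <;> simp
    · simp (disch := lia) only [Function.update_of_ne, Function.update_self, Nat.lt_succ_iff]
      unfold accepts
      split_ifs <;> simp_all

/-- A round of the layered protocol. -/
theorem reach_round {R : ℕ → ZMod q} {T : ℕ} {μ : ℕ → ZMod q} (hM : 2 * d + 100 ≤ M)
    (hq : 4096 ≤ q) (hdq : d < q)
    (hT : T < 5 * (K * (d + 1) + 1))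
    (hl : ∀ i < d + 5 * (K * (d + 1) + 1), l.drop i = (R i).val :: l.drop (i + 1))
    (hw : ∀ b < K * (d + 1), w b = if blockLayer K d b = 0 ∧ blockIdx d b ≠ d + 1 then
      z (blockIdx d b - 1) else R (d + (5 * b + 4)))
    (hm : ∀ b t, m b t = μ (5 * b + t))
    (h : LayeredInv K d l z f w m (T / 5) (T % 5) s) :
    Reach q M verifier.respond (s.input (μ T).val 0) 300 fun r =>
      (T + 1 < 5 * (K * (d + 1) + 1) → r.mem 1 = 0 ∧
        (r.mem 0 : ZMod q) = (if T % 5 = 4 then w (T / 5) else R (d + T)) ∧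
        LayeredInv K d l z f w m ((T + 1) / 5) ((T + 1) % 5) r) ∧
      (T + 1 = 5 * (K * (d + 1) + 1) → r.mem 1 ≠ 0 ∧ verdict r = open Classical in
        if accepts K d f z w m then some (2 ^ d * m 0 0 : ZMod q).val else none) := by
  have hmod : T % 5 < 5 := Nat.mod_lt _ (by lia)
  have hdiv : 5 * (T / 5) + T % 5 = T := Nat.div_add_mod T 5
  have h3 := h.mode
  have hrec := reach_receive (M := M) (u := R) (by lia) hq hmod (by
    rw [hdiv]; exact hl _ (by lia)) h
  rw [hm, hdiv] at hrec
  refine Reach.mono (T := 5 + (30 + (3 + (6 + 200)))) ?_ (by lia) fun _ => id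
  refine Reach.branch (fun _ => ?_) fun hb => ?_
  · refine Reach.seq hrec fun r ⟨r1, r0, hr⟩ => ?_
    have r8 := hr.round
    refine Reach.branch (fun hb => ⟨1, r, .skip r, by lia, ?_, ?_⟩) fun hb => ?_
    · intro _
      have hlt : T % 5 + 1 < 5 := by
        simp only [Exp.eval, r8] at hb
        lia
      refine ⟨r1, ?_, ?_⟩
      · rw [if_neg (by lia), r0, ZMod.natCast_zmod_val]
      · rwa [show (T + 1) / 5 = T / 5 by lia, show (T + 1) % 5 = T % 5 + 1 by lia]
    · intro he
      simp only [Exp.eval, r8] at hb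
      lia
    · simp only [Exp.eval, r8] at hb
      have h4 : T % 5 = 4 := by lia
      rw [h4] at hr
      -- The buffer is complete only in the fifth round of a block, so all tests and state changes
      -- happen here.
      obtain ⟨b, rfl⟩ : ∃ b, T = 5 * b + 4 := ⟨T / 5, by lia⟩
      rw [show (5 * b + 4) / 5 = b by lia] at hr ⊢
      have e1 : (5 * b + 4 + 1) / 5 = b + 1 := by lia
      have e2 : (5 * b + 4 + 1) % 5 = 0 := by lia
      rw [if_pos h4, e1, e2]
      have hid := blockIdx_le d b
      have hlt : Exp.eval q r.mem (.op .lt (.reg 4) (.reg 14)) =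
          if d < blockIdx d b then 1 else 0 := by
        simp only [Exp.eval, hr.bits, hr.idx, eval_lt]
      refine Reach.branch (fun hb => ?_) fun hb => ?_
      · have hi : blockIdx d b = d + 1 := by
          rw [hlt] at hb
          by_contra hne
          rw [if_neg (by lia)] at hb
          exact hb rfl
        rcases Nat.lt_or_ge b (K * (d + 1)) with hbK | hbK
        · refine Reach.mono (reach_claims (c := w b) (by lia) hq hi (blockLayer_pos hbK hi).ne' rfl
            hr r1 ?_) le_rfl fun u hu => ⟨fun _ => ⟨hu.1, ?_, hu.2.2⟩, fun he => by lia⟩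
          · rw [r0, hw b hbK, if_neg (by simp [hi])]
          · rw [hu.2.1, ZMod.natCast_zmod_val]
        · obtain rfl : b = K * (d + 1) := by lia
          exact Reach.mono (reach_last (by lia) hq hr) le_rfl
            fun u hu => ⟨fun hlt => by lia, fun _ => hu⟩
      · have hi : blockIdx d b ≠ d + 1 := by
          rw [hlt] at hb
          intro he
          rw [if_pos (by lia)] at hb
          simp at hb
        have hbK : b < K * (d + 1) := by
          by_contra hcon
          obtain rfl : b = K * (d + 1) := by lia
          exact hi (blockIdx_last K d)
        refine Reach.mono (reach_sumcheck hM hq hdq hi ?_ hr r1 r0) le_rfl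
          fun u hu => ⟨fun _ => ⟨hu.1, ?_, hu.2.2⟩, fun he => by lia⟩
        · rw [hw b hbK]
          simp [hi]
        · rw [hu.2.1, ZMod.natCast_zmod_val]
  · simp [Exp.eval, input_mem_of_le, h3, eval_eq] at hb

end Layered

/-! ### The verifier from initialization to the end of the stream. -/

section Observes

variable {q : ℕ} [Fact q.Prime]

/-- The random elements of the verifier, as a function on the natural numbers. -/
def extend {L : ℕ} (R : Fin L → ZMod q) (i : ℕ) : ZMod q := if h : i < L then R ⟨i, h⟩ else 0

theorem drop_coins {L : ℕ} (R : Fin L → ZMod q) {i : ℕ} (hi : i < L) :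
    (coins R).drop i = (extend R i).val :: (coins R).drop (i + 1) := by
  rw [List.drop_eq_getElem_cons (by simpa [coins] using hi)]
  simp [coins, extend, hi]

/-- The memory of the verifier after the stream, if the field is large. -/
structure ReadyInv (n q k : ℕ) [Fact q.Prime] (l : List ℕ) (z f : ℕ → ZMod q) (s : State) :
    Prop where
  items : s.mem 2 = n
  mode : s.mem 3 = if k < n then 2 else 1
  bits : s.mem 4 = Nat.clog 2 n
  layers : k < n → s.mem 5 = k - 1
  size : s.mem 6 = 2 ^ Nat.clog 2 n
  acc : s.mem 7 = (mle z (Nat.clog 2 n) f).val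
  ok : s.mem 13 = 1
  idx : k < n → s.mem 14 = Nat.clog 2 n + 1
  rest : ∀ a ∈ [8, 9, 15, 16, 19], s.mem a = 0
  point : ∀ j < Nat.clog 2 n, s.mem (j * 2 + 100) = (1 / 2 : ZMod q).val
  secret : ∀ j < Nat.clog 2 n, s.mem (j * 2 + 101) = (z j).val
  tape : s.tape = l.drop (Nat.clog 2 n)

theorem clog_le_self (n : ℕ) : Nat.clog 2 n ≤ n := Nat.clog_le_of_le_pow Nat.lt_two_pow_self.le

theorem two_mul_clog_lt {n q : ℕ} (hn : n < q) (hq : 4096 ≤ q) :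
    2 * Nat.clog 2 n + 101 < q ^ 2 := by
  have := clog_le_self n
  nlinarith

theorem observes_large {n m k M : ℕ} {x : DataStream n} {l : List ℕ} {z : ℕ → ZMod q}
    (hx : x.length = m) (hn : n < q) (hn2 : 2 ≤ n) (hq : 4096 ≤ q) (hk : q = 2 ^ k - 1)
    (hM : 2 * Nat.clog 2 n + 200 ≤ M)
    (hl : ∀ i < Nat.clog 2 n, l.drop i = (z i).val :: l.drop (i + 1)) :
    ∃ t s, verifier.Observes q M l x t s ∧
      t ≤ 100 + Nat.clog 2 n * 200 + n * 100 + m * (50 + Nat.clog 2 n * 60) ∧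
      ReadyInv n q k l z (table q x) s := by
  set d := Nat.clog 2 n with hd
  have hdq := two_mul_clog_lt hn hq
  have hdn := clog_le_self n
  have hqq : 4096 * q ≤ q ^ 2 := by nlinarith
  have hodd : q % 2 = 1 := by
    rcases (Fact.out : q.Prime).eq_two_or_odd with h | h <;> lia
  -- The first d coins become the secret point. It is interleaved with the current point, which
  -- starts at 1/2 in every coordinate.
  let J : ℕ → State → Prop := fun j s => s.tape = l.drop j ∧ ∀ i < j,
    s.mem (i * 2 + 100) = (1 / 2 : ZMod q).val ∧ s.mem (i * 2 + 101) = (z i).val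
  have hJ : ∀ j s s', (∀ a, 100 ≤ a → s'.mem a = s.mem a) → s'.tape = s.tape → J j s → J j s' := by
    rintro j s s' hs ht ⟨h₁, h₂⟩
    refine ⟨ht.trans h₁, fun i hi => ?_⟩
    rw [hs _ (by lia), hs _ (by lia)]
    exact h₂ i hi
  have hc : ∀ j < d, ∀ s, s.mem 4 = j → s.mem 17 = (q + 1) / 2 → J j s →
      Reach q M (.rand (.op .add (.op .mul (.reg 4) (.const 2)) (.const 101)) ;;
        .set (.op .add (.op .mul (.reg 4) (.const 2)) (.const 100)) (.reg 17)) s 20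
        fun r => J (j + 1) r ∧ ∀ a < 100, r.mem a = s.mem a := by
    rintro j hj s h4 h17 ⟨h₁, h₂⟩
    refine Reach.step ?_
    simp (disch := lia) only [Cmd.wp, Exp.eval, State.write, h4, h₁, hl j hj, h17,
      eval_mul_of_lt, eval_add_of_lt, Function.update_of_ne]
    refine ⟨by lia, (z j).val, l.drop (j + 1), rfl, by lia, ⟨rfl, fun i hi => ?_⟩, fun a ha => ?_⟩
    · by_cases hij : i = j
      · subst hij
        simp (disch := lia) only [Function.update_self, Function.update_of_ne, half_val hodd,
          and_self]
      · simp (disch := lia) only [Function.update_of_ne]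
        exact h₂ i (by lia)
    · simp (disch := lia) only [Function.update_of_ne]
  obtain ⟨t, s, h₁, h₂, hI, hJ⟩ := reach_init (M := M) (T := 20) (k := k) (l := l)
    (c := .rand (.op .add (.op .mul (.reg 4) (.const 2)) (.const 101)) ;;
    .set (.op .add (.op .mul (.reg 4) (.const 2)) (.const 100)) (.reg 17)) J hn hn2 hq hk
    (by lia) hJ hc ⟨rfl, fun i hi => by lia⟩
  obtain ⟨t', r, h₁', h₂', h7, hT, hr⟩ := pass_large (M := M) (d := d) (z := z) (s := s) hx
    (by lia) hdq (Nat.le_pow_clog (by lia) n) (by rw [hI.mode]; split_ifs <;> lia) hI.bits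
    (hI.rest 7 (by lia) (by simp)) (fun j hj => (hJ.2 j hj).2)
  refine ⟨t + t', r, ⟨s, t, t', h₁, h₁', rfl⟩, by rw [← hd] at h₂; lia, ?_⟩
  constructor
  case acc => exact h7
  case layers => intro h; rw [hr 5 (by simp), hI.layers h]
  case idx => intro h; rw [hr 14 (by simp), hI.idx h]
  case rest =>
    intro a ha
    simp only [List.mem_cons, List.not_mem_nil, or_false] at ha
    rcases ha with rfl | rfl | rfl | rfl | rfl <;>
      rw [hr _ (by simp), hI.rest _ (by lia) (by simp)]
  case point => intro j hj; rw [hr _ (by simp), (hJ.2 j hj).1]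
  case secret => intro j hj; rw [hr _ (by simp), (hJ.2 j hj).2]
  case tape => rw [hT, hJ.1]
  case mode => rw [hr 3 (by simp), hI.mode]
  case items => rw [hr 2 (by simp), hI.items]
  case bits => rw [hr 4 (by simp), hI.bits]
  case size => rw [hr 6 (by simp), hI.size]
  case ok => rw [hr 13 (by simp), hI.ok]

theorem ReadyInv.remote {n k : ℕ} {l : List ℕ} {z f v : ℕ → ZMod q} {s : State} (hk : ¬ k < n)
    (h : ReadyInv n q k l z f s) : RemoteInv n q (Nat.clog 2 n) z f v 0 s where
  items := h.items
  idx := h.rest 8 (by simp)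
  count := (h.rest 9 (by simp)).trans (by simp [countNonzero])
  mode := by rw [h.mode, if_neg hk]
  bits := h.bits
  secret := h.secret
  acc := by
    rw [h.acc]
    congr 2
    ext j
    simp [residual]

theorem ReadyInv.layered {n k : ℕ} {l : List ℕ} {z f w : ℕ → ZMod q} {m : ℕ → ℕ → ZMod q}
    {s : State} (hk : k < n) (h : ReadyInv n q k l z f s) :
    LayeredInv (k - 1) (Nat.clog 2 n) l z f w m 0 0 s where
  mode := by rw [h.mode, if_pos hk]
  bits := h.bits
  layer := h.layers hk
  size := h.size
  acc := h.acc
  round := h.rest 8 (by simp)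
  out := fun h0 => (h0 rfl).elim
  ok := by simp [h.ok]
  idx := h.idx hk
  weight := (h.rest 15 (by simp)).trans (by simp [weight])
  claim := (h.rest 16 (by simp)).trans (by simp [claim])
  started := by simp [h.rest 19 (by simp)]
  buffer := fun i hi => by lia
  point := h.point
  secret := h.secret
  tape := by simp [h.tape]

theorem observes_small {n m M : ℕ} {x : DataStream n} {l : List ℕ} (hx : x.length = m)
    (hn : n < q) (hq : q < 4096) (hM : 6000 ≤ M) :
    ∃ t s, verifier.Observes q M l x t s ∧ t ≤ 100 + m * 50 ∧
      LocalInv n q (table q x) 0 s := by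
  obtain ⟨t, s, h₁, h₂, h2, hT, hs⟩ := reach_init_small (n := n) (M := M) (l := l)
    (c := .rand (.op .add (.op .mul (.reg 4) (.const 2)) (.const 101)) ;;
    .set (.op .add (.op .mul (.reg 4) (.const 2)) (.const 100)) (.reg 17)) hq (by lia)
  obtain ⟨t', r, h₁', h₂', -, h2', hl, hr⟩ := pass_small (q := q) (M := M) (n := n) (s := s) hx hM
    (by lia) hs
  exact ⟨t + t', r, ⟨s, t, t', h₁, h₁', rfl⟩, by lia,
    ⟨⟨h2'.trans h2, hr 8 (by lia) (by lia), (hr 9 (by lia) (by lia)).trans (by simp [countNonzero])⟩,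
      hr 3 (by lia) (by lia), hl, hr 7 (by lia) (by lia)⟩⟩

end Observes

/-! ## The program of the prover -/

/-- The address of entry `x` of the table with the base address `c`. -/
abbrev Exp.cell (c : ℕ) (x : Exp) : Exp := .op .add (.op .mul x (.const 8)) (.const c)

/-- Entry `x` of the table with the base address `c`. -/
abbrev Exp.get (c : ℕ) (x : Exp) : Exp := .load (.cell c x)

/-- Filling of the first entries of the table `c`, as many as cell `12` says. The expression `e`
finds the index in cell `11`. -/
def fillCmd (c : ℕ) (e : Exp) : Cmd :=
  .setReg 11 (.const 0) ;;
  .while (.op .lt (.reg 11) (.reg 12))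
    (.set (.cell c (.reg 11)) e ;; .setReg 11 (.op .add (.reg 11) (.const 1)))

/-- The even entry of a pair in the table `c`. -/
def evenExp (c : ℕ) : Exp := .get c (.op .mul (.const 2) (.reg 11))

/-- The odd entry of a pair in the table `c`. -/
def oddExp (c : ℕ) : Exp := .get c (.op .add (.op .mul (.const 2) (.reg 11)) (.const 1))

/-- Folding of the table `c` with the field element in cell `16`. -/
def foldCmd (c : ℕ) : Cmd :=
  fillCmd c (.op .fadd (evenExp c) (.op .fmul (.reg 16) (.op .fsub (oddExp c) (evenExp c))))

/-- Folding of the tables of the input and of the layer, whose size is in cell `9`. -/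
def foldPairCmd : Cmd :=
  .setReg 9 (.op .div (.reg 9) (.const 2)) ;; .setReg 12 (.reg 9) ;; foldCmd 101 ;; foldCmd 102

/-- The tables of the input and of the layer at the beginning of a layer. -/
def loadCmd : Cmd :=
  .setReg 9 (.reg 6) ;; .setReg 12 (.reg 6) ;; fillCmd 101 (.get 100 (.reg 11)) ;;
  fillCmd 102 (.get 105 (.op .add (.op .mul (.reg 5) (.reg 6)) (.reg 11)))

/-- The product of the input and the preceding layer, in the computation of all layers. -/
def productExp : Exp :=
  .op .fmul (.get 100 (.op .mod (.reg 11) (.reg 6))) (.get 105 (.op .sub (.reg 11) (.reg 6)))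

/-- The computation of all layers. -/
def layersCmd : Cmd :=
  .setReg 12 (.op .mul (.op .add (.reg 5) (.const 1)) (.reg 6)) ;;
  fillCmd 105 (.op .fadd (.op .lt (.reg 11) (.reg 6))
    (.op .fmul (.op .eq (.op .lt (.reg 11) (.reg 6)) (.const 0)) (.op .fmul productExp productExp)))

/-- The preparation of the first block. -/
def startCmd : Cmd :=
  layersCmd ;; loadCmd ;; .setReg 16 (.reg 17) ;;
  .while (.op .lt (.const 1) (.reg 9)) foldPairCmd

/-- The preparation of the next block. -/
def advanceCmd : Cmd :=
  .ite (.op .lt (.reg 4) (.reg 14))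
    (.setReg 10 (.reg 0) ;; .setReg 5 (.op .sub (.reg 5) (.const 1)) ;; .setReg 14 (.const 1) ;;
      loadCmd)
    (.setReg 16 (.reg 0) ;; .set (.cell 96 (.reg 14)) (.reg 0) ;;
      .setReg 14 (.op .add (.reg 14) (.const 1)) ;; foldPairCmd)

/-- The middle coefficient of the product of two linear polynomials. -/
def middleExp : Exp :=
  .op .fadd (.op .fmul (evenExp 101) (.op .fsub (oddExp 102) (evenExp 102)))
    (.op .fmul (.op .fsub (oddExp 101) (evenExp 101)) (evenExp 102))

/-- The lowest coefficient of the product of two linear polynomials. -/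
def lowExp : Exp := .op .fmul (evenExp 101) (evenExp 102)

/-- The highest coefficient of the product of two linear polynomials. -/
def highExp : Exp :=
  .op .fmul (.op .fsub (oddExp 101) (evenExp 101)) (.op .fsub (oddExp 102) (evenExp 102))

/-- An entry of the table of the coefficients of degree `t`. -/
def coefExp : ℕ → Exp
  | 0 => .op .fadd (.op .fmul lowExp lowExp) (.op .fmul (.reg 10) (evenExp 101))
  | 1 => .op .fadd (.op .fadd (.op .fmul lowExp middleExp) (.op .fmul lowExp middleExp))
      (.op .fmul (.reg 10) (.op .fsub (oddExp 101) (evenExp 101)))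
  | 2 => .op .fadd (.op .fmul middleExp middleExp)
      (.op .fadd (.op .fmul lowExp highExp) (.op .fmul lowExp highExp))
  | 3 => .op .fadd (.op .fmul middleExp highExp) (.op .fmul middleExp highExp)
  | _ => .op .fmul highExp highExp

/-- The table of the coefficients of the degree in cell `8`. -/
def coefCmd : Cmd :=
  .ite (.reg 8) (.ite (.op .eq (.reg 8) (.const 1)) (fillCmd 103 (coefExp 1))
    (.ite (.op .eq (.reg 8) (.const 2)) (fillCmd 103 (coefExp 2))
      (.ite (.op .eq (.reg 8) (.const 3)) (fillCmd 103 (coefExp 3)) (fillCmd 103 (coefExp 4)))))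
    (fillCmd 103 (coefExp 0))

/-- The evaluation of the table of coefficients at the remaining coordinates of the point. -/
def evalCmd : Cmd :=
  .setReg 13 (.reg 14) ;;
  .while (.op .lt (.const 1) (.reg 12))
    (.setReg 12 (.op .div (.reg 12) (.const 2)) ;; .setReg 16 (.get 104 (.reg 13)) ;; foldCmd 103 ;;
      .setReg 13 (.op .add (.reg 13) (.const 1))) ;;
  .setReg 0 (.get 103 (.const 0))

/-- The computation of a message. -/
def messageCmd : Cmd :=
  .ite (.op .lt (.reg 4) (.reg 14))
    (.ite (.reg 8) (.setReg 0 (.get 101 (.const 0))) (.setReg 0 (.get 102 (.const 0))))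
    (.setReg 12 (.op .div (.reg 9) (.const 2)) ;; coefCmd ;; evalCmd)

/-- A round of the layered protocol. -/
def answerCmd : Cmd :=
  .ite (.reg 8) .skip (.ite (.reg 15) advanceCmd (.setReg 15 (.const 1) ;; startCmd)) ;;
  messageCmd ;; .setReg 8 (.op .mod (.op .add (.reg 8) (.const 1)) (.const 5))

/-- The honest prover. -/
def prover : Machine where
  init := initCmd (.set (.cell 104 (.reg 4)) (.reg 17))
  update := .ite (.reg 3)
    (.set (.cell 100 (.reg 0)) (.op .fadd (.get 100 (.reg 0)) (.reg 1))) .skip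
  respond := .ite (.op .eq (.reg 3) (.const 2)) answerCmd
    (.ite (.reg 3)
      (.setReg 0 (.get 100 (.reg 7)) ;; .setReg 7 (.op .add (.reg 7) (.const 1))) .skip)

/-! ### Tables -/

section Tables

variable {q : ℕ}

theorem Exp.eval_get {mem : ℕ → ℕ} {c v : ℕ} {x : Exp} (h : x.eval q mem = v)
    (hv : v * 8 + c < q ^ 2) : (Exp.get c x).eval q mem = mem (v * 8 + c) := by
  simp (disch := lia) only [Exp.eval, h, eval_mul_of_lt, eval_add_of_lt]

/-- Tables occupy residue classes of addresses modulo 8, so tables of any size coexist and a fill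
disturbs only its own class. `he` exposes the entries already written and the old memory elsewhere,
which covers both recursive tables and updates in place. -/
theorem reach_fill {c h T : ℕ} {g : ℕ → ℕ} {e : Exp} {s : State} (hc : 100 ≤ c) (hc' : c < 108)
    (hq : 200 < q ^ 2) (hh : h * 8 + 200 < q ^ 2) (h12 : s.mem 12 = h)
    (he : ∀ x < h, ∀ u : ℕ → ℕ, u 11 = x →
      (∀ a, a ≠ 11 → (∀ y < x, a ≠ y * 8 + c) → u a = s.mem a) →
      (∀ y < x, u (y * 8 + c) = g y) → e.eval q u = g x)
    (hT : e.cost + 20 ≤ T := by decide) :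
    Reach q (q ^ 2) (fillCmd c e) s (10 + h * T) fun r =>
      (∀ x < h, r.mem (x * 8 + c) = g x) ∧
      ∀ a, a ≠ 11 → (a < 100 ∨ a % 8 ≠ c % 8) → r.mem a = s.mem a := by
  refine Reach.mono (T := 3 + (h * (6 + ((7 + e.cost) + 6)) + 6)) ?_ ?_ fun _ => id
  swap
  · have : h * (6 + ((7 + e.cost) + 6)) ≤ h * T := by gcongr; lia
    lia
  refine Reach.setReg_seq (by lia) ?_
  let I : ℕ → State → Prop := fun x u => u.mem 11 = x ∧
    (∀ a, a ≠ 11 → (∀ y < x, a ≠ y * 8 + c) → u.mem a = s.mem a) ∧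
    (∀ y < x, u.mem (y * 8 + c) = g y)
  refine (Reach.loop I h (k := 6) (T := (7 + e.cost) + 6) ?_ ?_ ?_ le_rfl).mono le_rfl ?_
  · rintro u ⟨h11, hu, -⟩
    have := hu 12 (by lia) (by lia)
    simp [Exp.eval, eval_lt, h11, this, h12]
  · rintro x hx u ⟨h11, hu, hy⟩
    have e12 := hu 12 (by lia) (by lia)
    have ha : (Exp.cell c (.reg 11)).eval q u.mem = x * 8 + c := by
      simp (disch := lia) only [Exp.eval, h11, eval_mul_of_lt, eval_add_of_lt]
    refine ⟨by simp [Exp.eval, eval_lt, h11, e12, h12, hx], ?_⟩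
    refine Reach.seq (P := fun r => r = u.write (x * 8 + c) (g x))
      ⟨_, _, .set _ _ _ (by lia), by simp [Exp.cost], by rw [ha, he x hx u.mem h11 hu hy]⟩ ?_
    rintro r rfl
    refine Reach.step ⟨by simp only [Exp.eval]; lia, ?_⟩
    refine ⟨?_, fun a h1 h2 => ?_, fun y hy' => ?_⟩
    · simp (disch := lia) only [Exp.eval, State.write, Function.update_self,
        Function.update_of_ne, h11, eval_add_of_lt]
    · have := h2 x (by lia)
      simp (disch := lia) only [Exp.eval, State.write, Function.update_of_ne]
      exact hu a h1 fun y hy => h2 y (by lia)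
    · by_cases hyx : y = x
      · subst hyx
        simp (disch := lia) only [Exp.eval, State.write, Function.update_self,
          Function.update_of_ne]
      · simp (disch := lia) only [Exp.eval, State.write, Function.update_of_ne]
        exact hy y (by lia)
  · refine ⟨by simp [State.write, Exp.eval], fun a h1 _ => ?_, fun y hy => by lia⟩
    simp (disch := lia) only [Exp.eval, State.write, Function.update_of_ne]
  · rintro u ⟨-, hu, hy⟩
    exact ⟨hy, fun a h1 h2 => hu a h1 fun y _ => by lia⟩

variable [Fact q.Prime] {c h : ℕ} {s : State} {ρ : ZMod q} {f A B : ℕ → ZMod q}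

/-- Folding in place is safe: entry x reads entries 2x and 2x + 1, while only entries below x have
been overwritten. -/
theorem reach_fold (hc : 100 ≤ c) (hc' : c < 108) (hq : 200 < q ^ 2) (hh : h * 16 + 200 < q ^ 2)
    (h12 : s.mem 12 = h) (h16 : s.mem 16 = ρ.val)
    (hf : ∀ x < 2 * h, s.mem (x * 8 + c) = (f x).val) :
    Reach q (q ^ 2) (foldCmd c) s (10 + h * 70) fun r =>
      (∀ x < h, r.mem (x * 8 + c) = (fold ρ f x).val) ∧
      ∀ a, a ≠ 11 → (a < 100 ∨ a % 8 ≠ c % 8) → r.mem a = s.mem a := by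
  refine (reach_fill (g := fun x => (fold ρ f x).val) hc hc' hq (by lia) h12 ?_
    (T := 70) (by simp [Exp.cost, evenExp, oddExp])).mono le_rfl fun _ => id
  intro x hx u h11 hu _
  have e₀ : (evenExp c).eval q u = (f (2 * x)).val := by
    rw [evenExp, Exp.eval_get (v := 2 * x) (by simp (disch := lia) only [Exp.eval, h11, eval_mul_of_lt])
      (by lia), hu _ (by lia) (by lia), hf _ (by lia)]
  have e₁ : (oddExp c).eval q u = (f (2 * x + 1)).val := by
    rw [oddExp, Exp.eval_get (v := 2 * x + 1)
      (by simp (disch := lia) only [Exp.eval, h11, eval_mul_of_lt, eval_add_of_lt])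
      (by lia), hu _ (by lia) (by lia), hf _ (by lia)]
  have e16 := hu 16 (by lia) (by lia)
  rw [Exp.eval, Exp.eval, Exp.eval.eq_3 _ _ .fsub, e₀, e₁]
  simp only [Exp.eval, e16, h16, eval_fadd, eval_fmul, eval_fsub, ZMod.natCast_zmod_val, fold]

/-- The tables of the input and of the layer, of size `S`. -/
structure Folded (q S : ℕ) (A B : ℕ → ZMod q) (s : State) : Prop where
  size : s.mem 9 = S
  input : ∀ x < S, s.mem (x * 8 + 101) = (A x).val
  layer : ∀ x < S, s.mem (x * 8 + 102) = (B x).val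

theorem reach_foldPair (hq : 200 < q ^ 2) (hh : h * 16 + 200 < q ^ 2)
    (h16 : s.mem 16 = ρ.val) (hf : Folded q (2 * h) A B s) :
    Reach q (q ^ 2) foldPairCmd s (40 + h * 150) fun r => Folded q h (fold ρ A) (fold ρ B) r ∧
      ∀ a, a ∉ [9, 11, 12] → (a < 100 ∨ a % 8 ∉ [5, 6]) → r.mem a = s.mem a := by
  obtain ⟨h9, hA, hB⟩ := hf
  refine Reach.mono (T := 6 + (4 + ((10 + h * 70) + (10 + h * 70)))) ?_ (by lia) fun _ => id
  refine Reach.setReg_seq (by lia) (Reach.setReg_seq (by lia) ?_)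
  have e9 : s.mem 9 / 2 = h := by lia
  refine Reach.seq (reach_fold (h := h) (ρ := ρ) (f := A) (by lia) (by lia) hq hh ?_ ?_ ?_) ?_
  · simp [State.write, Exp.eval, eval_div, e9]
  · simp [State.write, h16]
  · intro x hx
    simp (disch := lia) only [State.write, Function.update_of_ne, hA x hx]
  rintro u ⟨hu, hu'⟩
  refine (reach_fold (h := h) (ρ := ρ) (f := B) (by lia) (by lia) hq hh ?_ ?_ ?_).mono le_rfl ?_
  · rw [hu' 12 (by lia) (by lia)]
    simp [State.write, Exp.eval, eval_div, e9]
  · rw [hu' 16 (by lia) (by lia)]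
    simp [State.write, h16]
  · intro x hx
    rw [hu' _ (by lia) (by lia)]
    simp (disch := lia) only [State.write, Function.update_of_ne, hB x hx]
  rintro r ⟨hr, hr'⟩
  refine ⟨⟨?_, fun x hx => ?_, hr⟩, fun a ha ha' => ?_⟩
  · rw [hr' 9 (by lia) (by lia), hu' 9 (by lia) (by lia)]
    simp [State.write, Exp.eval, eval_div, e9]
  · rw [hr' _ (by lia) (by lia), hu _ hx]
  · simp only [List.mem_cons, List.not_mem_nil, or_false, not_or] at ha ha'
    rw [hr' a (by lia) (by lia), hu' a (by lia) (by lia)]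
    simp (disch := lia) only [State.write, Function.update_of_ne]

/-- What the prover knows at any time in the layered protocol, except that the layers are computed
only in the first round. -/
structure ProverBase (q d : ℕ) (a : ℕ → ZMod q) (s : State) : Prop where
  mode : s.mem 3 = 2
  bits : s.mem 4 = d
  size : s.mem 6 = 2 ^ d
  input : ∀ x < 2 ^ d, s.mem (x * 8 + 100) = (a x).val

variable {d j : ℕ} {a : ℕ → ZMod q}

theorem reach_load (hq : 200 < q ^ 2) (hh : (j + 1) * 2 ^ d * 8 + 200 < q ^ 2)
    (hs : ProverBase q d a s) (h5 : s.mem 5 = j)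
    (hf : ∀ x < 2 ^ d, s.mem ((j * 2 ^ d + x) * 8 + 105) = (layer a j x).val) :
    Reach q (q ^ 2) loadCmd s (40 + 2 ^ d * 100) fun r => Folded q (2 ^ d) a (layer a j) r ∧
      ∀ a, a ∉ [9, 11, 12] → (a < 100 ∨ a % 8 ∉ [5, 6]) → r.mem a = s.mem a := by
  obtain ⟨-, -, h6, hin⟩ := hs
  generalize 2 ^ d = D at *
  have hj : (j + 1) * D = j * D + D := by ring
  refine Reach.mono (T := 4 + (4 + ((10 + D * 37) + (10 + D * 44))))
    ?_ (by lia) fun _ => id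
  refine Reach.setReg_seq (by lia) (Reach.setReg_seq (by lia) ?_)
  refine Reach.seq (reach_fill (h := D) (g := fun x => (a x).val) (by lia) (by lia) hq
    (by lia) ?_ ?_) ?_
  · simp [State.write, Exp.eval, h6]
  · intro x hx u h11 hu _
    rw [Exp.eval_get (v := x) (by simp [Exp.eval, h11]) (by lia), hu _ (by lia) (by lia)]
    simp (disch := lia) only [State.write, Function.update_of_ne, hin x hx]
  rintro u ⟨hu, hu'⟩
  refine (reach_fill (h := D) (g := fun x => (layer a j x).val) (by lia) (by lia) hq
    (by lia) ?_ ?_).mono le_rfl ?_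
  · rw [hu' 12 (by lia) (by lia)]
    simp [State.write, Exp.eval, h6]
  · intro x hx v h11 hv _
    have e5 : v 5 = j := by
      rw [hv 5 (by lia) (by lia), hu' 5 (by lia) (by lia)]; simp [State.write, h5]
    have e6 : v 6 = D := by
      rw [hv 6 (by lia) (by lia), hu' 6 (by lia) (by lia)]; simp [State.write, h6]
    rw [Exp.eval_get (v := j * D + x) (by
      simp (disch := lia) only [Exp.eval, h11, e5, e6, eval_add_of_lt, eval_mul_of_lt]) (by lia),
      hv _ (by lia) (by lia), hu' _ (by lia) (by lia), ← hf x hx]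
    simp (disch := lia) only [State.write, Function.update_of_ne]
  rintro r ⟨hr, hr'⟩
  refine ⟨⟨?_, fun x hx => ?_, hr⟩, fun a ha ha' => ?_⟩
  · rw [hr' 9 (by lia) (by lia), hu' 9 (by lia) (by lia)]
    simp [State.write, Exp.eval, h6]
  · rw [hr' _ (by lia) (by lia), hu _ hx]
  · simp only [List.mem_cons, List.not_mem_nil, or_false, not_or] at ha ha'
    rw [hr' a (by lia) (by lia), hu' a (by lia) (by lia)]
    simp (disch := lia) only [State.write, Function.update_of_ne]

end Tables

/-! ### Loops with halving sizes -/

theorem sum_two_pow_le (e : ℕ) : ∑ j ∈ Finset.range e, 2 ^ (e - (j + 1)) ≤ 2 ^ e := by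
  induction e with
  | zero => simp
  | succ e ih =>
    rw [Finset.sum_range_succ']
    simp only [Nat.add_sub_add_right, Nat.sub_zero, zero_add, Nat.add_sub_cancel]
    rw [pow_succ]
    lia

/-- The costs of the iterations form a geometric series, so the total is linear in 2 ^ e with no
factor e. The constant part of each iteration is absorbed by e ≤ 2 ^ e. -/
theorem Reach.halving {q M k c₀ c₁ U : ℕ} {b : Exp} {c : Cmd} (I : ℕ → State → Prop) (e : ℕ)
    (hend : ∀ s, I e s → b.eval q s.mem = 0)
    (hstep : ∀ j < e, ∀ s, I j s → b.eval q s.mem ≠ 0 ∧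
      Reach q M c s (c₀ + 2 ^ (e - (j + 1)) * c₁) (I (j + 1)))
    {s : State} (h0 : I 0 s) (hU : 2 ^ e * (k + c₀ + c₁) + k ≤ U)
    (hk : b.cost + 1 ≤ k := by decide) : Reach q M (.while b c) s U (I e) := by
  refine (Reach.while I e _ hend hstep h0).mono (le_trans ?_ hU) fun _ => id
  have h₁ : ∑ j ∈ Finset.range e, (b.cost + 1 + (c₀ + 2 ^ (e - (j + 1)) * c₁)) ≤
      ∑ j ∈ Finset.range e, ((k + c₀) + 2 ^ (e - (j + 1)) * c₁) :=
    Finset.sum_le_sum fun j _ => by lia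
  rw [Finset.sum_add_distrib (f := fun _ => k + c₀), Finset.sum_const, ← Finset.sum_mul,
    Finset.card_range, smul_eq_mul] at h₁
  have h₂ := Nat.mul_le_mul_right c₁ (sum_two_pow_le e)
  have h₃ := Nat.mul_le_mul_right (k + c₀) (Nat.lt_two_pow_self (n := e)).le
  rw [mul_add (2 ^ e)]
  lia

section Prover

variable {q : ℕ} [Fact q.Prime] {K d : ℕ} {a w : ℕ → ZMod q} {b : ℕ} {s : State}

/-! ### The layers -/

/-- All layers lie in one table, layer after layer. Entry x depends on entry x - 2^d of the same
table, so a single increasing fill computes everything. -/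
theorem reach_layers (hq : 200 < q ^ 2) (hh : (K + 1) * 2 ^ d * 8 + 200 < q ^ 2)
    (hs : ProverBase q d a s) (h5 : s.mem 5 = K) :
    Reach q (q ^ 2) layersCmd s (40 + (K + 1) * 2 ^ d * 100) fun r =>
      (∀ x < (K + 1) * 2 ^ d, r.mem (x * 8 + 105) = (layer a (x / 2 ^ d) (x % 2 ^ d)).val) ∧
      ∀ a, a ∉ [11, 12] → (a < 100 ∨ a % 8 ≠ 1) → r.mem a = s.mem a := by
  obtain ⟨-, -, h6, hin⟩ := hs
  have hD : 0 < 2 ^ d := by positivity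
  generalize 2 ^ d = D at *
  refine Reach.mono (T := 10 + (10 + (K + 1) * D * 100)) ?_ (by lia) fun _ => id
  have hKD : K + 1 ≤ (K + 1) * D := Nat.le_mul_of_pos_right _ hD
  have hDK : D ≤ (K + 1) * D := Nat.le_mul_of_pos_left _ (by lia)
  generalize hN : (K + 1) * D = N at *
  refine Reach.setReg_seq (by lia) ?_
  refine (reach_fill (h := N) (g := fun x => (layer a (x / D) (x % D)).val) (by lia) (by lia) hq
    (by lia) ?_ ?_).mono le_rfl ?_
  · simp (disch := lia) only [State.write, Exp.eval, h5, h6, eval_add_of_lt]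
    rw [eval_mul_of_lt (by lia), Function.update_self, hN]
  · intro x hx u h11 hu hg
    have e6 : u 6 = D := by
      rw [hu 6 (by lia) (by lia)]; simp [State.write, h6]
    simp only [Exp.eval, e6, h11]
    -- Two complementary bits replace a conditional expression: in layer 0 the product is multiplied
    -- by 0, whatever its truncated address reads.
    by_cases hxD : x < D
    · simp [Exp.eval, eval_lt, eval_eq, eval_fmul, eval_fadd, hxD, Nat.div_eq_of_lt hxD, layer]
    · obtain ⟨y, rfl⟩ := Nat.exists_eq_add_of_le (not_lt.mp hxD)
      have hy : (D + y) % D = y % D := by simp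
      have hy' : (D + y) / D = y / D + 1 := Nat.add_div_left _ hD
      have hyD := Nat.mod_lt y hD
      have ep : productExp.eval q u = (a (y % D) * layer a (y / D) (y % D)).val := by
        rw [productExp, Exp.eval, Exp.eval_get (v := y % D)
          (by simp only [Exp.eval, h11, e6, eval_mod, hy]) (by lia),
          Exp.eval_get (v := y) (by simp [Exp.eval, h11, e6, eval_sub]) (by lia),
          hg y (by lia), hu _ (by lia) (by lia)]
        simp (disch := lia) only [State.write, Function.update_of_ne, hin _ hyD, eval_fmul,
          ZMod.natCast_zmod_val]
      simp [Exp.eval, eval_lt, eval_eq, eval_fmul, eval_fadd, ep, hy', layer, sq]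
  · rintro r ⟨hr, hr'⟩
    refine ⟨hr, fun a ha ha' => ?_⟩
    simp only [List.mem_cons, List.not_mem_nil, or_false, not_or] at ha
    rw [hr' a (by lia) (by lia)]
    simp (disch := lia) only [State.write, Function.update_of_ne]

/-! ### The state of the prover in a block -/

/-- The memory of the prover in block `b`. -/
structure BlockInv (K d : ℕ) (a w : ℕ → ZMod q) (b : ℕ) (s : State) : Prop where
  base : ProverBase q d a s
  layer : s.mem 5 = blockLayer K d b
  idx : s.mem 14 = blockIdx d b
  weight : s.mem 10 = (weight d w b).val
  started : s.mem 15 = 1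
  folded : Folded q (2 ^ (d + 1 - blockIdx d b)) (inputTable d a w b) (layerTable K d a w b) s
  point : ∀ j < d, s.mem (j * 8 + 104) = (point d w b j).val
  layers : ∀ x < (K + 1) * 2 ^ d,
    s.mem (x * 8 + 105) = (StreamIP.layer a (x / 2 ^ d) (x % 2 ^ d)).val

theorem ProverBase.frame {s r : State} (h : ProverBase q d a s)
    (hr : ∀ a, a ∉ [0, 1, 5, 8, 9, 10, 11, 12, 13, 14, 15, 16] → (a < 100 ∨ a % 8 = 4) →
      r.mem a = s.mem a) :
    ProverBase q d a r where
  mode := by rw [hr 3 (by simp) (by lia), h.mode]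
  bits := by rw [hr 4 (by simp) (by lia), h.bits]
  size := by rw [hr 6 (by simp) (by lia), h.size]
  input x hx := by rw [hr _ (by simp) (by lia), h.input x hx]

theorem BlockInv.frame {s r : State} (h : BlockInv K d a w b s)
    (hr : ∀ a, a ∉ [0, 1, 8, 11, 12, 13, 16] → (a < 100 ∨ a % 8 ≠ 7) → r.mem a = s.mem a) :
    BlockInv K d a w b r where
  base := h.base.frame fun a ha ha' => hr a (by simp at ha ⊢; lia) (by lia)
  layer := by rw [hr 5 (by simp) (by lia), h.layer]
  idx := by rw [hr 14 (by simp) (by lia), h.idx]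
  weight := by rw [hr 10 (by simp) (by lia), h.weight]
  started := by rw [hr 15 (by simp) (by lia), h.started]
  folded := ⟨by rw [hr 9 (by simp) (by lia), h.folded.size],
    fun x hx => by rw [hr _ (by simp) (by lia), h.folded.input x hx],
    fun x hx => by rw [hr _ (by simp) (by lia), h.folded.layer x hx]⟩
  point j hj := by rw [hr _ (by simp) (by lia), h.point j hj]
  layers x hx := by rw [hr _ (by simp) (by lia), h.layers x hx]

/-- The memory of the prover after the stream. -/
structure ProverReady (K d : ℕ) (a : ℕ → ZMod q) (s : State) : Prop where
  base : ProverBase q d a s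
  layer : s.mem 5 = K
  idx : s.mem 14 = d + 1
  weight : s.mem 10 = 0
  started : s.mem 15 = 0
  round : s.mem 8 = 0
  half : s.mem 17 = (1 / 2 : ZMod q).val
  point : ∀ j < d, s.mem (j * 8 + 104) = (1 / 2 : ZMod q).val

/-- The opening claims are values at (1/2, …, 1/2), so the tables of the input and the top layer are
folded with 1/2 down to one entry. -/
theorem reach_start (hq : 200 < q ^ 2) (hh : (K + 1) * 2 ^ d * 16 + 200 < q ^ 2)
    (hs : ProverReady K d a s) :
    Reach q (q ^ 2) (.setReg 15 (.const 1) ;; startCmd) s (200 + (K + 1) * 2 ^ d * 500) fun r =>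
      BlockInv K d a w 0 r ∧ r.mem 8 = 0 := by
  obtain ⟨hB, h5, h14, h10, h15, h8, h17, hP⟩ := hs
  have hDK : 2 ^ d ≤ (K + 1) * 2 ^ d := Nat.le_mul_of_pos_left _ (by lia)
  refine Reach.mono (T := 5 + ((40 + (K + 1) * 2 ^ d * 100) + ((40 + 2 ^ d * 100) + (5 +
    (2 ^ d * 200 + 10))))) ?_ (by lia) fun _ => id
  refine Reach.setReg_seq (by lia) ?_
  have hB' := hB.frame (r := s.write 15 (Exp.eval q s.mem (.const 1))) fun a ha _ => by
    simp at ha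
    simp (disch := lia) only [State.write, Function.update_of_ne]
  refine Reach.seq (reach_layers hq (by lia) hB' (by simp [State.write, h5])) ?_
  rintro u ⟨huL, hu⟩
  have huB := hB'.frame (r := u) fun a ha _ => by
    simp at ha
    exact hu a (by simp; lia) (by lia)
  refine Reach.seq (reach_load (j := K) hq (by lia) huB ?_ fun x hx => ?_) ?_
  · rw [hu 5 (by simp) (by lia)]; simp [State.write, h5]
  · rw [huL _ (by rw [add_mul, one_mul]; lia), mul_comm K, Nat.mul_add_div (by positivity),
      Nat.div_eq_of_lt hx, Nat.mul_add_mod, Nat.mod_eq_of_lt hx, add_zero]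
  rintro v ⟨hvF, hv⟩
  have huv : ∀ a, a ∉ [9, 11, 12, 15] → (a < 100 ∨ a % 8 ∉ [1, 5, 6]) → v.mem a = s.mem a := by
    intro a ha ha'
    simp at ha ha'
    rw [hv a (by simp; lia) (by simp; lia), hu a (by simp; lia) (by lia)]
    simp (disch := lia) only [State.write, Function.update_of_ne]
  refine Reach.setReg_seq (by lia) ?_
  let I : ℕ → State → Prop := fun j r => Folded q (2 ^ (d - j)) (foldSeq (fun _ => 1 / 2) a j)
    (foldSeq (fun _ => 1 / 2) (StreamIP.layer a K) j) r ∧ r.mem 16 = (1 / 2 : ZMod q).val ∧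
    ∀ a, a ∉ [9, 11, 12, 16] → (a < 100 ∨ a % 8 ∉ [5, 6]) → r.mem a = v.mem a
  refine (Reach.halving I d (k := 6) (c₀ := 40) (c₁ := 150) ?_ ?_ ?_ (by lia)).mono le_rfl ?_
  · rintro r ⟨hF, -⟩
    simp [Exp.eval, eval_lt, hF.size]
  · rintro j hj r ⟨hF, h16, hr⟩
    have h2 : 2 ^ (d - j) = 2 * 2 ^ (d - (j + 1)) := by
      rw [← pow_succ', show d - (j + 1) + 1 = d - j by lia]
    have hle : 2 ^ (d - (j + 1)) ≤ 2 ^ d := Nat.pow_le_pow_right (by lia) (by lia)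
    have hpos : 0 < 2 ^ (d - (j + 1)) := by positivity
    rw [h2] at hF
    refine ⟨?_, (reach_foldPair hq (by lia) h16 hF).mono le_rfl ?_⟩
    · have : 1 < 2 * 2 ^ (d - (j + 1)) := by lia
      simp [Exp.eval, eval_lt, hF.size, this]
    · rintro r' ⟨hF', hr'⟩
      refine ⟨hF', ?_, fun a ha ha' => ?_⟩
      · rw [hr' 16 (by simp) (by lia), h16]
      · rw [hr' a (by simp at ha ⊢; lia) ha', hr a ha ha']
  · refine ⟨⟨?_, fun x hx => ?_, fun x hx => ?_⟩, ?_, fun a ha _ => ?_⟩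
    · simp [State.write, hvF.size]
    · simp (disch := lia) only [State.write, Function.update_of_ne]
      exact hvF.input x hx
    · simp (disch := lia) only [State.write, Function.update_of_ne]
      exact hvF.layer x hx
    · simp only [State.write, Exp.eval, Function.update_self]
      rw [huv 17 (by simp) (by lia), h17]
    · simp at ha
      simp (disch := lia) only [State.write, Function.update_of_ne]
  · rintro r ⟨hF, -, hr⟩
    have hrs : ∀ a, a ∉ [9, 11, 12, 15, 16] → (a < 100 ∨ a % 8 ∉ [1, 5, 6]) →
        r.mem a = s.mem a := by
      intro a ha ha'
      simp at ha ha'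
      rw [hr a (by simp; lia) (by simp; lia), huv a (by simp; lia) (by simp; lia)]
    refine ⟨⟨hB.frame fun a ha ha' => hrs a (by simp at ha ⊢; lia) (by simp; lia), ?_, ?_, ?_, ?_,
      ?_, fun j hj => ?_, fun x hx => ?_⟩, ?_⟩
    · rw [hrs 5 (by simp) (by lia), h5, blockLayer]
    · rw [hrs 14 (by simp) (by lia), h14, blockIdx]
    · rw [hrs 10 (by simp) (by lia), h10, StreamIP.weight, ZMod.val_zero]
    · rw [hr 15 (by simp) (by lia), hv 15 (by simp) (by lia), hu 15 (by simp) (by lia)]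
      simp [State.write, Exp.eval]
    · simpa [inputTable, layerTable, blockIdx, blockLayer, StreamIP.point] using hF
    · rw [hrs _ (by simp) (by simp), hP j hj, StreamIP.point]
    · rw [hr _ (by simp) (by simp), hv _ (by simp) (by simp), huL x hx]
    · rw [hrs 8 (by simp) (by lia), h8]

/-- After claims, full tables of the next layer are loaded; otherwise the current ones are folded at
the coin. In both cases the cost is proportional to the size of the new tables. -/
theorem reach_advance (hq : 200 < q ^ 2) (hh : (K + 1) * 2 ^ d * 16 + 200 < q ^ 2)
    (hdq : d * 8 + 200 < q ^ 2)
    (hs : BlockInv K d a w b s) (h0 : s.mem 0 = (w b).val) :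
    Reach q (q ^ 2) advanceCmd s (200 + 2 ^ (d + 1 - blockIdx d (b + 1)) * 200) fun r =>
      BlockInv K d a w (b + 1) r ∧ r.mem 8 = s.mem 8 := by
  obtain ⟨hB, h5, h14, h10, h15, hF, hP, hL⟩ := hs
  have hDK : 2 ^ d ≤ (K + 1) * 2 ^ d := Nat.le_mul_of_pos_left _ (by lia)
  refine Reach.mono (T := 6 + (180 + 2 ^ (d + 1 - blockIdx d (b + 1)) * 200)) ?_ (by lia)
    fun _ => id
  refine Reach.branch (fun hb => ?_) fun hb => ?_
  · have hi : blockIdx d b = d + 1 := by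
      have := blockIdx_le d b
      simp [Exp.eval, eval_lt, hB.bits, h14] at hb
      lia
    have e₁ : blockIdx d (b + 1) = 1 := by rw [blockIdx, if_pos hi]
    have e₂ : blockLayer K d (b + 1) = blockLayer K d b - 1 := by rw [blockLayer, if_pos hi]
    have e₃ : point d w (b + 1) = point d w b := by rw [point, if_pos hi]
    have e₄ : weight d w (b + 1) = w b := by rw [weight, if_pos hi]
    have hl := blockLayer_le K d (b + 1)
    rw [e₁, Nat.add_sub_cancel]
    refine Reach.mono (T := 5 + (6 + (5 + (40 + 2 ^ d * 100)))) ?_ (by lia) fun _ => id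
    refine Reach.setReg_seq (by lia) (Reach.setReg_seq (by lia) (Reach.setReg_seq (by lia) ?_))
    have hlK : (blockLayer K d (b + 1) + 1) * 2 ^ d ≤ (K + 1) * 2 ^ d := by gcongr
    refine (reach_load (j := blockLayer K d (b + 1)) (a := a) hq (by lia) ?_ ?_
      fun x hx => ?_).mono le_rfl ?_
    · refine hB.frame fun a ha ha' => ?_
      simp at ha
      simp (disch := lia) only [State.write, Function.update_of_ne]
    · simp [State.write, Exp.eval, eval_sub, h5, e₂]
    · simp (disch := lia) only [State.write, Function.update_of_ne]
      rw [hL _ (by rw [add_mul, one_mul] at hlK; lia), mul_comm (blockLayer K d (b + 1)),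
        Nat.mul_add_div (by positivity),
        Nat.div_eq_of_lt hx, Nat.mul_add_mod, Nat.mod_eq_of_lt hx, add_zero]
    · rintro r ⟨hrF, hr⟩
      have hrs : ∀ a, a ∉ [5, 9, 10, 11, 12, 14] → (a < 100 ∨ a % 8 ∉ [5, 6]) →
          r.mem a = s.mem a := by
        intro a ha ha'
        simp at ha ha'
        rw [hr a (by simp; lia) (by simp; lia)]
        simp (disch := lia) only [State.write, Function.update_of_ne]
      refine ⟨⟨hB.frame fun a ha ha' => hrs a (by simp at ha ⊢; lia) (by simp; lia), ?_, ?_, ?_,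
        ?_, ?_, fun j hj => ?_, fun x hx => ?_⟩, ?_⟩
      · rw [hr 5 (by simp) (by lia)]
        simp [State.write, Exp.eval, eval_sub, h5, e₂]
      · rw [hr 14 (by simp) (by lia)]
        simp [State.write, Exp.eval, e₁]
      · rw [hr 10 (by simp) (by lia)]
        simp [State.write, Exp.eval, e₄, h0]
      · rw [hrs 15 (by simp) (by lia), h15]
      · simpa [inputTable, layerTable, e₁, foldSeq] using hrF
      · rw [hrs _ (by simp) (by simp), hP j hj, e₃]
      · rw [hrs _ (by simp) (by simp), hL x hx]
      · rw [hrs 8 (by simp) (by lia)]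
  · have hi : blockIdx d b ≠ d + 1 := by
      intro h
      simp [Exp.eval, eval_lt, hB.bits, h14, h] at hb
    have h1 := one_le_blockIdx d b
    have h1' := blockIdx_le d b
    have e₁ : blockIdx d (b + 1) = blockIdx d b + 1 := by rw [blockIdx, if_neg hi]
    have e₂ : blockLayer K d (b + 1) = blockLayer K d b := by rw [blockLayer, if_neg hi]
    have e₃ : point d w (b + 1) = Function.update (point d w b) (blockIdx d b - 1) (w b) := by
      rw [point, if_neg hi]
    have e₄ : weight d w (b + 1) = weight d w b := by rw [weight, if_neg hi]
    obtain ⟨i, hi'⟩ := Nat.exists_eq_add_of_le' h1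
    have hA : ∀ f : ℕ → ZMod q, foldSeq (Function.update (point d w b) i (w b)) f (i + 1) =
        fold (w b) (foldSeq (point d w b) f i) := by
      intro f
      rw [foldSeq, Function.update_self]
      congr 1
      exact foldSeq_congr_point f fun j hj => Function.update_of_ne (by lia) _ _
    rw [hi', Nat.add_sub_cancel] at e₃
    rw [hi'] at e₁ h14
    simp only [inputTable, layerTable, hi', Nat.add_sub_cancel] at hF
    have hsz : 2 ^ (d + 1 - (i + 1)) = 2 * 2 ^ (d - (i + 1)) := by
      rw [← pow_succ']; congr 1; lia
    have hle : 2 ^ (d - (i + 1)) ≤ 2 ^ d := Nat.pow_le_pow_right (by lia) (by lia)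
    rw [hsz] at hF
    rw [e₁, Nat.add_sub_add_right]
    refine Reach.mono (T := 5 + (10 + (7 + (40 + 2 ^ (d - (i + 1)) * 150)))) ?_ (by lia)
      fun _ => id
    refine Reach.setReg_seq (by lia) ?_
    -- The base is 96 = 104 - 8 because block index i + 1 replaces coordinate i.
    have hcell : (Exp.cell 96 (.reg 14)).eval q (s.write 16 (Exp.eval q s.mem (.reg 0))).mem =
        i * 8 + 104 := by
      have : (i + 1) * 8 + 96 = i * 8 + 104 := by lia
      simp (disch := lia) only [Exp.eval, State.write, Function.update_of_ne, h14, eval_mul_of_lt,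
        eval_add_of_lt, this]
    refine Reach.seq (P := fun r => r = (s.write 16 (w b).val).write (i * 8 + 104) (w b).val)
      ⟨_, _, .set _ _ _ (by lia), by simp [Exp.cost], by
        rw [hcell]; simp [State.write, Exp.eval, h0]⟩ ?_
    rintro _ rfl
    refine Reach.setReg_seq (by lia) ?_
    refine (reach_foldPair (h := 2 ^ (d - (i + 1))) (ρ := w b) (A := foldSeq (point d w b) a i)
      (B := foldSeq (point d w b) (StreamIP.layer a (blockLayer K d b)) i) hq (by lia) ?_
      ⟨?_, fun x hx => ?_, fun x hx => ?_⟩).mono le_rfl ?_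
    · simp (disch := lia) only [State.write, Function.update_of_ne, Function.update_self]
    · simp (disch := lia) only [State.write, Function.update_of_ne]
      exact hF.size
    · simp (disch := lia) only [State.write, Function.update_of_ne]
      exact hF.input x hx
    · simp (disch := lia) only [State.write, Function.update_of_ne]
      exact hF.layer x hx
    · rintro r ⟨hrF, hr⟩
      have hrs : ∀ a, a ∉ [9, 11, 12, 14, 16] → (a < 100 ∨ a % 8 ∉ [5, 6]) → a ≠ i * 8 + 104 →
          r.mem a = s.mem a := by
        intro a ha ha' ha''
        simp at ha ha'
        rw [hr a (by simp; lia) (by simp; lia)]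
        simp (disch := lia) only [State.write, Function.update_of_ne]
      refine ⟨⟨?_, ?_, ?_, ?_, ?_, ?_, fun j hj => ?_, fun x hx => ?_⟩, ?_⟩
      · obtain ⟨b₁, b₂, b₃, b₄⟩ := hB
        exact ⟨by rw [hrs 3 (by simp) (by lia) (by lia), b₁],
          by rw [hrs 4 (by simp) (by lia) (by lia), b₂],
          by rw [hrs 6 (by simp) (by lia) (by lia), b₃],
          fun x hx => by rw [hrs _ (by simp) (by simp) (by lia), b₄ x hx]⟩
      · rw [hrs 5 (by simp) (by lia) (by lia), h5, e₂]
      · rw [hr 14 (by simp) (by lia)]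
        have hid : i + 1 + 1 < q ^ 2 := by lia
        simp (disch := lia) only [State.write, Exp.eval, Function.update_self,
          Function.update_of_ne, h14, e₁]
        rw [eval_add_of_lt hid]
      · rw [hrs 10 (by simp) (by lia) (by lia), h10, e₄]
      · rw [hrs 15 (by simp) (by lia) (by lia), h15]
      · rw [inputTable, layerTable, e₁, e₂, e₃, Nat.add_sub_cancel, hA, hA,
          Nat.add_sub_add_right]
        exact hrF
      · by_cases hji : j = i
        · subst hji
          rw [hr _ (by simp) (by simp), e₃, Function.update_self]
          simp (disch := lia) only [State.write, Function.update_of_ne, Function.update_self]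
        · rw [hrs _ (by simp) (by simp) (by lia), hP j hj, e₃,
            Function.update_of_ne hji]
      · rw [hrs _ (by simp) (by simp) (by lia), hL x hx]
      · rw [hrs 8 (by simp) (by lia) (by lia)]

end Prover

/-! ### Computation of the prover's messages. -/

section Message

variable {q : ℕ} [Fact q.Prime] {K d : ℕ} {a w : ℕ → ZMod q} {b : ℕ} {s : State}

theorem eval_coefExp {u : ℕ → ℕ} {lam : ZMod q} {A B : ℕ → ZMod q} {x t : ℕ} (ht : t < 5)
    (h10 : u 10 = lam.val)
    (hA₀ : (evenExp 101).eval q u = (A (2 * x)).val)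
    (hA₁ : (oddExp 101).eval q u = (A (2 * x + 1)).val)
    (hB₀ : (evenExp 102).eval q u = (B (2 * x)).val)
    (hB₁ : (oddExp 102).eval q u = (B (2 * x + 1)).val) :
    (coefExp t).eval q u = (coef lam A B t x).val := by
  interval_cases t <;>
    simp only [coefExp, lowExp, middleExp, highExp, Exp.eval, hA₀, hA₁, hB₀, hB₁, h10, eval_fadd,
      eval_fmul, eval_fsub, ZMod.natCast_zmod_val, coef]

theorem cost_coefExp (t : ℕ) : (coefExp t).cost ≤ 280 := by
  match t with
  | 0 | 1 | 2 | 3 => decide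
  | t + 4 => exact (by decide : (coefExp 4).cost ≤ 280)

theorem reach_coef {h t : ℕ} (ht : t < 5) (hq : 200 < q ^ 2) (hh : h * 16 + 200 < q ^ 2)
    {lam : ZMod q} {A B : ℕ → ZMod q} (hF : Folded q (2 * h) A B s) (h12 : s.mem 12 = h)
    (h10 : s.mem 10 = lam.val) (h8 : s.mem 8 = t) :
    Reach q (q ^ 2) coefCmd s (40 + h * 300) fun r =>
      (∀ x < h, r.mem (x * 8 + 103) = (coef lam A B t x).val) ∧
      ∀ a, a ≠ 11 → (a < 100 ∨ a % 8 ≠ 7) → r.mem a = s.mem a := by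
  have key : Reach q (q ^ 2) (fillCmd 103 (coefExp t)) s (10 + h * 300) fun r =>
      (∀ x < h, r.mem (x * 8 + 103) = (coef lam A B t x).val) ∧
      ∀ a, a ≠ 11 → (a < 100 ∨ a % 8 ≠ 7) → r.mem a = s.mem a := by
    refine reach_fill (by lia) (by lia) hq (by lia) h12 (fun x hx u h11 hu _ => ?_)
      (by have := cost_coefExp t; lia)
    refine eval_coefExp ht (by rw [hu 10 (by lia) (by lia), h10]) ?_ ?_ ?_ ?_
    · rw [evenExp, Exp.eval_get (v := 2 * x)
        (by simp (disch := lia) only [Exp.eval, h11, eval_mul_of_lt]) (by lia),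
        hu _ (by lia) (by lia), hF.input _ (by lia)]
    · rw [oddExp, Exp.eval_get (v := 2 * x + 1)
        (by simp (disch := lia) only [Exp.eval, h11, eval_mul_of_lt, eval_add_of_lt]) (by lia),
        hu _ (by lia) (by lia), hF.input _ (by lia)]
    · rw [evenExp, Exp.eval_get (v := 2 * x)
        (by simp (disch := lia) only [Exp.eval, h11, eval_mul_of_lt]) (by lia),
        hu _ (by lia) (by lia), hF.layer _ (by lia)]
    · rw [oddExp, Exp.eval_get (v := 2 * x + 1)
        (by simp (disch := lia) only [Exp.eval, h11, eval_mul_of_lt, eval_add_of_lt]) (by lia),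
        hu _ (by lia) (by lia), hF.layer _ (by lia)]
  refine Reach.mono (T := 3 + (5 + (5 + (5 + (10 + h * 300))))) ?_ (by lia) fun _ => id
  refine Reach.branch (fun hb => Reach.branch (fun hb₁ => ?_) fun hb₁ =>
    Reach.branch (fun hb₂ => ?_) fun hb₂ => Reach.branch (fun hb₃ => ?_) fun hb₃ => ?_) fun hb => ?_
  all_goals simp only [Exp.eval, h8, eval_eq] at *
  · obtain rfl : t = 1 := by by_contra h; simp [h] at hb₁
    exact key.mono (by lia) fun _ => id
  · obtain rfl : t = 2 := by by_contra h; simp [h] at hb₂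
    exact key.mono (by lia) fun _ => id
  · obtain rfl : t = 3 := by by_contra h; simp [h] at hb₃
    exact key
  · have h₁ : t ≠ 1 := by rintro rfl; simp at hb₁
    have h₂ : t ≠ 2 := by rintro rfl; simp at hb₂
    have h₃ : t ≠ 3 := by rintro rfl; simp at hb₃
    obtain rfl : t = 4 := by lia
    exact key
  · subst hb
    exact key.mono (by lia) fun _ => id

/-- In the block of index i the variable is coordinate i - 1, so the coordinates still to be
substituted start at i. Halving keeps the cost linear in the table. -/
theorem reach_eval {i : ℕ} {ρ f : ℕ → ZMod q} (hq : 200 < q ^ 2) (hi : i ≤ d)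
    (hh : 2 ^ d * 16 + 200 < q ^ 2) (hdq : d * 8 + 200 < q ^ 2)
    (h12 : s.mem 12 = 2 ^ (d - i)) (h14 : s.mem 14 = i)
    (hρ : ∀ j < d, s.mem (j * 8 + 104) = (ρ j).val)
    (hf : ∀ x < 2 ^ (d - i), s.mem (x * 8 + 103) = (f x).val) :
    Reach q (q ^ 2) evalCmd s (40 + 2 ^ (d - i) * 200) fun r =>
      r.mem 0 = (mle (fun y => ρ (i + y)) (d - i) f).val ∧
      ∀ a, a ∉ [0, 11, 12, 13, 16] → (a < 100 ∨ a % 8 ≠ 7) → r.mem a = s.mem a := by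
  refine Reach.mono (T := 4 + ((2 ^ (d - i) * 200 + 10) + 10)) ?_ (by lia) fun _ => id
  refine Reach.setReg_seq (by lia) ?_
  let I : ℕ → State → Prop := fun j r => r.mem 12 = 2 ^ (d - i - j) ∧ r.mem 13 = i + j ∧
    (∀ x < 2 ^ (d - i - j), r.mem (x * 8 + 103) = (foldSeq (fun y => ρ (i + y)) f j x).val) ∧
    ∀ a, a ∉ [11, 12, 13, 16] → (a < 100 ∨ a % 8 ≠ 7) → r.mem a = s.mem a
  refine Reach.seq (Reach.halving I (d - i) (k := 6) (c₀ := 50) (c₁ := 70) ?_ ?_ ?_ (by lia)) ?_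
  · rintro r ⟨h, -⟩
    simp [Exp.eval, eval_lt, h]
  · rintro j hj r ⟨e12, e13, hr, hr'⟩
    have h2 : 2 ^ (d - i - j) = 2 * 2 ^ (d - i - (j + 1)) := by
      rw [← pow_succ']; congr 1; lia
    have hle : 2 ^ (d - i - (j + 1)) ≤ 2 ^ d := Nat.pow_le_pow_right (by lia) (by lia)
    have hpos : 0 < 2 ^ (d - i - (j + 1)) := by positivity
    rw [h2] at e12 hr
    have e12' : r.mem 12 / 2 = 2 ^ (d - i - (j + 1)) := by lia
    generalize hS : 2 ^ (d - i - (j + 1)) = S at *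
    refine ⟨?_, ?_⟩
    · have : 1 < 2 * S := by lia
      simp [Exp.eval, eval_lt, e12, this]
    refine Reach.mono (T := 6 + (9 + ((10 + S * 70) + 10))) ?_ (by lia) fun _ => id
    refine Reach.setReg_seq (by lia) (Reach.setReg_seq (by lia) ?_)
    refine Reach.seq (reach_fold (h := S) (ρ := ρ (i + j))
      (f := foldSeq (fun y => ρ (i + y)) f j) (by lia) (by lia) hq (by lia) ?_ ?_
      fun x hx => ?_) ?_
    · simp [State.write, Exp.eval, eval_div, e12']
    · simp only [State.write, Function.update_self]
      rw [Exp.eval_get (v := i + j) (by simp [Exp.eval, e13]) (by lia)]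
      simp (disch := lia) only [Function.update_of_ne]
      rw [hr' _ (by simp) (by lia), hρ _ (by lia)]
    · simp (disch := lia) only [State.write, Function.update_of_ne]
      exact hr x hx
    rintro u ⟨hu, hu'⟩
    have e13' : u.mem 13 = i + j := by rw [hu' 13 (by lia) (by lia)]; simp [State.write, e13]
    refine Reach.step ⟨by simp [Exp.eval]; lia, ?_, ?_, ?_, ?_⟩
    · simp (disch := lia) only [State.write, Exp.eval, Function.update_of_ne]
      rw [hu' 12 (by lia) (by lia)]
      simp [State.write, Exp.eval, eval_div, e12', hS]
    · simp (disch := lia) only [State.write, Exp.eval, Function.update_self, e13', eval_add_of_lt,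
        add_assoc]
    · intro x hx
      rw [hS] at hx
      simp (disch := lia) only [State.write, Exp.eval, Function.update_of_ne]
      exact hu x hx
    · intro a ha ha'
      simp at ha
      simp (disch := lia) only [State.write, Exp.eval, Function.update_of_ne]
      rw [hu' a (by lia) (by lia)]
      simp (disch := lia) only [State.write, Function.update_of_ne]
      exact hr' a (by simp; lia) ha'
  · refine ⟨?_, ?_, fun x hx => ?_, fun a ha _ => ?_⟩
    · simp [State.write, h12]
    · simp [State.write, Exp.eval, h14]
    · simp (disch := lia) only [State.write, Function.update_of_ne]
      exact hf x hx
    · simp at ha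
      simp (disch := lia) only [State.write, Function.update_of_ne]
  · rintro r ⟨-, -, hr, hr'⟩
    refine Reach.step ⟨by simp [Exp.eval]; lia, ?_, fun a ha ha' => ?_⟩
    · simp only [State.write, Exp.eval.eq_1, Function.update_self]
      rw [Exp.eval_get (v := 0) (by simp [Exp.eval]) (by lia), hr 0 (by positivity), mle]
    · simp at ha
      simp (disch := lia) only [State.write, Exp.eval, Function.update_of_ne]
      exact hr' a (by simp; lia) ha'

/-- The coefficient table is built afresh for each degree, one degree per round; this costs only a
constant factor and leaves the folded tables intact. -/
theorem reach_message {t : ℕ} (ht : t < 5) (hq : 200 < q ^ 2)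
    (hh : 2 ^ d * 16 + 200 < q ^ 2) (hdq : d * 8 + 200 < q ^ 2)
    (hs : BlockInv K d a w b s) (h8 : s.mem 8 = t) :
    Reach q (q ^ 2) messageCmd s (200 + 2 ^ (d + 1 - blockIdx d b) * 600) fun r =>
      r.mem 0 = (honest K d a w b t).val ∧ BlockInv K d a w b r ∧ r.mem 8 = t := by
  refine Reach.mono (T := 6 + (180 + 2 ^ (d + 1 - blockIdx d b) * 600)) ?_ (by lia) fun _ => id
  refine Reach.branch (fun hb => ?_) fun hb => ?_
  · have hi : blockIdx d b = d + 1 := by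
      have := blockIdx_le d b
      simp [Exp.eval, eval_lt, hs.base.bits, hs.idx] at hb
      lia
    have hF := hs.folded
    rw [hi, Nat.sub_self, pow_zero] at hF
    have frame : ∀ v, BlockInv K d a w b (s.write 0 v) := fun v => hs.frame fun a ha _ => by
      simp at ha
      simp (disch := lia) only [State.write, Function.update_of_ne]
    have e₁ : (Exp.get 101 (.const 0)).eval q s.mem = (inputTable d a w b 0).val := by
      rw [Exp.eval_get (v := 0) (by simp [Exp.eval]) (by lia), hF.input 0 (by lia)]
    have e₂ : (Exp.get 102 (.const 0)).eval q s.mem = (layerTable K d a w b 0).val := by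
      rw [Exp.eval_get (v := 0) (by simp [Exp.eval]) (by lia), hF.layer 0 (by lia)]
    refine Reach.step ?_ (T := 180 + 2 ^ (d + 1 - blockIdx d b) * 600)
      (le_trans (b := 180) (by decide) (by lia))
    refine ⟨fun h => ?_, fun h => ?_⟩ <;> simp only [Exp.eval.eq_2, Exp.eval.eq_1, h8] at h
    · refine ⟨by simp [Exp.eval]; lia, ?_, frame _, by simp [State.write, Exp.eval, h8]⟩
      rw [honest, if_pos hi, if_neg h, e₁]
      simp [State.write, Exp.eval]
    · refine ⟨by simp [Exp.eval]; lia, ?_, frame _, by simp [State.write, Exp.eval, h8]⟩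
      rw [honest, if_pos hi, if_pos h, e₂]
      simp [State.write, Exp.eval]
  · have hi : blockIdx d b ≠ d + 1 := by
      intro h
      simp [Exp.eval, eval_lt, hs.base.bits, hs.idx, h] at hb
    have h1 := one_le_blockIdx d b
    have h1' := blockIdx_le d b
    have hF := hs.folded
    have h14 := hs.idx
    have hhonest : honest K d a w b t = mle (fun y => point d w b (blockIdx d b + y))
        (d - blockIdx d b)
        (coef (weight d w b) (inputTable d a w b) (layerTable K d a w b) t) := by
      rw [honest, if_neg hi]
    rw [hhonest]
    have hsz : 2 ^ (d + 1 - blockIdx d b) = 2 * 2 ^ (d - blockIdx d b) := by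
      rw [← pow_succ']; congr 1; lia
    have hle : 2 ^ (d - blockIdx d b) ≤ 2 ^ d := Nat.pow_le_pow_right (by lia) (by lia)
    rw [hsz] at hF ⊢
    refine Reach.mono (T := 6 + ((40 + 2 ^ (d - blockIdx d b) * 300) +
      (40 + 2 ^ (d - blockIdx d b) * 200))) ?_ (by lia) fun _ => id
    refine Reach.setReg_seq (by lia) ?_
    refine Reach.seq (reach_coef (h := 2 ^ (d - blockIdx d b)) (lam := weight d w b)
      (A := inputTable d a w b) (B := layerTable K d a w b) ht hq (by lia)
      ⟨?_, fun x hx => ?_, fun x hx => ?_⟩ ?_ ?_ ?_) ?_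
    · simp [State.write, hF.size]
    · simp (disch := lia) only [State.write, Function.update_of_ne]
      exact hF.input x hx
    · simp (disch := lia) only [State.write, Function.update_of_ne]
      exact hF.layer x hx
    · simp [State.write, Exp.eval, eval_div, hF.size]
    · simp [State.write, hs.weight]
    · simp [State.write, h8]
    rintro u ⟨hu, hu'⟩
    refine (reach_eval (i := blockIdx d b) (ρ := point d w b) hq (by lia) hh hdq ?_ ?_
      (fun j hj => ?_) hu).mono le_rfl ?_
    · rw [hu' 12 (by lia) (by lia)]; simp [State.write, Exp.eval, eval_div, hF.size]
    · rw [hu' 14 (by lia) (by lia)]; simp [State.write, h14]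
    · rw [hu' _ (by lia) (by lia)]
      simp (disch := lia) only [State.write, Function.update_of_ne]
      exact hs.point j hj
    · rintro r ⟨hr, hr'⟩
      have hrs : ∀ a, a ∉ [0, 11, 12, 13, 16] → (a < 100 ∨ a % 8 ≠ 7) → r.mem a = s.mem a := by
        intro a ha ha'
        simp at ha
        rw [hr' a (by simp; lia) ha', hu' a (by lia) ha']
        simp (disch := lia) only [State.write, Function.update_of_ne]
      exact ⟨hr, hs.frame fun a ha ha' => hrs a (by simp at ha ⊢; lia) ha',
        (hrs 8 (by simp) (by lia)).trans h8⟩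

/-! ### The rounds of the prover -/

/-- The memory of the prover before round `T`, if it gets the word `w b` after block `b`. -/
def AnswerInv (K d : ℕ) (a w : ℕ → ZMod q) (T : ℕ) (s : State) : Prop :=
  if T = 0 then ProverReady K d a s else BlockInv K d a w ((T - 1) / 5) s ∧ s.mem 8 = T % 5

/-- A bound for the time of the prover in a round. -/
def answerTime (K d T : ℕ) : ℕ :=
  500 + 2 ^ (d + 1 - blockIdx d (T / 5)) * 800 + if T = 0 then (K + 1) * 2 ^ d * 500 else 0

/-- The word that ends a block arrives with the first round of the next one, so the tables are
advanced exactly when 5 divides T. Only these words are used, hence the form of `hw`. -/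
theorem reach_answer {T : ℕ} {v : ZMod q} (hq : 200 < q ^ 2)
    (hh : (K + 1) * 2 ^ d * 16 + 200 < q ^ 2) (hdq : d * 8 + 200 < q ^ 2)
    (hw : ∀ b, T = 5 * (b + 1) → v = w b) (hs : AnswerInv K d a w T s) :
    Reach q (q ^ 2) prover.respond (s.input v.val 0) (answerTime K d T) fun r =>
      r.mem 0 = (honest K d a w (T / 5) (T % 5)).val ∧ AnswerInv K d a w (T + 1) r := by
  have hDK : 2 ^ d ≤ (K + 1) * 2 ^ d := Nat.le_mul_of_pos_left _ (by lia)
  have hin : ∀ a, a ∉ [0, 1] → (s.input v.val 0).mem a = s.mem a := by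
    intro a ha
    simp at ha
    simp (disch := lia) only [State.input, State.write, Function.update_of_ne]
  have hmode : s.mem 3 = 2 := by
    rw [AnswerInv] at hs
    split_ifs at hs with hT
    exacts [hs.base.mode, hs.1.base.mode]
  have h8 : s.mem 8 = T % 5 := by
    rw [AnswerInv] at hs
    split_ifs at hs with hT
    exacts [by rw [hs.round, hT], hs.2]
  set S := 2 ^ (d + 1 - blockIdx d (T / 5)) with hS
  set U := if T = 0 then (K + 1) * 2 ^ d * 500 else 0 with hU
  refine Reach.mono (T := 6 + ((3 + (3 + (200 + S * 200 + U))) + ((200 + S * 600) + 20))) ?_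
    (by rw [answerTime]; lia) fun _ => id
  refine Reach.branch (fun _ => ?_) fun hb => ?_
  swap
  · simp [Exp.eval, eval_eq, hin, hmode] at hb
  refine Reach.seq (P := fun r => BlockInv K d a w (T / 5) r ∧ r.mem 8 = T % 5) ?_ ?_
  · refine Reach.branch (fun hb => ?_) fun hb => ?_
    · have hT : T % 5 ≠ 0 := by simpa [Exp.eval, hin, h8] using hb
      refine (Reach.step (c := .skip) (T := 1) ?_).mono (by lia) fun _ => id
      -- The invariant refers to the block of round T - 1; inside a block this is also the block of
      -- round T.
      rw [AnswerInv, if_neg (by lia)] at hs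
      rw [show (T - 1) / 5 = T / 5 by lia] at hs
      refine ⟨hs.1.frame fun a ha ha' => hin a ?_, (hin 8 (by simp)).trans hs.2⟩
      simp at ha ⊢
      lia
    · have hT : T % 5 = 0 := by simpa [Exp.eval, hin, h8] using hb
      refine Reach.branch (fun hb => ?_) fun hb => ?_
      · simp only [Exp.eval, hin 15 (by simp)] at hb
        have hT0 : T ≠ 0 := by
          rintro rfl
          rw [AnswerInv, if_pos rfl] at hs
          exact hb hs.started
        rw [AnswerInv, if_neg hT0] at hs
        have hT1 : (T - 1) / 5 + 1 = T / 5 := by lia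
        have hadv := reach_advance (b := (T - 1) / 5) (s := s.input v.val 0) (w := w) (a := a)
          (K := K) (d := d) hq hh hdq (hs.1.frame fun a ha _ => hin a (by simp at ha ⊢; lia))
          (by simp [State.input, State.write, hw ((T - 1) / 5) (by lia)])
        rw [hT1] at hadv
        exact hadv.mono (by lia) fun r hr => ⟨hr.1, by rw [hr.2, hin 8 (by simp), hs.2]⟩
      · simp only [Exp.eval, hin 15 (by simp)] at hb
        have hT0 : T = 0 := by
          by_contra hT0
          rw [AnswerInv, if_neg hT0] at hs
          have := hs.1.started
          lia
        subst hT0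
        rw [AnswerInv, if_pos rfl] at hs
        refine (reach_start (w := w) hq hh (K := K) (d := d) (a := a)
          ⟨hs.base.frame fun a ha _ => hin a ?_, ?_, ?_, ?_, ?_, ?_, ?_, fun j hj => ?_⟩).mono ?_ ?_
        · simp at ha ⊢; lia
        · rw [hin 5 (by simp), hs.layer]
        · rw [hin 14 (by simp), hs.idx]
        · rw [hin 10 (by simp), hs.weight]
        · rw [hin 15 (by simp), hs.started]
        · rw [hin 8 (by simp), hs.round]
        · rw [hin 17 (by simp), hs.half]
        · rw [hin _ (by simp), hs.point j hj]
        · rw [hU, if_pos rfl]; lia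
        · exact fun r hr => hr
  · rintro u ⟨hu, hu8⟩
    refine Reach.seq (reach_message (t := T % 5) (by lia) hq (by lia) hdq hu hu8) ?_
    rintro r ⟨hr0, hr, hr8⟩
    refine Reach.step ⟨by simp [Exp.eval]; lia, ?_, ?_⟩
    · simp [State.write, Exp.eval, hr0]
    · rw [AnswerInv, if_neg (by lia), Nat.add_sub_cancel]
      refine ⟨hr.frame fun a ha _ => ?_, ?_⟩
      · simp at ha
        simp (disch := lia) only [State.write, Exp.eval, Function.update_of_ne]
      · have : (T % 5 + 1) % 5 = (T + 1) % 5 := by lia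
        simp only [State.write, Exp.eval, Function.update_self, hr8]
        rw [eval_add_of_lt (by lia), eval_mod, this]

end Message

/-! ### The prover during the stream, and its answers in the two modes without layers. -/

section ProverObserves

variable {n m q k : ℕ} [Fact q.Prime] {x : DataStream n}

theorem prover_pass {s : State} (hx : x.length = m) (hn : n < q) (hq : 4096 ≤ q)
    (h3 : s.mem 3 ≠ 0) (hs : ∀ i, s.mem (i * 8 + 100) = 0) :
    ∃ t r, Pass q (q ^ 2) prover.update x s t r ∧ t ≤ m * 60 ∧
      (∀ i, r.mem (i * 8 + 100) = (table q x i).val) ∧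
      ∀ a, a ∉ [0, 1] → (a < 100 ∨ a % 8 ≠ 4) → r.mem a = s.mem a := by
  have hqq : 4096 * q ≤ q ^ 2 := by nlinarith
  have key := Pass.of_invariant (q := q) (M := q ^ 2) (c := prover.update) (fun y r =>
    (∀ i, r.mem (i * 8 + 100) = (table q y i).val) ∧
      ∀ a, a ∉ [0, 1] → (a < 100 ∨ a % 8 ≠ 4) → r.mem a = s.mem a) 60 ?_ x [] s ?_
  · obtain ⟨t, r, h₁, h₂, h₃⟩ := key
    exact ⟨t, r, h₁, hx ▸ h₂, h₃⟩
  · rintro y i δ r ⟨hT, hr⟩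
    have hi := i.2
    refine Reach.mono (T := 3 + 40) ?_ (by lia) fun _ => id
    refine Reach.branch (fun hb => Reach.step ?_) fun hb => ?_
    · have e1 : (r.input i (δ : ZMod q).val).mem 1 = (δ : ZMod q).val := by
        simp [State.input, State.write]
      have e0 : (r.input i (δ : ZMod q).val).mem 0 = i := by simp [State.input, State.write]
      have er : ∀ a, 2 ≤ a → (r.input i (δ : ZMod q).val).mem a = r.mem a := fun a ha => by
        simp (disch := lia) [State.input, State.write]
      simp (disch := lia) only [Cmd.wp, Exp.eval, e0, e1, eval_mul_of_lt, eval_add_of_lt,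
        er (i * 8 + 100) (by lia), hT, eval_fadd, ZMod.natCast_zmod_val, State.write]
      refine ⟨by lia, fun j => ?_, fun a ha ha' => ?_⟩
      · rw [table_append, Pi.add_apply, Pi.single_apply]
        by_cases hij : j = i
        · subst hij; simp
        · rw [Function.update_of_ne (by lia), er _ (by lia), hT j, if_neg hij, add_zero]
      · simp at ha
        rw [Function.update_of_ne (by lia), er _ (by lia), hr a (by simp; lia) ha']
    · exfalso
      simp [Exp.eval, State.input, State.write, hr 3, h3] at hb
  · exact ⟨fun i => by simp [hs, table_nil], fun _ _ _ => rfl⟩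

/-- The memory of the prover after the stream, if it is going to list the frequencies. -/
structure ProverList (n q T : ℕ) (f : ℕ → ZMod q) (s : State) : Prop where
  mode : s.mem 3 = 1
  idx : s.mem 7 = T
  input : ∀ i, s.mem (i * 8 + 100) = (f i).val

theorem prover_observes (hx : x.length = m) (hn : n < q) (hn2 : 2 ≤ n) (hq : 4096 ≤ q)
    (hk : q = 2 ^ k - 1) :
    ∃ t s, prover.Observes q (q ^ 2) [] x t s ∧
      t ≤ 100 + Nat.clog 2 n * 200 + n * 100 + m * 60 ∧
      (k < n → ProverReady (k - 1) (Nat.clog 2 n) (table q x) s) ∧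
      (¬ k < n → ProverList n q 0 (table q x) s) := by
  set d := Nat.clog 2 n with hd
  have hdn := clog_le_self n
  have hqq : 4096 * q ≤ q ^ 2 := by nlinarith
  have hodd : q % 2 = 1 := by
    rcases (Fact.out : q.Prime).eq_two_or_odd with h | h <;> lia
  let J : ℕ → State → Prop := fun j s => (∀ i < j, s.mem (i * 8 + 104) = (1 / 2 : ZMod q).val) ∧
    ∀ i, s.mem (i * 8 + 100) = 0
  have hJ : ∀ j s s', (∀ a, 100 ≤ a → s'.mem a = s.mem a) → s'.tape = s.tape → J j s → J j s' := by
    rintro j s s' hs - ⟨h₁, h₂⟩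
    exact ⟨fun i hi => by rw [hs _ (by lia), h₁ i hi], fun i => by rw [hs _ (by lia), h₂ i]⟩
  have hc : ∀ j < d, ∀ s, s.mem 4 = j → s.mem 17 = (q + 1) / 2 → J j s →
      Reach q (q ^ 2) (.set (.cell 104 (.reg 4)) (.reg 17)) s 20
        fun r => J (j + 1) r ∧ ∀ a < 100, r.mem a = s.mem a := by
    rintro j hj s h4 h17 ⟨h₁, h₂⟩
    refine Reach.step ?_
    simp (disch := lia) only [Cmd.wp, Exp.eval, State.write, h4, h17, eval_mul_of_lt,
      eval_add_of_lt]
    refine ⟨by lia, ⟨fun i hi => ?_, fun i => ?_⟩, fun a ha => ?_⟩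
    · by_cases hij : i = j
      · subst hij
        simp only [Function.update_self, half_val hodd]
      · simp (disch := lia) only [Function.update_of_ne]
        exact h₁ i (by lia)
    · simp (disch := lia) only [Function.update_of_ne]
      exact h₂ i
    · simp (disch := lia) only [Function.update_of_ne]
  obtain ⟨t, s, h₁, h₂, hI, hJ⟩ := reach_init (M := q ^ 2) (T := 20) (k := k) (l := [])
    (c := .set (.cell 104 (.reg 4)) (.reg 17)) J hn hn2 hq hk
    (by lia) hJ hc ⟨fun i hi => by lia, fun i => rfl⟩
  obtain ⟨t', r, h₁', h₂', hT, hr⟩ := prover_pass (s := s) hx hn hq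
    (by rw [hI.mode]; split_ifs <;> lia) hJ.2
  refine ⟨t + t', r, ⟨s, t, t', h₁, h₁', rfl⟩, by rw [← hd] at h₂; lia, fun hkn => ?_,
    fun hkn => ?_⟩
  · constructor
    case base =>
      exact ⟨by rw [hr 3 (by simp) (by lia), hI.mode, if_pos hkn],
        by rw [hr 4 (by simp) (by lia), hI.bits], by rw [hr 6 (by simp) (by lia), hI.size],
        fun i _ => hT i⟩
    case layer => rw [hr 5 (by simp) (by lia), hI.layers hkn]
    case idx => rw [hr 14 (by simp) (by lia), hI.idx hkn]
    case weight => rw [hr 10 (by simp) (by lia), hI.rest 10 (by lia) (by simp)]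
    case started => rw [hr 15 (by simp) (by lia), hI.rest 15 (by lia) (by simp)]
    case round => rw [hr 8 (by simp) (by lia), hI.rest 8 (by lia) (by simp)]
    case half => rw [hr 17 (by simp) (by lia), hI.half, half_val hodd]
    case point => exact fun j hj => by rw [hr _ (by simp) (by lia), hJ.1 j hj]
  · exact ⟨by rw [hr 3 (by simp) (by lia), hI.mode, if_neg hkn],
      by rw [hr 7 (by simp) (by lia), hI.rest 7 (by lia) (by simp)], hT⟩

theorem ProverList.reach {T : ℕ} {f : ℕ → ZMod q} {s : State} {w : ZMod q} (hT : T < q)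
    (hq : 4096 ≤ q) (h : ProverList n q T f s) :
    Reach q (q ^ 2) prover.respond (s.input w.val 0) 40 fun r =>
      r.mem 0 = (f T).val ∧ ProverList n q (T + 1) f r := by
  have hqq : 4096 * q ≤ q ^ 2 := by nlinarith
  obtain ⟨h3, h7, hf⟩ := h
  have er : ∀ a, 2 ≤ a → (s.input w.val 0).mem a = s.mem a := fun a ha => by
    simp (disch := lia) [State.input, State.write]
  refine Reach.mono (T := 6 + (3 + 25)) ?_ (by lia) fun _ => id
  refine Reach.branch (fun hb => ?_) fun _ => Reach.branch (fun _ => Reach.step ?_) fun hb => ?_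
  · simp [Exp.eval, eval_eq, er, h3] at hb
  · simp (disch := lia) only [Cmd.wp, Exp.eval, er, h7, eval_mul_of_lt, eval_add_of_lt, hf,
      State.write, Function.update_of_ne]
    refine ⟨by lia, by lia, by simp, ⟨?_, ?_, fun i => ?_⟩⟩
    · simp [er, h3]
    · simp
    · simp (disch := lia) only [Function.update_of_ne, er, hf]
  · simp [Exp.eval, er, h3] at hb

/-- In this mode the messages have no effect, so the prover merely echoes. It is given 100 cells
because `q ^ 2` may be less than what the initialization needs. -/
theorem prover_respond_small {s : State} {w : ZMod q} (h : s.mem 3 = 0) :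
    Reach q 100 prover.respond (s.input w.val 0) 40 fun r => r.mem 0 = w.val ∧ r.mem 3 = 0 := by
  have er : ∀ a, 2 ≤ a → (s.input w.val 0).mem a = s.mem a := fun a ha => by
    simp (disch := lia) [State.input, State.write]
  refine Reach.mono (T := 6 + (3 + 1)) ?_ (by lia) fun _ => id
  refine Reach.branch (fun hb => ?_) fun _ => Reach.branch (fun hb => ?_) fun _ => Reach.step ?_
  · simp [Exp.eval, eval_eq, er, h] at hb
  · simp [Exp.eval, er, h] at hb
  · exact ⟨by simp [State.input, State.write], by rw [er 3 (by lia), h]⟩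

theorem prover_observes_small (hx : x.length = m) (hq : q < 4096) :
    ∃ t s, prover.Observes q 100 [] x t s ∧ t ≤ 100 + m * 10 ∧ s.mem 3 = 0 := by
  obtain ⟨t, s, h₁, h₂, -, -, hs⟩ := reach_init_small (n := n) (M := 100) (l := [])
    (c := .set (.cell 104 (.reg 4)) (.reg 17)) hq (by lia)
  obtain ⟨t', r, h₁', h₂', hr⟩ := Pass.of_invariant (q := q) (M := 100) (c := prover.update)
    (fun _ (r : State) => r.mem 3 = 0) 10 (fun y i δ r h3 => by
      refine Reach.mono (T := 3 + 1) (Reach.branch (fun hb => ?_) fun hb => Reach.step ?_)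
        (by lia) fun _ => id
      · simp [Exp.eval, State.input, State.write, h3] at hb
      · simpa [Cmd.wp, State.input, State.write] using h3) x [] s (hs 3 (by lia))
  exact ⟨t + t', r, ⟨s, t, t', h₁, h₁', rfl⟩, by lia, hr⟩

end ProverObserves

/-! ### The words that the verifier sends. -/

section Words

variable {F : Type*} [Zero F]

/-- The answer of the verifier at the end of block `b`, with the random elements `R`. -/
def coin (K d : ℕ) (R : ℕ → F) (b : ℕ) : F :=
  if blockLayer K d b = 0 ∧ blockIdx d b ≠ d + 1 then R (blockIdx d b - 1)
  else R (d + (5 * b + 4))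

/-- What the prover gets in round `T`, with the random elements `R`. -/
def word (K d : ℕ) (R : ℕ → F) : ℕ → F
  | 0 => 0
  | T + 1 => if T % 5 = 4 then coin K d R (T / 5) else R (d + T)

theorem word_block (K d : ℕ) (R : ℕ → F) (b : ℕ) : word K d R (5 * (b + 1)) = coin K d R b := by
  have h₁ : (5 * b + 4) % 5 = 4 := by lia
  have h₂ : (5 * b + 4) / 5 = b := by lia
  rw [show 5 * (b + 1) = 5 * b + 4 + 1 by lia, word, if_pos h₁, h₂]

end Words

/-! ### Whole conversations in the three modes, for any prover that satisfies an invariant. -/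

section Conversations

variable {q : ℕ} [Fact q.Prime] {S : Type} {next : S → ZMod q → ZMod q → ℕ → S → Prop}
  {n k M : ℕ} {f : ℕ → ZMod q} {s : State} {p : S} {PI : ℕ → S → Prop} {TP : ℕ → ℕ}
  {v : ℕ → ZMod q}

/-- The number of rounds of the layered protocol. -/
def rounds (K d : ℕ) : ℕ := 5 * (K * (d + 1) + 1)

open Classical in
-- Stated for an abstract prover relation and a given sequence `v` of messages, so that it serves
-- both the honest machine and arbitrary strategies.
theorem interact_layered {K L : ℕ} {R : Fin L → ZMod q} (hn : n < q) (hq : 4096 ≤ q)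
    (hkn : k < n) (hK : K = k - 1)
    (hL : L = Nat.clog 2 n + rounds K (Nat.clog 2 n)) (hM : 2 * Nat.clog 2 n + 200 ≤ M)
    (hs : ReadyInv n q k (coins R) (extend R) f s)
    (hP : ∀ T < rounds K (Nat.clog 2 n), ∀ p, PI T p → ∃ t p',
      next p (word K (Nat.clog 2 n) (extend R) T) (v T) t p' ∧ t ≤ TP T ∧ PI (T + 1) p')
    (hp : PI 0 p) :
    ∃ tV tP, Interact q M verifier.respond next s p 0
      (if accepts K (Nat.clog 2 n) f (extend R) (coin K (Nat.clog 2 n) (extend R))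
        (fun b t => v (5 * b + t)) then some (2 ^ Nat.clog 2 n * v 0 : ZMod q).val else none)
      tV tP (rounds K (Nat.clog 2 n)) ∧ tV ≤ rounds K (Nat.clog 2 n) * 300 ∧
      tP ≤ ∑ T ∈ Finset.range (rounds K (Nat.clog 2 n)), TP T := by
  set d := Nat.clog 2 n with hd
  have hdn := clog_le_self n
  let out : Option ℕ :=
    if accepts K d f (extend R) (coin K d (extend R)) (fun b t => v (5 * b + t)) then
      some (2 ^ d * v 0 : ZMod q).val else none
  let VI : ℕ → State → Prop := fun T s => LayeredInv K d (coins R) (extend R) f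
    (coin K d (extend R)) (fun b t => v (5 * b + t)) (T / 5) (T % 5) s
  have hV : ∀ T < rounds K d, ∀ s, VI T s →
      Reach q M verifier.respond (s.input (v T).val 0) 300 fun r =>
        (T + 1 < rounds K d → r.mem 1 = 0 ∧
          (r.mem 0 : ZMod q) = word K d (extend R) (T + 1) ∧ VI (T + 1) r) ∧
        (T + 1 = rounds K d → r.mem 1 ≠ 0 ∧ verdict r = out) := by
    intro T hT s hs
    exact reach_round (R := extend R) (μ := v) (by lia) hq (by lia) hT
      (fun i hi => drop_coins R (by rw [hL]; exact hi)) (fun _ _ => rfl) (fun _ _ => rfl) hs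
  have h0 : VI 0 s := by
    simp only [VI, hK]
    exact ReadyInv.layered hkn hs
  obtain ⟨tV, tP, h₁, h₂, h₃⟩ := Interact.of_invariant (word K d (extend R)) v out
    (fun _ => 300) TP VI PI (by rw [rounds]; lia) hP hV h0 hp
  exact ⟨tV, tP, h₁, by simpa using h₂, h₃⟩

theorem interact_remote {L : ℕ} {R : Fin L → ZMod q} (hn : n < q) (hn2 : 2 ≤ n) (hq : 4096 ≤ q)
    (hkn : ¬ k < n) (hM : 100 ≤ M) (hs : ReadyInv n q k (coins R) (extend R) f s)
    (hP : ∀ T < n, ∀ p, PI T p → ∃ t p', next p 0 (v T) t p' ∧ t ≤ TP T ∧ PI (T + 1) p')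
    (hp : PI 0 p) :
    ∃ tV tP, Interact q M verifier.respond next s p 0
      (if mle (extend R) (Nat.clog 2 n) (residual f v n) = 0 then some (countNonzero v n)
        else none) tV tP n ∧ tV ≤ n * (200 + Nat.clog 2 n * 60) ∧
      tP ≤ ∑ T ∈ Finset.range n, TP T := by
  obtain ⟨tV, tP, h₁, h₂, h₃⟩ := Interact.of_invariant (k := n) (q := q) (M := M)
    (c := verifier.respond) (next := next) 0 v _ (fun _ => 200 + Nat.clog 2 n * 60) TP
    (fun T s => RemoteInv n q (Nat.clog 2 n) (extend R) f v T s) PI (by lia) hP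
    (fun T hT s hs => reach_remote hM hn (two_mul_clog_lt hn hq)
      (Nat.le_pow_clog (by lia) n) hT hs) (s := s) (p := p) (hs.remote hkn) hp
  exact ⟨tV, tP, h₁, by simpa using h₂, h₃⟩

theorem interact_local (hn : n < q) (hn2 : 2 ≤ n) (hq : q < 4096) (hM : 6000 ≤ M)
    {c : ℕ → ZMod q} (hs : LocalInv n q v 0 s)
    (hP : ∀ T < n, ∀ p, PI T p → ∃ t p', next p 0 (c T) t p' ∧ t ≤ TP T ∧ PI (T + 1) p')
    (hp : PI 0 p) :
    ∃ tV tP, Interact q M verifier.respond next s p 0 (some (countNonzero v n)) tV tP n ∧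
      tV ≤ n * 200 ∧ tP ≤ ∑ T ∈ Finset.range n, TP T := by
  obtain ⟨tV, tP, h₁, h₂, h₃⟩ := Interact.of_invariant (k := n) (q := q) (M := M)
    (c := verifier.respond) (next := next) 0 c (some (countNonzero v n)) (fun _ => 200) TP
    (fun T s => LocalInv n q v T s) PI (by lia) hP
    (fun T hT s hs => reach_local hM hn hq hT hs) (s := s) (p := p) hs hp
  exact ⟨tV, tP, h₁, by simpa using h₂, h₃⟩

/-- The messages of a strategy, if the words are `w 0, w 1, …`. -/
def replies (σ : List (ZMod q) → ZMod q) (w : ℕ → ZMod q) (T : ℕ) : ZMod q :=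
  σ ((List.range (T + 1)).map w)

theorem strategyNext_replies (σ : List (ZMod q) → ZMod q) (w : ℕ → ZMod q) (T : ℕ)
    (p : List (ZMod q)) (hp : p = (List.range T).map w) :
    ∃ t p', strategyNext σ p (w T) (replies σ w T) t p' ∧ t ≤ 0 ∧
      p' = (List.range (T + 1)).map w := by
  have : (List.range (T + 1)).map w = p ++ [w T] := by rw [hp, List.range_succ, List.map_append]; rfl
  exact ⟨0, p ++ [w T], ⟨rfl, by rw [replies, this], rfl⟩, le_rfl, this.symm⟩

end Conversations

/-! ### The time of the honest prover -/

/-- A potential argument: the left side never increases. A halving step pays its new size from the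
current one, and a new layer costs 2^d + 2^d, released by the drop of the layer counter. -/
theorem sum_block_size_le (K d b : ℕ) (hb : b ≤ K * (d + 1)) :
    ∑ b' ∈ Finset.range (b + 1), 2 ^ (d + 1 - blockIdx d b') + 2 ^ (d + 1 - blockIdx d b) +
      blockLayer K d b * 2 ^ (d + 1) ≤ 2 + K * 2 ^ (d + 1) := by
  induction b with
  | zero => simp [blockIdx, blockLayer]
  | succ b ih =>
    have ih := ih (by lia)
    have h1 := one_le_blockIdx d b
    have h1' := blockIdx_le d b
    rw [Finset.sum_range_succ, blockIdx, blockLayer]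
    split_ifs with hi
    · have := blockLayer_pos (K := K) (by lia) hi
      obtain ⟨l, hl⟩ := Nat.exists_eq_succ_of_ne_zero this.ne'
      rw [hl] at ih ⊢
      have h2 : 2 ^ (d + 1) = 2 * 2 ^ d := pow_succ' 2 d
      rw [Nat.add_sub_cancel, Nat.succ_sub_one]
      rw [Nat.succ_mul] at ih
      lia
    · have h2 : 2 ^ (d + 1 - blockIdx d b) = 2 * 2 ^ (d + 1 - (blockIdx d b + 1)) := by
        rw [← pow_succ']; congr 1; lia
      lia

theorem sum_range_five_mul (f : ℕ → ℕ) (n : ℕ) :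
    ∑ T ∈ Finset.range (5 * n), f (T / 5) = 5 * ∑ b ∈ Finset.range n, f b := by
  induction n with
  | zero => simp
  | succ n ih =>
    rw [show 5 * (n + 1) = 5 * n + 1 + 1 + 1 + 1 + 1 by lia]
    simp only [Finset.sum_range_succ, ih]
    rw [show 5 * n / 5 = n by lia, show (5 * n + 1) / 5 = n by lia,
      show (5 * n + 1 + 1) / 5 = n by lia, show (5 * n + 1 + 1 + 1) / 5 = n by lia,
      show (5 * n + 1 + 1 + 1 + 1) / 5 = n by lia]
    ring

theorem sum_answerTime_le (K d : ℕ) :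
    ∑ T ∈ Finset.range (rounds K d), answerTime K d T ≤ (K + 1) * 2 ^ d * 20000 := by
  have h := sum_block_size_le K d (K * (d + 1)) le_rfl
  rw [blockIdx_last, blockLayer_last] at h
  have h2 : 2 ^ (d + 1) = 2 * 2 ^ d := pow_succ' 2 d
  have h3 : ∑ T ∈ Finset.range (rounds K d), answerTime K d T =
      rounds K d * 500 + 5 * ((∑ b ∈ Finset.range (K * (d + 1) + 1),
        2 ^ (d + 1 - blockIdx d b)) * 800) + (K + 1) * 2 ^ d * 500 := by
    simp only [answerTime, Finset.sum_add_distrib]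
    rw [Finset.sum_ite_eq' (Finset.range _), if_pos (by simp [rounds]), Finset.sum_const,
      Finset.card_range, smul_eq_mul, rounds,
      sum_range_five_mul (fun b => 2 ^ (d + 1 - blockIdx d b) * 800), Finset.sum_mul]
  rw [h3, rounds]
  have h4 : d + 1 ≤ 2 ^ d := Nat.lt_two_pow_self
  have h5 : K * (d + 1) ≤ K * 2 ^ d := Nat.mul_le_mul_left K h4
  rw [h2] at h
  have h6 : (K + 1) * 2 ^ d = K * 2 ^ d + 2 ^ d := by ring
  have h7 : K * (2 * 2 ^ d) = 2 * (K * 2 ^ d) := by ring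
  lia

/-! ### Probabilities -/

section Prob

open Classical in
/-- If a set has few elements on each line in the direction `j`, it is small. -/
theorem ncard_mul_card_le {F : Type*} [Fintype F] {L D : ℕ} (j : Fin L) (S : Set (Fin L → F))
    (h : ∀ R, {u | Function.update R j u ∈ S}.ncard ≤ D) :
    S.ncard * Fintype.card F ≤ D * Fintype.card F ^ L := by
  let P : Finset (Σ _ : Fin L → F, F) :=
    Finset.univ.sigma fun R => Finset.univ.filter fun u => Function.update R j u ∈ S
  have h₁ : S.ncard * Fintype.card F ≤ P.card := by
    rw [Set.ncard_eq_toFinset_card', ← Finset.card_univ, ← Finset.card_product]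
    -- Double counting: exchanging coordinate j with the extra element is injective, and putting the
    -- old coordinate back recovers the point of `S`.
    refine Finset.card_le_card_of_injOn (fun x => ⟨Function.update x.1 j x.2, x.1 j⟩)
      (fun x hx => ?_) fun x _ y _ hxy => ?_
    · simp only [Finset.coe_product, Set.mem_prod, Finset.mem_coe, Set.mem_toFinset] at hx
      simp [P, hx.1]
    · obtain ⟨x₁, x₂⟩ := x
      obtain ⟨y₁, y₂⟩ := y
      simp only [Sigma.mk.injEq, heq_eq_eq] at hxy
      obtain ⟨h₁, h₂⟩ := hxy
      have e₂ : x₂ = y₂ := by simpa using congrFun h₁ j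
      have e₁ : x₁ = y₁ := by
        funext i
        by_cases hi : i = j
        · rw [hi, h₂]
        · simpa [hi] using congrFun h₁ i
      rw [e₁, e₂]
  have h₂ : P.card ≤ D * Fintype.card F ^ L := by
    rw [Finset.card_sigma]
    refine (Finset.sum_le_card_nsmul _ _ D fun R _ => ?_).trans ?_
    · refine le_trans (le_of_eq ?_) (h R)
      rw [Set.ncard_eq_toFinset_card']
      congr 1
      ext u
      simp
    · simp [mul_comm]
  exact h₁.trans h₂

/-- The union bound: N events of probability at most D / q each, with 3 N D ≤ q. -/
theorem prob_le_third {q L N D : ℕ} [Fact q.Prime] {E : Set (Fin L → ZMod q)}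
    (S : ℕ → Set (Fin L → ZMod q)) (hE : ∀ R ∈ E, ∃ b < N, R ∈ S b)
    (hS : ∀ b < N, (S b).ncard * q ≤ D * q ^ L) (hq : 3 * (N * D) ≤ q) : prob E ≤ 1 / 3 := by
  have hq0 := (Fact.out : q.Prime).pos
  have h₁ : E.ncard ≤ ∑ b ∈ Finset.range N, (S b).ncard := by
    have hsub : E ⊆ ⋃ b ∈ Finset.range N, S b := fun R hR => by
      obtain ⟨b, hb, hR⟩ := hE R hR
      simp only [Finset.mem_range, Set.mem_iUnion]
      exact ⟨b, hb, hR⟩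
    exact (Set.ncard_le_ncard hsub (Set.toFinite _)).trans (Finset.set_ncard_biUnion_le _ _)
  have h₂ : E.ncard * q ≤ N * D * q ^ L := by
    calc E.ncard * q ≤ (∑ b ∈ Finset.range N, (S b).ncard) * q := Nat.mul_le_mul_right q h₁
      _ = ∑ b ∈ Finset.range N, (S b).ncard * q := Finset.sum_mul _ _ _
      _ ≤ ∑ b ∈ Finset.range N, D * q ^ L :=
        Finset.sum_le_sum fun b hb => hS b (Finset.mem_range.mp hb)
      _ = N * D * q ^ L := by simp [mul_assoc]
  have h₃ : E.ncard * 3 ≤ q ^ L := by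
    have : E.ncard * 3 * q ≤ q ^ L * q := by
      calc E.ncard * 3 * q = 3 * (E.ncard * q) := by ring
        _ ≤ 3 * (N * D * q ^ L) := Nat.mul_le_mul_left 3 h₂
        _ = 3 * (N * D) * q ^ L := by ring
        _ ≤ q * q ^ L := Nat.mul_le_mul_right _ hq
        _ = q ^ L * q := by ring
    exact Nat.le_of_mul_le_mul_right this hq0
  have h₄ : (0 : ℝ) < (q : ℝ) ^ L := by positivity
  rw [prob, div_le_iff₀ h₄]
  have h₅ : (E.ncard : ℝ) * 3 ≤ (q : ℝ) ^ L := by exact_mod_cast h₃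
  linarith

theorem prob_univ {q L : ℕ} [Fact q.Prime] {E : Set (Fin L → ZMod q)} (h : ∀ R, R ∈ E) :
    prob E = 1 := by
  have hq0 := (Fact.out : q.Prime).pos
  rw [Set.eq_univ_of_forall h, prob, Set.ncard_univ, Nat.card_eq_fintype_card, Fintype.card_fun,
    Fintype.card_fin, ZMod.card]
  push_cast
  exact div_self (by positivity)

end Prob

/-! ### The number of distinct items -/

section Count

variable {q n k d : ℕ} [Fact q.Prime] {x : DataStream n}

theorem countNonzero_table (h : NoOverflow q x) : countNonzero (table q x) n = distinct x := by
  rw [distinct_eq h, countNonzero]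

/-- The only place where the Mersenne form meets Fermat's little theorem: the exponent of this layer
is q - 1. -/
theorem layer_last (hk : q = 2 ^ (k + 1) - 1) (a : ℕ → ZMod q) (y : ℕ) :
    layer a k y = if a y = 0 then 0 else 1 := by
  have hq := (Fact.out : q.Prime).two_le
  rw [layer_eq, show 2 ^ (k + 1) - 2 = q - 1 by lia]
  split_ifs with h
  · rw [h, zero_pow (by lia)]
  · exact ZMod.pow_card_sub_one_eq_one h

/-- The padding of the table up to 2^d contributes zeros, and the count is at most n < q, so its
residue is the count itself. Oddness of q makes 1/2 meaningful. -/
theorem two_pow_mul_mle_layer (h : NoOverflow q x) (hn : n < q) (hnd : n ≤ 2 ^ d) (hq : 2 < q)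
    (hk : q = 2 ^ (k + 1) - 1) :
    (2 ^ d * mle (fun _ => 1 / 2) d (layer (table q x) k) : ZMod q).val = distinct x := by
  have h2 : (2 : ZMod q) ≠ 0 := by
    have h2' : ((2 : ℕ) : ZMod q) ≠ 0 := by
      rw [Ne, ZMod.natCast_eq_zero_iff]
      intro hdvd
      have := Nat.le_of_dvd (by lia) hdvd
      lia
    exact_mod_cast h2'
  have hsum : ∑ y ∈ Finset.range (2 ^ d), layer (table q x) k y = (countNonzero (table q x) n : ℕ) := by
    rw [countNonzero, Finset.card_filter, Nat.cast_sum]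
    rw [← Finset.sum_subset (Finset.range_subset_range.mpr hnd)]
    · refine Finset.sum_congr rfl fun y _ => ?_
      rw [layer_last hk]
      split_ifs <;> simp_all
    · intro y _ hy
      rw [layer_last hk, if_pos]
      rw [Finset.mem_range] at hy
      rw [table, dif_neg hy]
  rw [two_pow_mul_mle_half h2, hsum, countNonzero_table h, ZMod.val_natCast, Nat.mod_eq_of_lt]
  rw [← countNonzero_table h]
  exact (countNonzero_le _ _).trans_lt hn

end Count

/-! ### Soundness of the layered protocol -/

section Soundness

variable {q K d : ℕ} [Fact q.Prime] {a : ℕ → ZMod q}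

/-- By `point_last` the final point is the secret one, so the final test checks the last claims
against their true values. Without collisions this correctness propagates back to the opening claim.
-/
theorem accepts_sound {f z w : ℕ → ZMod q} {m : ℕ → ℕ → ZMod q} (hK : 0 < K)
    (hw : ∀ b < K * (d + 1), blockLayer K d b = 0 ∧ blockIdx d b ≠ d + 1 →
      w b = z (blockIdx d b - 1))
    (h : accepts K d f z w m) (hc : ∀ b < K * (d + 1), ¬ Collision K d f w m b) :
    m 0 0 = mle (fun _ => 1 / 2) d (layer f K) := by
  obtain ⟨h₁, h₂, h₃⟩ := h
  have hp := point_last (w := w) (z := z) (d := d) hK fun b hb hl =>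
    hw b hb ⟨hl, fun hi => (blockLayer_pos hb hi).ne' hl⟩
  have hlast : Agrees K d f w m (K * (d + 1)) := by
    rw [Agrees, if_pos (blockIdx_last K d), honest, honest, if_pos (blockIdx_last K d),
      if_pos (blockIdx_last K d), if_pos rfl, if_neg (by lia), h₂, h₃, layerTable, inputTable,
      blockLayer_last, blockIdx_last, Nat.add_sub_cancel, mle]
    refine ⟨?_, ?_⟩
    · have : layer f 0 = 1 := rfl
      rw [this, foldSeq_one]; rfl
    · rw [foldSeq_congr_point f hp]
  have h0 := agrees_zero hc h₁ hlast
  rw [Agrees, if_pos (by rw [blockIdx]), honest, if_pos (by rw [blockIdx]), if_pos rfl] at h0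
  rw [h0.1, layerTable, blockIdx, blockLayer, Nat.add_sub_cancel, mle]
  rfl

theorem accepts_honest {f z w : ℕ → ZMod q} {m : ℕ → ℕ → ZMod q} (hK : 0 < K)
    (hw : ∀ b < K * (d + 1), blockLayer K d b = 0 ∧ blockIdx d b ≠ d + 1 →
      w b = z (blockIdx d b - 1))
    (hm : ∀ b, ∀ t < 5, m b t = honest K d f w b t) :
    accepts K d f z w m ∧ m 0 0 = mle (fun _ => 1 / 2) d (layer f K) := by
  have hA : ∀ b, Agrees K d f w m b := fun b => by
    rw [Agrees]
    split_ifs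
    exacts [⟨hm b 0 (by lia), hm b 1 (by lia)⟩, hm b]
  have hp := point_last (w := w) (z := z) (d := d) hK fun b hb hl =>
    hw b hb ⟨hl, fun hi => (blockLayer_pos hb hi).ne' hl⟩
  refine ⟨⟨fun b hb => check_of_honest hb hA, ?_, ?_⟩, ?_⟩
  · rw [hm _ 0 (by lia), honest, if_pos (blockIdx_last K d), if_pos rfl, layerTable,
      blockLayer_last]
    have : layer f 0 = 1 := rfl
    rw [this, foldSeq_one]; rfl
  · rw [hm _ 1 (by lia), honest, if_pos (blockIdx_last K d), if_neg (by lia), inputTable,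
      blockIdx_last, Nat.add_sub_cancel, foldSeq_congr_point f hp, mle]
  · rw [hm 0 0 (by lia), honest, if_pos (by rw [blockIdx]), if_pos rfl, layerTable, blockIdx,
      blockLayer, Nat.add_sub_cancel, mle]
    rfl

/-- The position of the random element that is sent at the end of block `b`. -/
def coinIdx (K d b : ℕ) : ℕ :=
  if blockLayer K d b = 0 ∧ blockIdx d b ≠ d + 1 then blockIdx d b - 1 else d + (5 * b + 4)

theorem coin_eq (R : ℕ → ZMod q) (b : ℕ) : coin K d R b = R (coinIdx K d b) := by
  rw [coin, coinIdx]
  split_ifs <;> rfl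

/-- Secret coordinates sit at positions below d and fresh coins above. Two blocks of the last layer
have different indices by `block_eq`. -/
theorem coinIdx_ne {b b' : ℕ} (hb : b < K * (d + 1)) (h : b' < b) :
    coinIdx K d b' ≠ coinIdx K d b := by
  have h₁ := block_eq hb.le
  have h₂ := block_eq (h.trans hb).le
  have h₃ := blockIdx_le d b
  have h₄ := blockIdx_le d b'
  have h₅ := one_le_blockIdx d b'
  rw [coinIdx, coinIdx]
  split_ifs with h₆ h₇ h₇
  · rw [h₇.1] at h₁
    rw [h₆.1] at h₂
    lia
  · lia
  · lia
  · lia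

/-- The coin of a block, even if it is a secret coordinate drawn long before, is not revealed until
the messages of that block are complete. -/
theorem word_congr {R R' : ℕ → ZMod q} {b : ℕ} (hb : b < K * (d + 1))
    (h : ∀ i, i ≠ coinIdx K d b → R i = R' i) {T : ℕ} (hT : T < 5 * b + 5) :
    word K d R T = word K d R' T := by
  cases T with
  | zero => rfl
  | succ T =>
    rw [word, word]
    split_ifs with hT4
    · rw [coin_eq, coin_eq, h _ (coinIdx_ne hb (by lia))]
    · refine h _ ?_
      have := blockIdx_le d b
      have := one_le_blockIdx d b
      rw [coinIdx]
      split_ifs <;> lia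

theorem replies_congr (σ : List (ZMod q) → ZMod q) {w w' : ℕ → ZMod q} {T : ℕ}
    (h : ∀ T' ≤ T, w T' = w' T') : replies σ w T = replies σ w' T := by
  rw [replies, replies]
  congr 1
  refine List.map_congr_left fun T' hT' => h T' ?_
  rw [List.mem_range] at hT'
  lia

theorem extend_update {L : ℕ} (R : Fin L → ZMod q) (j : Fin L) (u : ZMod q) (i : ℕ) :
    extend (Function.update R j u) i = if i = j then u else extend R i := by
  rw [extend, extend]
  by_cases hi : i < L
  · rw [dif_pos hi, dif_pos hi, Function.update_apply]
    simp only [Fin.ext_iff]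
  · rw [dif_neg hi, dif_neg hi, if_neg (by lia)]

/-- Along the line in the direction of this block's coin, the received and the honest messages are
constant. Either they agree and no collision occurs, or at most four values of the coin hide the
difference. -/
theorem ncard_collision_mul_le {L : ℕ} (σ : List (ZMod q) → ZMod q) {b : ℕ}
    (hL : L = d + rounds K d) (hb : b < K * (d + 1)) :
    {R : Fin L → ZMod q | Collision K d a (coin K d (extend R))
      (fun b t => replies σ (word K d (extend R)) (5 * b + t)) b}.ncard * q ≤ 4 * q ^ L := by
  have hlt : coinIdx K d b < L := by
    have := blockIdx_le d b
    rw [hL, rounds, coinIdx]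
    split_ifs <;> lia
  have := ncard_mul_card_le (F := ZMod q) (D := 4) ⟨coinIdx K d b, hlt⟩
    {R : Fin L → ZMod q | Collision K d a (coin K d (extend R))
      (fun b t => replies σ (word K d (extend R)) (5 * b + t)) b} fun R => ?_
  · rwa [ZMod.card] at this
  have hword : ∀ u, ∀ t < 5, replies σ
      (word K d (extend (Function.update R ⟨coinIdx K d b, hlt⟩ u))) (5 * b + t) =
        replies σ (word K d (extend R)) (5 * b + t) := fun u t ht =>
    replies_congr σ fun T hT => word_congr hb (fun i hi => by
      rw [extend_update, if_neg hi]) (by lia)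
  have hcoin : ∀ u, ∀ b' < b, coin K d (extend (Function.update R ⟨coinIdx K d b, hlt⟩ u)) b' =
      coin K d (extend R) b' := fun u b' hb' => by
    rw [coin_eq, coin_eq, extend_update, if_neg (coinIdx_ne hb hb')]
  have hself : ∀ u, coin K d (extend (Function.update R ⟨coinIdx K d b, hlt⟩ u)) b = u := by
    intro u
    rw [coin_eq, extend_update, if_pos rfl]
  by_cases hA : Agrees K d a (coin K d (extend R))
      (fun b t => replies σ (word K d (extend R)) (5 * b + t)) b
  · have hempty : {u | Function.update R ⟨coinIdx K d b, hlt⟩ u ∈ {R : Fin L → ZMod q |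
        Collision K d a (coin K d (extend R))
          (fun b t => replies σ (word K d (extend R)) (5 * b + t)) b}} = ∅ := by
      refine Set.eq_empty_of_forall_notMem fun u hu => hu.1 ?_
      rw [Agrees] at hA ⊢
      simp only [honest_congr (hcoin u)]
      split_ifs at hA ⊢
      · exact ⟨(hword u 0 (by lia)).trans hA.1, (hword u 1 (by lia)).trans hA.2⟩
      · exact fun t ht => (hword u t ht).trans (hA t ht)
    rw [hempty, Set.ncard_empty]
    lia
  · rw [Agrees] at hA
    refine (Set.ncard_le_ncard (fun u hu => ?_) (Set.toFinite _)).trans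
      (ncard_nextClaim_eq_le hA)
    have h := hu.2
    rw [hself] at h
    rw [Set.mem_ofPred_eq]
    have e₁ := nextClaim_congr (d := d) (i := blockIdx d b) (w := u)
      (m := fun t => replies σ (word K d (extend R)) (5 * b + t))
      (m' := fun t => replies σ
        (word K d (extend (Function.update R ⟨coinIdx K d b, hlt⟩ u))) (5 * b + t)) (by
        split_ifs
        · exact ⟨(hword u 0 (by lia)).symm, (hword u 1 (by lia)).symm⟩
        · exact fun t ht => (hword u t ht).symm)
    have e₂ : honest K d a (coin K d (extend (Function.update R ⟨coinIdx K d b, hlt⟩ u))) b =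
        honest K d a (coin K d (extend R)) b := funext fun t => honest_congr (hcoin u) t
    rw [e₂] at h
    exact e₁.trans h

/-- Schwartz–Zippel for multilinear polynomials in the form of a union bound: the table dies at some
coordinate, and the earlier coordinates leave at most one value that can kill it there. -/
theorem ncard_mle_eq_zero_mul_le {L : ℕ} {f : ℕ → ZMod q} (hf : ∃ x < 2 ^ d, f x ≠ 0)
    (hL : d ≤ L) : ∃ S : ℕ → Set (Fin L → ZMod q),
      (∀ R, mle (extend R) d f = 0 → ∃ j < d, R ∈ S j) ∧ ∀ j < d, (S j).ncard * q ≤ 1 * q ^ L := by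
  refine ⟨fun j => {R | (∃ x < 2 * 2 ^ (d - (j + 1)), foldSeq (extend R) f j x ≠ 0) ∧
    ∀ x < 2 ^ (d - (j + 1)), fold (extend R j) (foldSeq (extend R) f j) x = 0},
    fun R hR => exists_fold_eq_zero hf hR, fun j hj => ?_⟩
  have hjL : j < L := by lia
  have := ncard_mul_card_le (F := ZMod q) (D := 1) ⟨j, hjL⟩
    {R | (∃ x < 2 * 2 ^ (d - (j + 1)), foldSeq (extend R) f j x ≠ 0) ∧
      ∀ x < 2 ^ (d - (j + 1)), fold (extend R j) (foldSeq (extend R) f j) x = 0} fun R => ?_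
  · rwa [ZMod.card] at this
  have hcongr : ∀ u, foldSeq (extend (Function.update R ⟨j, hjL⟩ u)) f j =
      foldSeq (extend R) f j := fun u =>
    foldSeq_congr_point f fun i hi => by rw [extend_update, if_neg (by lia)]
  rw [Set.ncard_le_one_iff]
  intro u u' hu hu'
  obtain ⟨h₁, h₂⟩ := hu
  obtain ⟨-, h₂'⟩ := hu'
  rw [hcongr] at h₁
  rw [hcongr, extend_update, if_pos rfl] at h₂ h₂'
  exact fold_eq_zero_unique h₁ h₂ h₂'

end Soundness

/-! ### The protocol as a whole -/

/-- What the protocol achieves, with `r` rounds and the bounds `TV` and `TP` for the times of the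
verifier and the prover. -/
structure Performs (q n m M L r TV TP : ℕ) : Prop where
  against : ∀ x ∈ streams q n m, ∀ σ : List (ZMod q) → ZMod q,
    ∃ E : Set (Fin L → ZMod q), prob E ≤ 1 / 3 ∧ ∀ R, ∃ out tV,
      RunAgainst M verifier x R σ out tV r ∧ tV ≤ TV ∧
        (R ∉ E → ∀ v, out = some v → v = distinct x)
  honest : ∀ x ∈ streams q n m, ∀ R : Fin L → ZMod q, ∃ tV tP,
    RunHonest M verifier prover x R (some (distinct x)) tV tP r ∧ tP ≤ TP

theorem prob_mono {q L : ℕ} [Fact q.Prime] {E E' : Set (Fin L → ZMod q)} (h : E ⊆ E') :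
    prob E ≤ prob E' := by
  rw [prob, prob]
  gcongr
  exact Set.toFinite _

/-- For every choice of coins some run is exhibited; by determinism any other run with the same
coins has the same output, so errors occur only inside the exceptional set. -/
theorem Performs.isValidProtocol {q n m M L r TV TP : ℕ} [Fact q.Prime]
    (h : Performs q n m M L r TV TP) :
    IsValidProtocol q M L verifier prover (streams q n m) distinct where
  complete x hx := prob_univ fun R => by
    obtain ⟨tV, tP, hR, -⟩ := h.honest x hx R
    exact ⟨tV, tP, r, hR⟩
  sound x hx σ := by
    obtain ⟨E, hE, hR⟩ := h.against x hx σ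
    refine (prob_mono fun R hv => ?_).trans hE
    obtain ⟨v, tV, k, hv, hne⟩ := hv
    obtain ⟨out, tV', hR, -, hE⟩ := hR R
    by_contra hRE
    exact hne (hE hRE v (hR.det hv))

theorem two_pow_clog_le {n : ℕ} (hn : 2 ≤ n) : 2 ^ Nat.clog 2 n ≤ 2 * n := by
  have hd := Nat.clog_pos one_lt_two hn
  have h₁ := pow_lt_iff_lt_clog.mpr (Nat.sub_lt hd one_pos)
  have h₂ : 2 ^ Nat.clog 2 n = 2 * 2 ^ (Nat.clog 2 n - 1) := by
    rw [← pow_succ', Nat.sub_add_cancel hd]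
  lia

/-! ### Validity and costs of the three modes. -/

section Modes

variable {q n m k : ℕ} [Fact q.Prime]

theorem machineNext_of_reach {N T : ℕ} {P : Machine} {p : State} {w a : ZMod q}
    {Q : State → Prop} (h : Reach q N P.respond (p.input w.val 0) T
      fun r => r.mem 0 = a.val ∧ Q r) :
    ∃ t p', machineNext q N P p w a t p' ∧ t ≤ T ∧ Q p' := by
  obtain ⟨t, r, h₁, h₂, h₃, h₄⟩ := h
  exact ⟨t, r, ⟨h₁, by rw [h₃, ZMod.natCast_zmod_val]⟩, h₂, h₄⟩

/-- No randomness and no error: the verifier counts from its own list, and the n rounds only step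
through that list. -/
theorem performs_small (hn : n < q) (hn2 : 2 ≤ n) (hq : q < 4096) :
    Performs q n m 6000 0 n (100 + m * 50 + n * 200) (100 + m * 10 + n * 40) where
  against x hx σ := by
    refine ⟨∅, by simp [prob], fun R => ?_⟩
    obtain ⟨t, s, hs, ht, hI⟩ := observes_small (q := q) (M := 6000) (l := coins R) hx.1 hn hq le_rfl
    obtain ⟨tV, tP, h₁, h₂, -⟩ := interact_local (M := 6000) (c := replies σ 0) (TP := 0)
      (PI := fun T p => p = (List.range T).map 0)
      (p := []) hn hn2 hq le_rfl hI (fun T _ p hp => strategyNext_replies σ 0 T p hp) rfl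
    refine ⟨_, t + tV, ⟨s, t, tV, tP, hs, h₁, rfl⟩, by lia, fun _ v hv => ?_⟩
    rw [countNonzero_table hx.2] at hv
    exact (Option.some.inj hv).symm
  honest x hx R := by
    obtain ⟨t, s, hs, ht, hI⟩ := observes_small (q := q) (M := 6000) (l := coins R) hx.1 hn hq le_rfl
    obtain ⟨t', p, hp, ht', hp3⟩ := prover_observes_small (q := q) hx.1 hq
    obtain ⟨tV, tP, h₁, h₂, h₃⟩ := interact_local (M := 6000) (c := 0) (TP := fun _ => 40)
      (next := machineNext q 100 prover) (PI := fun _ p => p.mem 3 = 0)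
      hn hn2 hq le_rfl hI
      (fun T _ p hp => machineNext_of_reach (a := 0) (prover_respond_small hp)) hp3
    rw [countNonzero_table hx.2] at h₁
    refine ⟨t + tV, t' + tP, ⟨100, s, p, t, tV, t', tP, hs, hp, h₁, rfl, rfl⟩, ?_⟩
    simp only [Finset.sum_const, Finset.card_range, smul_eq_mul] at h₃
    lia

/-- The field is large in comparison with the number of rounds. -/
theorem three_mul_clog_le (hn : n < q) (hq : 4096 ≤ q) (hk : q = 2 ^ k - 1) :
    12 * ((k - 1) * (Nat.clog 2 n + 1)) ≤ q ∧ 3 * (Nat.clog 2 n * 1) ≤ q ∧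
      32 * k + 1 ≤ q ∧ Nat.clog 2 n ≤ k := by
  have hdk : Nat.clog 2 n ≤ k := Nat.clog_le_of_le_pow (by lia)
  -- Since 2^k - 1 ≥ 4096, the exponent 12 is already too small.
  have hk13 : 13 ≤ k := by
    by_contra hcon
    have : 2 ^ k ≤ 2 ^ 12 := Nat.pow_le_pow_right (by lia) (by lia)
    lia
  -- The quadratic term serves the union bound over about k² blocks with four bad coins each; the
  -- linear one keeps the prover's addresses below `q ^ 2`.
  have key : 12 * (k * k) + 32 * k + 2 ≤ 2 ^ k := by
    clear hk hdk hn hq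
    induction k, hk13 using Nat.le_induction with
    | base => norm_num
    | succ k hk ih =>
      rw [pow_succ]
      nlinarith
  have h₁ : (k - 1) * (Nat.clog 2 n + 1) ≤ (k - 1) * (k + 1) := Nat.mul_le_mul_left _ (by lia)
  have h₂ : (k - 1) * (k + 1) ≤ k * k := by
    obtain ⟨j, rfl⟩ := Nat.exists_eq_add_of_le' (by lia : 1 ≤ k)
    rw [Nat.add_sub_cancel]
    nlinarith
  have h₃ : 12 * (k * k) + 32 * k + 1 ≤ q := by lia
  refine ⟨by lia, by lia, by lia, hdk⟩

/-- The verifier only ever sends 0, so the listed table is a fixed function of the strategy and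
independent of the secret point. A wrong list survives with probability at most d / q. -/
theorem performs_remote (hn : n < q) (hn2 : 2 ≤ n) (hq : 4096 ≤ q) (hk : q = 2 ^ k - 1)
    (hkn : ¬ k < n) :
    Performs q n m (6000 + 2 * Nat.clog 2 n) (Nat.clog 2 n) n
      (100 + Nat.clog 2 n * 200 + n * 100 + m * (50 + Nat.clog 2 n * 60) +
        n * (200 + Nat.clog 2 n * 60))
      (100 + Nat.clog 2 n * 200 + n * 100 + m * 60 + n * 40) := by
  set d := Nat.clog 2 n with hd
  constructor
  · intro x hx σ
    have hnd : n ≤ 2 ^ d := Nat.le_pow_clog (by lia) n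
    have hrun : ∀ R : Fin d → ZMod q, ∃ tV, RunAgainst (6000 + 2 * d) verifier x R σ
        (if mle (extend R) d (residual (table q x) (replies σ 0) n) = 0 then
          some (countNonzero (replies σ 0) n) else none) tV n ∧
        tV ≤ 100 + d * 200 + n * 100 + m * (50 + d * 60) + n * (200 + d * 60) := by
      intro R
      obtain ⟨t, s, hs, ht, hI⟩ := observes_large (q := q) (M := 6000 + 2 * d) (l := coins R)
        (z := extend R) hx.1 hn hn2 hq hk (by lia) fun i hi => drop_coins R hi
      obtain ⟨tV, tP, h₁, h₂, -⟩ := interact_remote (M := 6000 + 2 * d) (v := replies σ 0)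
        (TP := 0) (PI := fun T p => p = (List.range T).map 0) (p := []) hn hn2 hq hkn (by lia) hI
        (fun T _ p hp => strategyNext_replies σ 0 T p hp) rfl
      exact ⟨t + tV, ⟨s, t, tV, tP, hs, h₁, rfl⟩, by lia⟩
    -- Either the list is wrong and acceptance needs a zero of a nonzero extension, or it is right
    -- and the count is exact for all coins.
    by_cases hf : ∃ y < 2 ^ d, residual (table q x) (replies σ 0) n y ≠ 0
    · obtain ⟨S, hS, hS'⟩ := ncard_mle_eq_zero_mul_le (L := d) hf le_rfl
      refine ⟨{R | mle (extend R) d (residual (table q x) (replies σ 0) n) = 0},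
        prob_le_third S (fun R hR => hS R hR) hS' (three_mul_clog_le hn hq hk).2.1, fun R => ?_⟩
      obtain ⟨tV, h₁, h₂⟩ := hrun R
      refine ⟨_, tV, h₁, h₂, fun hR v hv => ?_⟩
      split_ifs at hv with h0
      exact (hR h0).elim
    · push Not at hf
      refine ⟨∅, by simp [prob], fun R => ?_⟩
      obtain ⟨tV, h₁, h₂⟩ := hrun R
      refine ⟨_, tV, h₁, h₂, fun _ v hv => ?_⟩
      have hv' : countNonzero (replies σ 0) n = v := by
        split_ifs at hv
        exact Option.some.inj hv
      rw [← hv', ← countNonzero_table hx.2, countNonzero, countNonzero]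
      congr 1
      refine Finset.filter_congr fun y hy => ?_
      rw [Finset.mem_range] at hy
      have := hf y (by lia)
      rw [residual, if_pos hy, sub_eq_zero] at this
      rw [this]
  · intro x hx R
    obtain ⟨t, s, hs, ht, hI⟩ := observes_large (q := q) (M := 6000 + 2 * d) (l := coins R)
      (z := extend R) hx.1 hn hn2 hq hk (by lia) fun i hi => drop_coins R hi
    obtain ⟨t', p, hp, ht', -, hp'⟩ := prover_observes (q := q) (k := k) hx.1 hn hn2 hq hk
    obtain ⟨tV, tP, h₁, h₂, h₃⟩ := interact_remote (M := 6000 + 2 * d) (v := table q x)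
      (TP := fun _ => 40) (next := machineNext q (q ^ 2) prover)
      (PI := fun T p => ProverList n q T (table q x) p) hn hn2 hq hkn (by lia) hI
      (fun T hT p hp => machineNext_of_reach (hp.reach (hT.trans hn) hq)) (hp' hkn)
    have hzero : residual (table q x) (table q x) n = 0 := by
      ext y
      rw [residual]
      split_ifs with hy
      · exact sub_self _
      · rw [table, dif_neg hy]; simp
    rw [hzero, if_pos (mle_zero _ _), countNonzero_table hx.2] at h₁
    refine ⟨t + tV, t' + tP, ⟨q ^ 2, s, p, t, tV, t', tP, hs, hp, h₁, rfl, rfl⟩, ?_⟩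
    simp only [Finset.sum_const, Finset.card_range, smul_eq_mul] at h₃
    lia

/-- The exceptional set is the union of the collision events, each of probability at most 4 / q. The
tape holds d secret coordinates and one coin per round. -/
theorem performs_layered (hn : n < q) (hn2 : 2 ≤ n) (hq : 4096 ≤ q) (hk : q = 2 ^ k - 1)
    (hkn : k < n) :
    Performs q n m (6000 + 2 * Nat.clog 2 n)
      (Nat.clog 2 n + rounds (k - 1) (Nat.clog 2 n)) (rounds (k - 1) (Nat.clog 2 n))
      (100 + Nat.clog 2 n * 200 + n * 100 + m * (50 + Nat.clog 2 n * 60) +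
        rounds (k - 1) (Nat.clog 2 n) * 300)
      (100 + Nat.clog 2 n * 200 + n * 100 + m * 60 + k * 2 ^ Nat.clog 2 n * 20000) := by
  obtain ⟨hq₁, -, hq₂, -⟩ := three_mul_clog_le hn hq hk
  obtain ⟨K, rfl⟩ : ∃ K, k = K + 1 := Nat.exists_eq_add_of_le' (by
    by_contra hcon
    rw [show k = 0 by lia] at hk
    lia)
  rw [Nat.add_sub_cancel] at hq₁ ⊢
  have hK : 0 < K := by
    refine Nat.pos_of_ne_zero fun h0 => ?_
    rw [h0] at hk
    lia
  set d := Nat.clog 2 n with hd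
  have hnd : n ≤ 2 ^ d := Nat.le_pow_clog (by lia) n
  have hdn : d ≤ n := clog_le_self n
  have h2d : 2 ^ d ≤ 2 * n := two_pow_clog_le hn2
  have hqq : 4096 * q ≤ q ^ 2 := by nlinarith
  -- The table of all layers has (K + 1) 2^d ≤ 2kn entries, so its addresses do not wrap around.
  have hh : (K + 1) * 2 ^ d * 16 + 200 < q ^ 2 := by
    have : (K + 1) * 2 ^ d ≤ (K + 1) * (2 * n) := Nat.mul_le_mul_left _ h2d
    have h₂ : 32 * (K + 1) * n ≤ 32 * (K + 1) * q := Nat.mul_le_mul_left _ hn.le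
    have h₃ : (32 * (K + 1) + 1) * q ≤ q * q := Nat.mul_le_mul_right q hq₂
    nlinarith
  have hw : ∀ R : Fin (d + rounds K d) → ZMod q, ∀ b < K * (d + 1),
      blockLayer K d b = 0 ∧ blockIdx d b ≠ d + 1 →
        coin K d (extend R) b = extend R (blockIdx d b - 1) := fun R b _ h => by
    rw [coin, if_pos h]
  have hobs : ∀ x ∈ streams q n m, ∀ R : Fin (d + rounds K d) → ZMod q, ∃ t s,
      verifier.Observes q (6000 + 2 * d) (coins R) x t s ∧
      t ≤ 100 + d * 200 + n * 100 + m * (50 + d * 60) ∧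
      ReadyInv n q (K + 1) (coins R) (extend R) (table q x) s := fun x hx R =>
    observes_large hx.1 hn hn2 hq hk (by lia) fun i hi => drop_coins R (by lia)
  constructor
  · intro x hx σ
    refine ⟨{R | ∃ b < K * (d + 1), Collision K d (table q x) (coin K d (extend R))
      (fun b t => replies σ (word K d (extend R)) (5 * b + t)) b}, ?_, fun R => ?_⟩
    · exact prob_le_third _ (fun R hR => hR)
        (fun b hb => ncard_collision_mul_le σ rfl hb) (by lia)
    · obtain ⟨t, s, hs, ht, hI⟩ := hobs x hx R
      obtain ⟨tV, tP, h₁, h₂, -⟩ := interact_layered (K := K) (M := 6000 + 2 * d)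
        (v := replies σ (word K d (extend R)))
        (TP := 0) (PI := fun T p => p = (List.range T).map (word K d (extend R))) (p := []) hn hq
        hkn rfl rfl (by lia) hI (fun T _ p hp => strategyNext_replies σ _ T p hp) rfl
      refine ⟨_, t + tV, ⟨s, t, tV, tP, hs, h₁, rfl⟩, by lia, fun hR v hv => ?_⟩
      split_ifs at hv with hacc
      have hm := accepts_sound hK (hw R) hacc fun b hb hc => hR ⟨b, hb, hc⟩
      simp only [Nat.mul_zero, Nat.add_zero] at hm
      rw [hm, two_pow_mul_mle_layer hx.2 hn hnd (by lia) hk] at hv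
      exact (Option.some.inj hv).symm
  · intro x hx R
    obtain ⟨t, s, hs, ht, hI⟩ := hobs x hx R
    obtain ⟨t', p, hp, ht', hp', -⟩ := prover_observes (q := q) (k := K + 1) hx.1 hn hn2 hq hk
    obtain ⟨tV, tP, h₁, h₂, h₃⟩ := interact_layered (K := K) (M := 6000 + 2 * d)
      (v := fun T => honest K d (table q x) (coin K d (extend R)) (T / 5) (T % 5))
      (TP := answerTime K d) (next := machineNext q (q ^ 2) prover)
      (PI := AnswerInv K d (table q x) (coin K d (extend R))) (p := p) hn hq
      hkn rfl rfl (by lia) hI (fun T hT p hp => machineNext_of_reach (reach_answer (by lia) hh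
        (by lia) (fun b hb => by rw [hb, word_block]) hp))
      (by rw [AnswerInv, if_pos rfl]; exact hp' hkn)
    obtain ⟨hacc, hm⟩ := accepts_honest (z := extend R) (f := table q x)
      (m := fun b t => honest K d (table q x) (coin K d (extend R)) ((5 * b + t) / 5)
        ((5 * b + t) % 5)) hK (hw R) fun b t ht => by
          rw [show (5 * b + t) / 5 = b by lia, show (5 * b + t) % 5 = t by lia]
    simp only [Nat.mul_zero, Nat.add_zero] at hm
    rw [if_pos hacc, hm, two_pow_mul_mle_layer hx.2 hn hnd (by lia) hk] at h₁
    refine ⟨t + tV, t' + tP, ⟨q ^ 2, s, p, t, tV, t', tP, hs, hp, h₁, rfl, rfl⟩, ?_⟩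
    have := sum_answerTime_le K d
    lia

/-- The three cases, with common bounds. -/
theorem exists_performs (hn : n < q) (hn2 : 2 ≤ n) (hk : q = 2 ^ k - 1) :
    ∃ M L r TV TP, Performs q n m M L r TV TP ∧ M ≤ 7000 * Nat.clog 2 n ∧
      r ≤ 4096 * (Nat.clog 2 n * k) ∧ TV ≤ 4000 * ((n + m) * Nat.clog 2 n) ∧
      TP ≤ 50000 * ((n + m) * k) := by
  have hd1 : 1 ≤ Nat.clog 2 n := Nat.clog_pos (by lia) hn2
  have hk1 : 1 ≤ k := by
    by_contra hcon
    rw [show k = 0 by lia] at hk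
    lia
  have hdn := clog_le_self n
  have hnd : n ≤ n * Nat.clog 2 n := Nat.le_mul_of_pos_right n hd1
  have hmd : m ≤ m * Nat.clog 2 n := Nat.le_mul_of_pos_right m hd1
  have hnk : n ≤ n * k := Nat.le_mul_of_pos_right n hk1
  have hmk : m ≤ m * k := Nat.le_mul_of_pos_right m hk1
  have hdk : k ≤ Nat.clog 2 n * k := Nat.le_mul_of_pos_left k hd1
  by_cases hq : q < 4096
  · refine ⟨_, _, _, _, _, performs_small hn hn2 hq, by lia, by lia, ?_, ?_⟩ <;> rw [add_mul] <;>
      lia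
  push Not at hq
  by_cases hkn : k < n
  · have h2d : 2 ^ Nat.clog 2 n ≤ 2 * n := two_pow_clog_le hn2
    have h₁ : k * 2 ^ Nat.clog 2 n ≤ k * (2 * n) := Nat.mul_le_mul_left k h2d
    have h₂ : rounds (k - 1) (Nat.clog 2 n) ≤ 10 * (Nat.clog 2 n * k) := by
      obtain ⟨K, rfl⟩ := Nat.exists_eq_add_of_le' hk1
      rw [rounds, Nat.add_sub_cancel]
      generalize Nat.clog 2 n = d at *
      nlinarith
    -- This is what k < n is for: the rounds, of order d k, are absorbed by the verifier's O(n d)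
    -- time.
    have h₃ : Nat.clog 2 n * k ≤ Nat.clog 2 n * n := Nat.mul_le_mul_left _ hkn.le
    have h₄ : k * (2 * n) = 2 * (n * k) := by ring
    have h₅ : Nat.clog 2 n * n = n * Nat.clog 2 n := mul_comm _ _
    refine ⟨_, _, _, _, _, performs_layered hn hn2 hq hk hkn, by lia, by lia, ?_, ?_⟩
    · rw [add_mul, mul_add, mul_comm (Nat.clog 2 n) 60]
      have h₆ : m * (60 * Nat.clog 2 n) = 60 * (m * Nat.clog 2 n) := by ring
      lia
    · rw [add_mul]
      lia
  · refine ⟨_, _, _, _, _, performs_remote hn hn2 hq hk hkn, by lia, by lia, ?_, ?_⟩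
    · have h₆ : m * (50 + Nat.clog 2 n * 60) = m * 50 + 60 * (m * Nat.clog 2 n) := by ring
      have h₇ : n * (200 + Nat.clog 2 n * 60) = n * 200 + 60 * (n * Nat.clog 2 n) := by ring
      rw [add_mul]
      lia
    · rw [add_mul]
      lia

end Modes

/-- Taking logarithms gives a ≤ (2 / log 2) log b, and 2 / log 2 < 3. -/
theorem le_three_mul_log {a b : ℕ} (hb : 2 ≤ b) (h : 2 ^ a ≤ b ^ 2) :
    (a : ℝ) ≤ 3 * Real.log b := by
  have h₁ : ((2 : ℝ) ^ a) ≤ (b : ℝ) ^ 2 := by exact_mod_cast h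
  have h₂ := Real.log_le_log (by positivity) h₁
  rw [Real.log_pow, Real.log_pow] at h₂
  have h₃ := Real.log_two_gt_d9
  push_cast at h₂
  have h₄ : (0 : ℝ) ≤ a := by positivity
  nlinarith

end StreamIP

theorem corollary2 :
    ∃ V P : StreamIP.Machine, ∀ c : ℝ, ∃ C : ℝ, ∀ q n m : ℕ,
      Nat.Prime q → (∃ k : ℕ, q = mersenne k) → max m n < q → 2 ≤ n →
      (m : ℝ) ≤ c * n → (n : ℝ) ≤ c * m →
      ∃ M L : ℕ,
        -- validity
        StreamIP.IsValidProtocol q M L V P (StreamIP.streams q n m) StreamIP.distinct ∧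
        -- space of the verifier: `M` words, each of the size of two field elements
        ((2 * M : ℕ) : ℝ) ≤ C * Real.log n ∧
        -- communication (two field elements per round) and time of the verifier, for any prover
        (∀ x ∈ StreamIP.streams q n m, ∀ (σ : List (ZMod q) → ZMod q) (R : Fin L → ZMod q),
          ∃ (out : Option ℕ) (tV k : ℕ),
            StreamIP.RunAgainst M V x R σ out tV k ∧
            ((2 * k : ℕ) : ℝ) ≤ C * (Real.log n * Real.log q) ∧
            (tV : ℝ) ≤ C * (m * Real.log n)) ∧
        -- time of the prover
        (∀ x ∈ StreamIP.streams q n m, ∀ R : Fin L → ZMod q,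
          ∃ (out : Option ℕ) (tV tP k : ℕ),
            StreamIP.RunHonest M V P x R out tV tP k ∧
            (tP : ℝ) ≤ C * (n * Real.log q)) := by
  refine ⟨StreamIP.verifier, StreamIP.prover, fun c => ⟨1000000 * (1 + c), fun q n m hp ⟨k, hk⟩ hmn hn2 hm hn => ?_⟩⟩
  haveI := Fact.mk hp
  have hk : q = 2 ^ k - 1 := hk
  have hnq : n < q := (le_max_right m n).trans_lt hmn
  obtain ⟨M, L, r, TV, TP, hperf, hM, hr, hTV, hTP⟩ := StreamIP.exists_performs (m := m) hnq hn2 hk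
  -- Rounding up is absorbed by the square: 2^d ≤ 2n ≤ n², and below 2^k = q + 1 ≤ q².
  have hd := StreamIP.le_three_mul_log (a := Nat.clog 2 n) hn2
    ((StreamIP.two_pow_clog_le hn2).trans (by nlinarith))
  have hkq := StreamIP.le_three_mul_log (a := k) (b := q) (by lia) (by
    have : 2 ^ k = q + 1 := by lia
    nlinarith)
  generalize Nat.clog 2 n = d at *
  have hln : 0 ≤ Real.log n := Real.log_natCast_nonneg n
  have hlq : 0 ≤ Real.log q := Real.log_natCast_nonneg q
  have hn0 : (2 : ℝ) ≤ n := by exact_mod_cast hn2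
  have hm0 : (0 : ℝ) ≤ m := by positivity
  have hc : 0 ≤ c := by
    by_contra hcon
    nlinarith
  have hM' : ((2 * M : ℕ) : ℝ) ≤ 14000 * d := by exact_mod_cast (by lia : 2 * M ≤ 14000 * d)
  have hr' : ((2 * r : ℕ) : ℝ) ≤ 8192 * (d * k) := by
    exact_mod_cast (by lia : 2 * r ≤ 8192 * (d * k))
  have hTV' : (TV : ℝ) ≤ 4000 * ((n + m) * d) := by exact_mod_cast hTV
  have hTP' : (TP : ℝ) ≤ 50000 * ((n + m) * k) := by exact_mod_cast hTP
  have hdk : (d : ℝ) * k ≤ (3 * Real.log n) * (3 * Real.log q) := by gcongr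
  -- The verifier's bound is stated in m and uses n ≤ c m; the prover's is stated in n and uses m ≤
  -- c n.
  have hnm : (n + m : ℝ) * d ≤ ((1 + c) * m) * (3 * Real.log n) := by
    gcongr
    linarith
  have hnm' : (n + m : ℝ) * k ≤ ((1 + c) * n) * (3 * Real.log q) := by
    gcongr
    linarith
  have p₁ := mul_nonneg hc hln
  have p₂ := mul_nonneg hc (mul_nonneg hln hlq)
  have p₃ := mul_nonneg hln hlq
  have p₄ : 0 ≤ (1 + c) * (m * Real.log n) := by positivity
  have p₅ : 0 ≤ (1 + c) * (n * Real.log q) := by positivity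
  refine ⟨M, L, hperf.isValidProtocol, by linarith, fun x hx σ R => ?_, fun x hx R => ?_⟩
  · obtain ⟨E, -, hE⟩ := hperf.against x hx σ
    obtain ⟨out, tV, h₁, h₂, -⟩ := hE R
    have : (tV : ℝ) ≤ TV := by exact_mod_cast h₂
    exact ⟨out, tV, r, h₁, by linarith, by linarith⟩
  · obtain ⟨tV, tP, h₁, h₂⟩ := hperf.honest x hx R
    have : (tP : ℝ) ≤ TP := by exact_mod_cast h₂
    exact ⟨_, tV, tP, r, h₁, by linarith⟩
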